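/- Let $\mathbb{M}$ be a monster model of a complete first-order theory $T$, that is, $\mathbb{M}$ is $\kappa$-saturated and strongly $\kappa$-homogeneous for a sufficiently large cardinal $\kappa$ (larger than the language, and such that $\beth_{(2^{\mu})^{+}}<\kappa$ for all $\mu<\kappa$); "small" means of size less than $\kappa$, all tuples and sets are small and taken in $\mathbb{M}$, $M\prec\mathbb{M}$ always denotes a small model, and global types are complete types over $\mathbb{M}$. A global type $p(x)$ is *$M$-invariant* if $\varphi(x,c)\in p$ and $c'\equiv_M c$ imply $\varphi(x,c')\in p$. A sequence $(c_i)_{i<\omega}$ is a *Morley sequence over $M$ in the $M$-invariant type $p$* if $c_i\models p|_{M\{c_j : j<i\}}$ for all $i$; an *invariant Morley sequence over $M$* is a Morley sequence over $M$ in some $M$-invariant global type. A formula $\varphi(x,c)$ *Kim-divides* (resp. *Conant-divides*) over $M$ if for some (resp. for every) invariant Morley sequence $(c_i)_{i<\omega}$ over $M$ with $c_0=c$ the set $\{\varphi(x,c_i):i<\omega\}$ is inconsistent; it *Kim-forks* over $M$ if it implies a finite disjunction of formulas that Kim-divide over $M$. For sets $A,B$ write - $A\perp^{i}_M B$ if $\mathrm{tp}(A/MB)$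 extends to a global $M$-invariant type; - $A\perp^{f}_M B$ if $\mathrm{tp}(A/MB)$ contains no formula forking over $M$; - $A\perp^{K}_M B$ if $\mathrm{tp}(A/MB)$ contains no formula Kim-forking over $M$; - $A\perp^{K^{*}d}_M B$ if $\mathrm{tp}(A/MB)$ contains no formula Conant-dividing over $M$. A relation $\perp$ is *symmetric* if $A\perp_M B$ implies $B\perp_M A$ for all $M$, $A$, $B$. It satisfies the *chain condition* if, for all $M,A,B$ with $A\perp_M B$ and every invariant Morley sequence $I=(B_i)_{i<\omega}$ over $M$ with $B_0=B$, there is $I'\equiv_{MB}I$ indiscernible over $MA$ with $A\perp_M I'$. The theory $T$ is $\mathrm{NSOP}_3$ if there is no formula $R(x_1,x_2)$ such that no $c_1,c_2,c_3$ satisfy $R(c_1,c_2)\wedge R(c_2,c_3)\wedge R(c_3,c_1)$, while some sequence $(a_i)_{i<\omega}$ satisfies $R(a_i,a_j)$ for all $i<j$. **Theorem.** Assume that $T$ is $\mathrm{NSOP}_3$ and that $\perp^{K^{*}d}$ is symmetric. Let $p(x)$ be an $M$-invariant global type, let $a,b\supseteq M$ be small sets with $a\perp^{i}_M b$, and let $I,J$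 be Morley sequences over $M$ in $p(x)$ (indexed by $\omega$) that are indiscernible over $a$ and over $b$ respectively, with $I\perp^{K}_M a$. Then there is $I''$ with $I''\equiv_a I$, $I''\equiv_b J$ and $I''\perp^{K^{*}d}_M ab$. Moreover, if $\perp^{f}$ (resp. $\perp^{K}$) satisfies the chain condition, the same conclusion holds when the assumption $a\perp^{i}_M b$ is replaced by $a\perp^{f}_M b$ (resp. $a\perp^{K}_M b$). -/

import Mathlib

open FirstOrder Cardinal

universe u v w

namespace Monster

section Basic

variable (L : FirstOrder.Language.{u, v}) {𝕄 : Type w} [L.Structure 𝕄]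

/-- `x ≡_A y`: the tuples `x` and `y` satisfy the same formulas with parameters in `A`.
A formula over `A` in the variables `ι` is a formula in the variables `A ⊕ ι`, where the elements
of `A` are plugged in for the first block of variables. -/
def SameType (A : Set 𝕄) {ι : Type*} (x y : ι → 𝕄) : Prop :=
  ∀ φ : L.Formula (A ⊕ ι),
    φ.Realize (Sum.elim ((↑) : A → 𝕄) x) ↔ φ.Realize (Sum.elim ((↑) : A → 𝕄) y)

/-- `𝕄` is `κ`-saturated: every finitely satisfiable set of formulas in one variable over a set of
fewer than `κ` parameters is realized. -/
def IsSaturated (𝕄 : Type w) [L.Structure 𝕄] (κ : Cardinal.{w}) : Prop :=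
  ∀ A : Set 𝕄, #A < κ → ∀ Γ : Set (L.Formula (A ⊕ Unit)),
    (∀ Δ ⊆ Γ, Δ.Finite → ∃ x : 𝕄, ∀ φ ∈ Δ, φ.Realize (Sum.elim ((↑) : A → 𝕄) fun _ => x)) →
      ∃ x : 𝕄, ∀ φ ∈ Γ, φ.Realize (Sum.elim ((↑) : A → 𝕄) fun _ => x)

/-- `𝕄` is strongly `κ`-homogeneous: every elementary map from a subset of fewer than `κ` elements
into `𝕄` extends to an automorphism. -/
def IsStronglyHomogeneous (𝕄 : Type w) [L.Structure 𝕄] (κ : Cardinal.{w}) : Prop :=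
  ∀ A : Set 𝕄, #A < κ → ∀ f : A → 𝕄,
    (∀ φ : L.Formula A, φ.Realize ((↑) : A → 𝕄) ↔ φ.Realize f) →
      ∃ σ : 𝕄 ≃[L] 𝕄, ∀ a : A, σ a = f a

/-- `𝕄` is a monster model (of its complete theory): it is `κ`-saturated and strongly
`κ`-homogeneous, where `κ` is larger than the language and large enough for extracting
indiscernible sequences from long sequences of small tuples. Small means of size less than `κ`. -/
structure IsMonster (𝕄 : Type w) [L.Structure 𝕄] (κ : Cardinal.{w}) : Prop where
  card_lt : Cardinal.lift.{w} L.card < Cardinal.lift.{max u v} κ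
  large : ∀ μ < κ, ℶ_ (Order.succ ((2 : Cardinal.{w}) ^ μ)).ord < κ
  saturated : IsSaturated L 𝕄 κ
  homogeneous : IsStronglyHomogeneous L 𝕄 κ

/-- `NSOP_n` for the complete theory of `𝕄`: no formula `R(x₁, x₂)` without `n`-cycles admits an
infinite sequence of tuples with `R(a i, a j)` for all `i < j`. In a cycle, `i + 1` is read
modulo `n`. -/
def IsNSOP (𝕄 : Type w) [L.Structure 𝕄] (n : ℕ) [NeZero n] : Prop :=
  ¬ ∃ (k : ℕ) (R : L.Formula (Fin k ⊕ Fin k)),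
    (¬ ∃ c : Fin n → Fin k → 𝕄, ∀ i : Fin n, R.Realize (Sum.elim (c i) (c (i + 1)))) ∧
      ∃ a : ℕ → Fin k → 𝕄, ∀ i j : ℕ, i < j → R.Realize (Sum.elim (a i) (a j))

/-- A sequence `I` of tuples is indiscernible over the set `A`. -/
def IsIndiscernible (A : Set 𝕄) {α : Type*} (I : ℕ → α → 𝕄) : Prop :=
  ∀ (n : ℕ) (f g : Fin n → ℕ), StrictMono f → StrictMono g →
    SameType L A (fun x : Fin n × α => I (f x.1) x.2) (fun x : Fin n × α => I (g x.1) x.2)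

/-- The set of all elements occurring in the tuples of the sequence `I`. -/
def seqSet {𝕄 : Type w} {α : Type*} (I : ℕ → α → 𝕄) : Set 𝕄 := {x | ∃ i j, I i j = x}

/-- `I ≡_A J` for sequences of tuples. -/
def SameTypeSeq (A : Set 𝕄) {α : Type*} (I J : ℕ → α → 𝕄) : Prop :=
  SameType L A (fun x : ℕ × α => I x.1 x.2) (fun x : ℕ × α => J x.1 x.2)

end Basic

/-- A global type in the variables `α`: a complete type over the model `𝕄`. -/
abbrev GlobalType (L : FirstOrder.Language.{u, v}) (𝕄 : Type w) [L.Structure 𝕄] (α : Type*) :=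
  (L.elementaryDiagram 𝕄).CompleteType α

section Types

variable {L : FirstOrder.Language.{u, v}} {𝕄 : Type w} [L.Structure 𝕄] {α : Type*}

/-- `φ(x, c) ∈ p`, where `φ` is an `L`-formula, `x` are the variables `α` of `p`, and the tuple `c`
from `𝕄` is plugged in for the variables `γ` of `φ`. -/
def Contains (p : GlobalType L 𝕄 α) {γ : Type*} (φ : L.Formula (γ ⊕ α)) (c : γ → 𝕄) : Prop :=
  FirstOrder.Language.Formula.equivSentence
    (FirstOrder.Language.BoundedFormula.constantsVarsEquiv.symm (φ.relabel (Sum.map c id)) :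
      (L.withConstants 𝕄).Formula α) ∈ p

/-- `p` is invariant over `M`: if `φ(x, c) ∈ p` and `c' ≡_M c`, then `φ(x, c') ∈ p`. -/
def IsInvariant (M : Set 𝕄) (p : GlobalType L 𝕄 α) : Prop :=
  ∀ (n : ℕ) (φ : L.Formula (Fin n ⊕ α)) (c c' : Fin n → 𝕄),
    SameType L M c c' → Contains p φ c → Contains p φ c'

/-- `a ⊨ p|_A`. -/
def RealizesOver (p : GlobalType L 𝕄 α) (A : Set 𝕄) (a : α → 𝕄) : Prop :=
  ∀ φ : L.Formula (A ⊕ α), Contains p φ ((↑) : A → 𝕄) → φ.Realize (Sum.elim ((↑) : A → 𝕄) a)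

/-- `I` is a Morley sequence in `p` over `M`: `I i ⊨ p|_{M ∪ {I j : j < i}}` for all `i`. -/
def IsMorleySeqIn (p : GlobalType L 𝕄 α) (M : Set 𝕄) (I : ℕ → α → 𝕄) : Prop :=
  ∀ i, RealizesOver p (M ∪ {x | ∃ j < i, ∃ k, I j k = x}) (I i)

end Types

section Independence

variable (L : FirstOrder.Language.{u, v}) {𝕄 : Type w} [L.Structure 𝕄]

/-- `I` is an invariant Morley sequence over `M`. -/
def IsInvariantMorley (M : Set 𝕄) {α : Type*} (I : ℕ → α → 𝕄) : Prop :=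
  ∃ p : GlobalType L 𝕄 α, IsInvariant M p ∧ IsMorleySeqIn p M I

/-- A formula `φ(x, b)` in the variables `x = (x_0, …, x_{m-1})`, with a finite tuple `b` of
parameters from `𝕄` (dummy parameters are allowed). -/
structure ParamFormula (𝕄 : Type w) (m : ℕ) where
  n : ℕ
  formula : L.Formula (Fin n ⊕ Fin m)
  param : Fin n → 𝕄

variable {L}

/-- `⊨ φ(a, b)`. -/
def ParamFormula.Holds {m : ℕ} (φ : ParamFormula L 𝕄 m) (a : Fin m → 𝕄) : Prop :=
  φ.formula.Realize (Sum.elim φ.param a)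

/-- `{φ(x, b_i) : i < ω}` is consistent, for a sequence of tuples `b_i`. -/
def ParamFormula.ConsistentAlong {m : ℕ} (φ : ParamFormula L 𝕄 m) (b : ℕ → Fin φ.n → 𝕄) : Prop :=
  ∀ k : ℕ, ∃ a : Fin m → 𝕄, ∀ i < k, φ.formula.Realize (Sum.elim (b i) a)

/-- `φ(x, b)` divides over `M`. -/
def Divides (M : Set 𝕄) {m : ℕ} (φ : ParamFormula L 𝕄 m) : Prop :=
  ∃ b : ℕ → Fin φ.n → 𝕄, b 0 = φ.param ∧ IsIndiscernible L M b ∧ ¬ φ.ConsistentAlong b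

/-- `φ(x, b)` Kim-divides over `M`: some invariant Morley sequence over `M` starting with `b`
makes `{φ(x, b_i)}` inconsistent. -/
def KimDivides (M : Set 𝕄) {m : ℕ} (φ : ParamFormula L 𝕄 m) : Prop :=
  ∃ b : ℕ → Fin φ.n → 𝕄, b 0 = φ.param ∧ IsInvariantMorley L M b ∧ ¬ φ.ConsistentAlong b

/-- `φ(x, b)` Conant-divides over `M`: every invariant Morley sequence over `M` starting with `b`
makes `{φ(x, b_i)}` inconsistent. -/
def ConantDivides (M : Set 𝕄) {m : ℕ} (φ : ParamFormula L 𝕄 m) : Prop :=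
  ∀ b : ℕ → Fin φ.n → 𝕄, b 0 = φ.param → IsInvariantMorley L M b → ¬ φ.ConsistentAlong b

/-- `φ` implies a finite disjunction of formulas with the property `D`. -/
def ImpliesDisj {m : ℕ} (D : ParamFormula L 𝕄 m → Prop) (φ : ParamFormula L 𝕄 m) : Prop :=
  ∃ S : Set (ParamFormula L 𝕄 m), S.Finite ∧ (∀ ψ ∈ S, D ψ) ∧
    ∀ a : Fin m → 𝕄, φ.Holds a → ∃ ψ ∈ S, ψ.Holds a

/-- `φ(x, b)` forks over `M`. -/
def Forks (M : Set 𝕄) {m : ℕ} (φ : ParamFormula L 𝕄 m) : Prop := ImpliesDisj (Divides M) φ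

/-- `φ(x, b)` Kim-forks over `M`. -/
def KimForks (M : Set 𝕄) {m : ℕ} (φ : ParamFormula L 𝕄 m) : Prop := ImpliesDisj (KimDivides M) φ

/-- `tp(A/MB)` contains no formula with the property `D`. -/
def Avoids (D : ∀ {m : ℕ}, ParamFormula L 𝕄 m → Prop) (M A B : Set 𝕄) : Prop :=
  ∀ (m : ℕ) (a : Fin m → 𝕄) (φ : ParamFormula L 𝕄 m),
    (∀ i, a i ∈ A) → (∀ j, φ.param j ∈ M ∪ B) → φ.Holds a → ¬ D φ

variable (L)

/-- `A ⫝^i_M B`: `tp(A/MB)` extends to a global `M`-invariant type. -/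
def InvIndep (M A B : Set 𝕄) : Prop :=
  ∃ p : GlobalType L 𝕄 A, IsInvariant M p ∧ RealizesOver p (M ∪ B) ((↑) : A → 𝕄)

/-- `A ⫝^f_M B`: forking-independence. -/
def ForkIndep (M A B : Set 𝕄) : Prop := Avoids (L := L) (Forks M) M A B

/-- `A ⫝^K_M B`: Kim-independence. -/
def KimIndep (M A B : Set 𝕄) : Prop := Avoids (L := L) (KimForks M) M A B

/-- `A ⫝^{K*d}_M B`: `tp(A/MB)` contains no formula that Conant-divides over `M`. -/
def ConantDivIndep (M A B : Set 𝕄) : Prop := Avoids (L := L) (ConantDivides M) M A B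

/-- The ternary relation `R` (written `R M A B` for `A ⫝_M B`) is symmetric, over small models and
for small sets. -/
def IsSymmetricRel (κ : Cardinal.{w}) (R : Set 𝕄 → Set 𝕄 → Set 𝕄 → Prop) : Prop :=
  ∀ M : L.ElementarySubstructure 𝕄, #M < κ → ∀ A B : Set 𝕄, #A < κ → #B < κ →
    R M A B → R M B A

/-- The chain condition with respect to invariant Morley sequences: if `A ⫝_M B` and `I` is an
invariant Morley sequence over `M` whose first term is (the enumeration of) `B`, then there is
`I' ≡_{MB} I`, indiscernible over `MA`, with `A ⫝_M I'`. -/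
def ChainCondition (κ : Cardinal.{w}) (R : Set 𝕄 → Set 𝕄 → Set 𝕄 → Prop) : Prop :=
  ∀ M : L.ElementarySubstructure 𝕄, #M < κ → ∀ A B : Set 𝕄, #A < κ → #B < κ →
    R M A B → ∀ I : ℕ → B → 𝕄, I 0 = ((↑) : B → 𝕄) → IsInvariantMorley L (M : Set 𝕄) I →
      ∃ I' : ℕ → B → 𝕄, SameTypeSeq L ((M : Set 𝕄) ∪ B) I' I ∧
        IsIndiscernible L ((M : Set 𝕄) ∪ A) I' ∧ R M A (seqSet I')

end Independence

end Monster

-- The problem is one about pairs of formulas. Let `q` be an `M`-invariant type of finite tuples,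
-- with Φ(·, a) true along one Morley sequence in `q` and Ψ(·, b) along another; the pair is
-- amalgamated when Φ(x, a) ∧ Ψ(x, b) has a solution. By compactness, and by selecting finitely many
-- coordinates from consecutive blocks of I and J, a common realization of tp(I/a) and tp(J/b)
-- reduces to such pairs (`exists_amalgam`). A sequence K indiscernible over ab is then extracted
-- from that realization. Indiscernibility forbids Conant-dividing in tp(ab/MK)
-- (`IsIndiscernible.conantDivIndep`), and symmetry turns this into the required independence.
--
-- NSOP₃ is used only through `IsNSOP.not_inconsistent`: if Φ(c_j, a_i) and Ψ(c_i, b_j) hold for all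
-- i < j, then Φ(x, a_j) ∧ Ψ(x, b_i) is consistent for some i < j. Each amalgamation argument
-- assumes a failure and spreads it along such a configuration. What varies is the order in which
-- the a's, b's and c's are chosen, hence which of them may realize an invariant type over the
-- others.
--
-- The working notion is `Nice`. If `r` is nice over `q` for Φ, amalgamation with every Ψ(·, b) that
-- holds along a Morley sequence in `q` belongs to `r` (`Nice.exists_and_mem`). Nice types have two
-- sources. Kim-independence of I from a gives consistency along every Morley sequence starting with
-- a, and this makes every invariant extension of tp(a/M) nice (`nice_of_isMorleyOn`). Without
-- Kim-independence, symmetry of Conant-independence still provides one nice invariant extension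
-- (`exists_nice`, resting on `exists_copy`).
--
-- If tp(a/Mb) extends to an invariant type, that type is nice and a realizes it over Mb, so the
-- pair is amalgamated. Under a chain condition, suppose the pair is not amalgamated. Choose an
-- extension `s` of tp(b/M) that is nice for Ψ. A Morley sequence in `s` starting with b can be made
-- indiscernible over Ma, so the failure holds along it. Now `exists_nice` applies to the failure
-- relation itself and gives a type `t` of a. Alternating realizations of `t` and `s`
-- (`Nice.exists_alternating`), together with the niceness of both types over `q`, contradict NSOP₃
-- (`exists_and_of_chain`).

universe z z'

set_option linter.unusedSectionVars false

namespace Monster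

open Set

/-! ### Definable sets, equality of types and automorphisms. -/

section Definability

variable {L : FirstOrder.Language.{u, v}} {𝕄 : Type w} [L.Structure 𝕄]

/-- Substituting elements of `A` for some of the variables preserves definability over `A`. -/
theorem definable_preimage_subst {ι γ : Type*} {A : Set 𝕄} {S : Set (γ → 𝕄)}
    (hS : A.Definable L S) (f : γ → ι ⊕ A) :
    A.Definable L {x : ι → 𝕄 | (fun i => Sum.elim x ((↑) : A → 𝕄) (f i)) ∈ S} := by
  obtain ⟨φ, rfl⟩ := definable_iff_exists_formula_sum.1 hS
  refine definable_iff_exists_formula_sum.2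
    ⟨φ.relabel (Sum.elim Sum.inl fun i => (f i).swap), ?_⟩
  ext x
  simp only [mem_ofPred_eq, Language.Formula.realize_relabel]
  refine iff_of_eq (congrArg _ (funext fun i => ?_))
  rcases i with i | i
  · rfl
  · simp only [Sum.elim_inr, Function.comp_apply]
    rcases f i with j | j <;> rfl

/-- A definable set depends on finitely many coordinates only. -/
theorem exists_finset_support {ι : Type*} {A : Set 𝕄} {S : Set (ι → 𝕄)} (hS : A.Definable L S) :
    ∃ (F : Finset ι) (S' : Set (F → 𝕄)), A.Definable L S' ∧
      S = {x | (fun i : F => x i) ∈ S'} := by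
  classical
  obtain ⟨φ, rfl⟩ := definable_iff_exists_formula_sum.1 hS
  let F : Finset ι := φ.freeVarFinset.toRight
  refine ⟨F, {x | Language.Formula.Realize (M := 𝕄) (φ.restrictFreeVar fun x => Sum.casesOn x.1
        (fun (x : A) (_ : Sum.inl x ∈ φ.freeVarFinset) => (Sum.inl x : A ⊕ F))
        (fun x hx => Sum.inr ⟨x, by simp [F, hx]⟩) x.2)
      (Sum.elim ((↑) : A → 𝕄) x)}, definable_iff_exists_formula_sum.2 ⟨_, rfl⟩, ?_⟩
  ext x
  refine iff_comm.1 (Language.BoundedFormula.realize_restrictFreeVar _ ?_)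
  rintro ⟨i | i, hi⟩ <;> rfl

/-- Projections of definable sets to finitely many coordinates are definable. -/
theorem definable_image_comp [Nonempty 𝕄] {ι γ : Type*} [Finite γ] {A : Set 𝕄} {S : Set (ι → 𝕄)}
    (hS : A.Definable L S) (f : γ → ι) :
    A.Definable L {y : γ → 𝕄 | ∃ x ∈ S, ∀ i, y i = x (f i)} := by
  classical
  obtain ⟨F, S', hS', rfl⟩ := exists_finset_support hS
  cases nonempty_fintype γ
  let G : Finset ι := F ∪ Finset.univ.image f
  have hFG : ∀ i : F, (i : ι) ∈ G := fun i => Finset.mem_union_left _ i.2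
  have hfG : ∀ i, f i ∈ G := fun i => Finset.mem_union_right _ (by simp)
  have h := (hS'.preimage_comp (fun i : F => (⟨i, hFG i⟩ : G))).image_comp
    (fun i : γ => (⟨f i, hfG i⟩ : G))
  refine (congrArg _ (ext fun y => ?_)).mp h
  constructor
  · rintro ⟨x, hx, rfl⟩
    refine ⟨fun i => if h : i ∈ G then x ⟨i, h⟩ else Classical.arbitrary 𝕄, ?_, fun i => ?_⟩
    · simp only [mem_ofPred_eq]
      have : (fun i : F => if h : (i : ι) ∈ G then x ⟨i, h⟩ else Classical.arbitrary 𝕄)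
          = x ∘ fun i : F => (⟨i, hFG i⟩ : G) := by
        funext i; simp [hFG i]
      rw [this]; exact hx
    · simp [hfG i]
  · rintro ⟨x, hx, hy⟩
    exact ⟨fun i => x i, hx, (funext hy).symm⟩

theorem definable_finite_param {ι : Type*} {A : Set 𝕄} {S : Set (ι → 𝕄)}
    (hS : A.Definable L S) : ∃ A₀ : Set 𝕄, A₀.Finite ∧ A₀ ⊆ A ∧ A₀.Definable L S := by
  obtain ⟨A₀, h, h'⟩ := definable_iff_finitely_definable.1 hS
  exact ⟨A₀, A₀.finite_toSet, h, h'⟩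

theorem definable_sInter {ι : Type*} {A : Set 𝕄} {𝒮 : Set (Set (ι → 𝕄))} (h𝒮 : 𝒮.Finite)
    (h : ∀ S ∈ 𝒮, A.Definable L S) :
    A.Definable L (⋂₀ 𝒮) := by
  induction 𝒮, h𝒮 using Set.Finite.induction_on with
  | empty => simp
  | insert _ _ ih =>
    rw [sInter_insert]
    exact (h _ (mem_insert _ _)).inter (ih fun _ hS => h _ (mem_insert_of_mem _ hS))

theorem definable_forall_finite {ι τ : Type*} [Finite τ] {A : Set 𝕄} {P : τ → (ι → 𝕄) → Prop}
    (h : ∀ t, A.Definable L {x | P t x}) : A.Definable L {x | ∀ t, P t x} := by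
  have := definable_iInter_of_finite h
  refine (congrArg _ (ext fun x => ?_)).mp this
  simp

theorem sameType_iff {ι : Type*} {A : Set 𝕄} {x y : ι → 𝕄} :
    SameType L A x y ↔ ∀ S, A.Definable L S → (x ∈ S ↔ y ∈ S) := by
  constructor
  · intro h S hS
    obtain ⟨φ, rfl⟩ := definable_iff_exists_formula_sum.1 hS
    exact h φ
  · intro h φ
    exact h _ (definable_iff_exists_formula_sum.2 ⟨φ, rfl⟩)

theorem sameType_of_imp {ι : Type*} {A : Set 𝕄} {x y : ι → 𝕄}
    (h : ∀ S, A.Definable L S → x ∈ S → y ∈ S) : SameType L A x y :=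
  sameType_iff.2 fun S hS => ⟨h S hS, fun hy => by_contra fun hx => h _ hS.compl hx hy⟩

theorem SameType.symm {ι : Type*} {A : Set 𝕄} {x y : ι → 𝕄} (h : SameType L A x y) :
    SameType L A y x := fun φ => (h φ).symm

theorem SameType.trans {ι : Type*} {A : Set 𝕄} {x y z : ι → 𝕄} (h : SameType L A x y)
    (h' : SameType L A y z) : SameType L A x z := fun φ => (h φ).trans (h' φ)

theorem SameType.mono {ι : Type*} {A B : Set 𝕄} {x y : ι → 𝕄} (h : SameType L B x y)
    (hAB : A ⊆ B) : SameType L A x y :=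
  sameType_iff.2 fun S hS => sameType_iff.1 h S (hS.mono hAB)

theorem SameType.comp {ι γ : Type*} {A : Set 𝕄} {x y : ι → 𝕄} (h : SameType L A x y)
    (f : γ → ι) : SameType L A (fun i => x (f i)) (fun i => y (f i)) :=
  sameType_iff.2 fun _ hS => sameType_iff.1 h _ (hS.preimage_comp f)

theorem SameType.apply_eq {ι : Type*} {A : Set 𝕄} {x y : ι → 𝕄} (h : SameType L A x y) (i : ι)
    (hi : x i ∈ A) : y i = x i := by
  have := (h ((Language.Term.var (Sum.inr i)).equal (Language.Term.var (Sum.inl ⟨x i, hi⟩)))).1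
    (by simp [Language.Formula.realize_equal])
  simpa [Language.Formula.realize_equal] using this

/-- Types of infinite tuples are determined by the types of their finite subtuples. -/
theorem sameType_of_finite {ι : Type*} {A : Set 𝕄} {x y : ι → 𝕄}
    (h : ∀ F : Finset ι, SameType L A (fun i : F => x i) (fun i : F => y i)) :
    SameType L A x y := by
  refine sameType_iff.2 fun S hS => ?_
  obtain ⟨F, S', hS', rfl⟩ := exists_finset_support hS
  exact sameType_iff.1 (h F) S' hS'

/-- `σ` fixes the set `A` pointwise. -/
def Fixes (A : Set 𝕄) (σ : 𝕄 ≃[L] 𝕄) : Prop := ∀ m ∈ A, σ m = m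

theorem Fixes.mono {A B : Set 𝕄} {σ : 𝕄 ≃[L] 𝕄} (h : Fixes B σ) (hAB : A ⊆ B) : Fixes A σ :=
  fun m hm => h m (hAB hm)

theorem Fixes.symm {A : Set 𝕄} {σ : 𝕄 ≃[L] 𝕄} (h : Fixes A σ) : Fixes A σ.symm := fun m hm => by
  conv_lhs => rw [← h m hm]
  exact σ.symm_apply_apply m

theorem Fixes.sameType {A : Set 𝕄} {σ : 𝕄 ≃[L] 𝕄} (h : Fixes A σ) {ι : Type*} (x : ι → 𝕄) :
    SameType L A x (fun i => σ (x i)) := fun φ => by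
  rw [← Language.StrongHomClass.realize_formula σ φ]
  refine iff_of_eq (congrArg _ (funext fun i => ?_))
  rcases i with i | i
  · exact h i i.2
  · rfl

theorem Fixes.mem_iff {A : Set 𝕄} {σ : 𝕄 ≃[L] 𝕄} (h : Fixes A σ) {ι : Type*} {S : Set (ι → 𝕄)}
    (hS : A.Definable L S) (x : ι → 𝕄) : (fun i => σ (x i)) ∈ S ↔ x ∈ S :=
  (sameType_iff.1 (h.sameType x) S hS).symm

theorem definable_preimage_equiv {ι : Type*} {A : Set 𝕄} {S : Set (ι → 𝕄)}
    (hS : A.Definable L S) (σ : 𝕄 ≃[L] 𝕄) :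
    (σ ⁻¹' A).Definable L {x : ι → 𝕄 | (fun i => σ (x i)) ∈ S} := by
  obtain ⟨φ, rfl⟩ := definable_iff_exists_formula_sum.1 hS
  refine definable_iff_exists_formula_sum.2
    ⟨φ.relabel (Sum.map (fun a : A => ⟨σ.symm a, by simp⟩) id), ?_⟩
  ext x
  simp only [mem_ofPred_eq, Language.Formula.realize_relabel]
  refine Iff.trans (iff_of_eq (congrArg _ (funext fun i => ?_)))
    (Language.StrongHomClass.realize_formula σ φ)
  rcases i with i | i <;> simp

/-- Elements of an elementary substructure satisfying a formula over it. -/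
theorem exists_mem_of_definable [Nonempty 𝕄] (M : L.ElementarySubstructure 𝕄) {ι : Type*}
    {S : Set (ι → 𝕄)} (hS : (M : Set 𝕄).Definable L S) (hne : S.Nonempty) :
    ∃ x : ι → 𝕄, x ∈ S ∧ ∀ i, x i ∈ M := by
  classical
  obtain ⟨F, S', hS', rfl⟩ := exists_finset_support hS
  obtain ⟨φ, rfl⟩ := definable_iff_exists_formula_sum.1 hS'
  obtain ⟨x, hx⟩ := hne
  have h1 : (φ.iExs F).Realize (fun i : (M : Set 𝕄) => (i : 𝕄)) := by
    rw [Language.Formula.realize_iExs]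
    exact ⟨_, hx⟩
  have h2 : (φ.iExs F).Realize (fun i : (M : Set 𝕄) => (⟨i, i.2⟩ : M)) := by
    rw [← M.subtype.map_formula]
    exact h1
  rw [Language.Formula.realize_iExs] at h2
  obtain ⟨y, hy⟩ := h2
  have hM : Nonempty M := by
    have h3 : ((⊤ : L.Formula ((M : Set 𝕄) ⊕ Fin 1)).iExs (Fin 1)).Realize
        (fun i : (M : Set 𝕄) => (⟨i, i.2⟩ : M)) := by
      rw [← M.subtype.map_formula, Language.Formula.realize_iExs]
      exact ⟨fun _ => Classical.arbitrary 𝕄, by simp [Language.Formula.Realize]⟩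
    rw [Language.Formula.realize_iExs] at h3
    obtain ⟨z, -⟩ := h3
    exact ⟨z 0⟩
  refine ⟨fun i => if h : i ∈ F then y ⟨i, h⟩ else Classical.arbitrary M, ?_, fun i => ?_⟩
  · simp only [mem_ofPred_eq]
    rw [← M.subtype.map_formula] at hy
    convert hy using 1
    funext i
    rcases i with i | i
    · rfl
    · simp
  · dsimp only
    split_ifs <;> exact Subtype.mem _

end Definability

/-- An index type of size less than `κ`. -/
def SmallIndex (κ : Cardinal.{w}) (ι : Type*) : Prop :=
  ∃ (A : Type w) (f : ι → A), Function.Injective f ∧ #A < κ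

/-! ### Saturation and homogeneity for small tuples. -/

section Saturation

variable {L : FirstOrder.Language.{u, v}} {𝕄 : Type w} [L.Structure 𝕄] {κ : Cardinal.{w}}

theorem IsMonster.pos (h𝕄 : IsMonster L 𝕄 κ) : 0 < κ := by
  have := h𝕄.card_lt
  by_contra h
  rw [not_lt, nonpos_iff_eq_zero] at h
  subst h
  simp at this

theorem IsMonster.aleph0_lt (h𝕄 : IsMonster L 𝕄 κ) : ℵ₀ < κ :=
  (aleph0_le_beth _).trans_lt (h𝕄.large 0 h𝕄.pos)

theorem IsMonster.small_of_countable (h𝕄 : IsMonster L 𝕄 κ) (ι : Type*) [Countable ι] :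
    SmallIndex κ ι := by
  obtain ⟨f, hf⟩ := exists_injective_nat ι
  exact ⟨ULift.{w} ℕ, fun i => ⟨f i⟩, fun i j h => hf (ULift.up_injective h),
    by simpa using h𝕄.aleph0_lt⟩

theorem IsMonster.mk_lt_of_finite (h𝕄 : IsMonster L 𝕄 κ) {A : Set 𝕄} (hA : A.Finite) : #A < κ :=
  (hA.lt_aleph0).trans h𝕄.aleph0_lt

theorem IsMonster.mk_union_lt (h𝕄 : IsMonster L 𝕄 κ) {A B : Set 𝕄} (hA : #A < κ) (hB : #B < κ) :
    #(A ∪ B : Set 𝕄) < κ :=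
  (mk_union_le A B).trans_lt (add_lt_of_lt h𝕄.aleph0_lt.le hA hB)

theorem SmallIndex.of_injective {ι γ : Type*} (hι : SmallIndex κ ι) (f : γ → ι)
    (hf : Function.Injective f) : SmallIndex κ γ := by
  obtain ⟨A, g, hg, hA⟩ := hι
  exact ⟨A, g ∘ f, hg.comp hf, hA⟩

theorem SmallIndex.of_surjective {ι γ : Type*} (hι : SmallIndex κ ι) (f : ι → γ)
    (hf : Function.Surjective f) : SmallIndex κ γ :=
  hι.of_injective _ (Function.injective_surjInv hf)

theorem SmallIndex.of_mk_lt {ι : Type w} (hι : #ι < κ) : SmallIndex κ ι :=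
  ⟨ι, id, Function.injective_id, hι⟩

theorem SmallIndex.mk_lt {ι : Type w} (hι : SmallIndex κ ι) : #ι < κ := by
  obtain ⟨A, g, hg, hA⟩ := hι
  exact (mk_le_of_injective hg).trans_lt hA

theorem SmallIndex.mk_range_lt {ι : Type*} (hι : SmallIndex κ ι) (f : ι → 𝕄) : #(range f) < κ :=
  (hι.of_surjective _ rangeFactorization_surjective).mk_lt

theorem IsMonster.small_prod (h𝕄 : IsMonster L 𝕄 κ) {ι γ : Type*} (hι : SmallIndex κ ι)
    (hγ : SmallIndex κ γ) : SmallIndex κ (ι × γ) := by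
  obtain ⟨A, f, hf, hA⟩ := hι
  obtain ⟨B, g, hg, hB⟩ := hγ
  exact ⟨A × B, Prod.map f g, hf.prodMap hg, by
    rw [← mul_def]
    exact mul_lt_of_lt h𝕄.aleph0_lt.le hA hB⟩

/-- Saturation for types in one variable, in terms of definable sets. -/
theorem IsMonster.exists_mem_of_fip_unit (h𝕄 : IsMonster L 𝕄 κ) {A : Set 𝕄} (hA : #A < κ)
    {𝒮 : Set (Set (Unit → 𝕄))} (h𝒮 : ∀ S ∈ 𝒮, A.Definable L S)
    (hfip : ∀ 𝒯 ⊆ 𝒮, 𝒯.Finite → (⋂₀ 𝒯).Nonempty) : (⋂₀ 𝒮).Nonempty := by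
  obtain ⟨x, hx⟩ := h𝕄.saturated A hA
    {φ | {x : Unit → 𝕄 | φ.Realize (Sum.elim ((↑) : A → 𝕄) x)} ∈ 𝒮} fun Δ hΔ hfin => by
      obtain ⟨x, hx⟩ := hfip ((fun φ : L.Formula (A ⊕ Unit) =>
        {x : Unit → 𝕄 | φ.Realize (Sum.elim ((↑) : A → 𝕄) x)}) '' Δ)
        (by rintro _ ⟨φ, hφ, rfl⟩; exact hΔ hφ) (hfin.image _)
      refine ⟨x (), fun φ hφ => ?_⟩
      exact hx _ ⟨φ, hφ, rfl⟩
  refine ⟨fun _ => x, fun S hS => ?_⟩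
  obtain ⟨φ, rfl⟩ := definable_iff_exists_formula_sum.1 (h𝒮 S hS)
  exact hx φ hS

/-- Saturation for types in a small number of variables, in terms of definable sets. -/
theorem IsMonster.exists_mem_of_fip [Nonempty 𝕄] (h𝕄 : IsMonster L 𝕄 κ) {ι : Type*}
    (hι : SmallIndex κ ι) {A : Set 𝕄} (hA : #A < κ)
    {𝒮 : Set (Set (ι → 𝕄))} (h𝒮 : ∀ S ∈ 𝒮, A.Definable L S)
    (hfip : ∀ 𝒯 ⊆ 𝒮, 𝒯.Finite → (⋂₀ 𝒯).Nonempty) : (⋂₀ 𝒮).Nonempty := by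
  classical
  -- Sets of assignments (variable, value) that are finitely consistent with `𝒮`. A maximal one
  -- turns out to be the graph of a realization, since one-variable saturation over `A` and the
  -- values already used supplies any missing value.
  let 𝒢 : Set (Set (ι × 𝕄)) := {G | ∀ H ⊆ G, H.Finite → ∀ 𝒯 ⊆ 𝒮, 𝒯.Finite →
    ∃ x ∈ ⋂₀ 𝒯, ∀ p ∈ H, x p.1 = p.2}
  obtain ⟨G, -, hG⟩ : ∃ G, ∅ ⊆ G ∧ Maximal (· ∈ 𝒢) G := by
    refine zorn_subset_nonempty 𝒢 (fun c hc hchain hne => ⟨⋃₀ c, ?_, fun s hs =>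
      subset_sUnion_of_mem hs⟩) ∅ ?_
    · intro H hH hHfin 𝒯 h𝒯 h𝒯fin
      obtain ⟨G, hG, hHG⟩ := DirectedOn.exists_mem_subset_of_finite_of_subset_sUnion hne
        hchain.directedOn hHfin hH
      exact hc hG H hHG hHfin 𝒯 h𝒯 h𝒯fin
    · intro H hH _ 𝒯 h𝒯 h𝒯fin
      obtain ⟨x, hx⟩ := hfip 𝒯 h𝒯 h𝒯fin
      exact ⟨x, hx, fun p hp => absurd (hH hp) (notMem_empty p)⟩
  have hfun : ∀ j m m', (j, m) ∈ G → (j, m') ∈ G → m = m' := by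
    intro j m m' h h'
    obtain ⟨x, -, hx⟩ := hG.prop {(j, m), (j, m')} (by
      rintro p (rfl | rfl)
      exacts [h, h']) (by simp) ∅ (empty_subset _) finite_empty
    exact (hx (j, m) (by simp)).symm.trans (hx (j, m') (by simp))
  have hB : #(Prod.snd '' G : Set 𝕄) < κ := by
    have : Prod.snd '' G ⊆ range fun j : ι =>
        if h : ∃ m, (j, m) ∈ G then h.choose else Classical.arbitrary 𝕄 := by
      rintro _ ⟨⟨j, m⟩, h, rfl⟩
      refine ⟨j, ?_⟩
      have h' : ∃ m, (j, m) ∈ G := ⟨m, h⟩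
      simp only [dif_pos h']
      exact hfun j _ _ h'.choose_spec h
    exact (mk_le_mk_of_subset this).trans_lt (hι.mk_range_lt _)
  have htot : ∀ j, ∃ m, (j, m) ∈ G := by
    intro j
    let D : Set (Set (ι → 𝕄)) → Set (ι × 𝕄) → Set (ι → 𝕄) := fun 𝒯 H =>
      ⋂₀ 𝒯 ∩ ⋂₀ ((fun p : ι × 𝕄 => {x : ι → 𝕄 | x p.1 = p.2}) '' H)
    have hD : ∀ 𝒯 ⊆ 𝒮, 𝒯.Finite → ∀ H ⊆ G, H.Finite →
        (A ∪ Prod.snd '' G).Definable L (D 𝒯 H) := by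
      intro 𝒯 h𝒯 h𝒯fin H hH hHfin
      refine Definable.inter (definable_sInter h𝒯fin fun S hS =>
        (h𝒮 S (h𝒯 hS)).mono subset_union_left) (definable_sInter (hHfin.image _) ?_)
      rintro _ ⟨p, hp, rfl⟩
      refine definable_iff_exists_formula_sum.2 ⟨(Language.Term.var (Sum.inr p.1)).equal
        (Language.Term.var (Sum.inl ⟨p.2, Or.inr ⟨p, hH hp, rfl⟩⟩)), ?_⟩
      ext x
      simp [Language.Formula.realize_equal]
    obtain ⟨z, hz⟩ := h𝕄.exists_mem_of_fip_unit (h𝕄.mk_union_lt hA hB)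
      (𝒮 := {S | ∃ 𝒯 ⊆ 𝒮, 𝒯.Finite ∧ ∃ H ⊆ G, H.Finite ∧
        S = {y | ∃ x ∈ D 𝒯 H, ∀ i : Unit, y i = x j}}) (by
        rintro _ ⟨𝒯, h𝒯, h𝒯fin, H, hH, hHfin, rfl⟩
        exact definable_image_comp (hD 𝒯 h𝒯 h𝒯fin H hH hHfin) fun _ => j) (by
        intro 𝒰 h𝒰 h𝒰fin
        have h𝒰 : ∀ S ∈ 𝒰, _ := fun S hS => h𝒰 hS
        choose! T hT1 hT2 H hH1 hH2 hTH using h𝒰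
        obtain ⟨x, hx, hx'⟩ := hG.prop (⋃ S ∈ 𝒰, H S) (iUnion₂_subset hH1)
          (h𝒰fin.biUnion hH2) (⋃ S ∈ 𝒰, T S) (iUnion₂_subset hT1) (h𝒰fin.biUnion hT2)
        refine ⟨fun _ => x j, fun S hS => ?_⟩
        rw [hTH S hS]
        refine ⟨x, ⟨fun V hV => hx V (mem_iUnion₂.2 ⟨S, hS, hV⟩), ?_⟩, fun _ => rfl⟩
        rintro _ ⟨p, hp, rfl⟩
        exact hx' p (mem_iUnion₂.2 ⟨S, hS, hp⟩))
    refine ⟨z (), ?_⟩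
    have hmem : insert (j, z ()) G ∈ 𝒢 := by
      intro H hH hHfin 𝒯 h𝒯 h𝒯fin
      obtain ⟨x, ⟨hx, hx'⟩, hzx⟩ := hz _ ⟨𝒯, h𝒯, h𝒯fin, H \ {(j, z ())}, by
        intro p hp
        exact (hH hp.1).resolve_left hp.2, hHfin.sdiff, rfl⟩
      refine ⟨x, hx, fun p hp => ?_⟩
      by_cases hpj : p = (j, z ())
      · subst hpj
        exact (hzx ()).symm
      · exact hx' _ ⟨p, ⟨hp, hpj⟩, rfl⟩
    exact hG.le_of_ge hmem (subset_insert _ _) (mem_insert _ _)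
  choose x hx using htot
  refine ⟨x, fun S hS => ?_⟩
  obtain ⟨F, S', hS', rfl⟩ := exists_finset_support (h𝒮 S hS)
  obtain ⟨y, hy, hy'⟩ := hG.prop ((fun j => (j, x j)) '' F) (by
    rintro _ ⟨j, -, rfl⟩
    exact hx j) (F.finite_toSet.image _) {_} (singleton_subset_iff.2 hS) (finite_singleton _)
  have hy := hy _ rfl
  simp only [mem_ofPred_eq] at hy ⊢
  convert hy using 1
  funext i
  exact (hy' _ ⟨i, i.2, rfl⟩).symm

/-- Strong homogeneity for small tuples. -/
theorem IsMonster.exists_equiv (h𝕄 : IsMonster L 𝕄 κ) {ι : Type*} (hι : SmallIndex κ ι)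
    {A : Set 𝕄} (hA : #A < κ) {x y : ι → 𝕄} (h : SameType L A x y) :
    ∃ σ : 𝕄 ≃[L] 𝕄, Fixes A σ ∧ ∀ i, σ (x i) = y i := by
  have hp : ∀ z : (A ∪ range x : Set 𝕄), ∃ s : A ⊕ ι, Sum.elim ((↑) : A → 𝕄) x s = z := by
    rintro ⟨z, hz | ⟨i, rfl⟩⟩
    exacts [⟨Sum.inl ⟨z, hz⟩, rfl⟩, ⟨Sum.inr i, rfl⟩]
  choose s hs using hp
  obtain ⟨σ, hσ⟩ := h𝕄.homogeneous (A ∪ range x) (h𝕄.mk_union_lt hA (hι.mk_range_lt x))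
    (fun z => Sum.elim ((↑) : A → 𝕄) y (s z)) fun φ => by
      have := h (φ.relabel s)
      rw [Language.Formula.realize_relabel, Language.Formula.realize_relabel] at this
      refine Iff.trans (iff_of_eq (congrArg _ (funext fun z => ?_))) this
      exact (hs z).symm
  have key : ∀ t t' : A ⊕ ι, Sum.elim ((↑) : A → 𝕄) x t = Sum.elim ((↑) : A → 𝕄) x t' →
      Sum.elim ((↑) : A → 𝕄) y t = Sum.elim ((↑) : A → 𝕄) y t' := by
    intro t t' htt'
    have := (h ((Language.Term.var t).equal (Language.Term.var t'))).1
      (by simpa [Language.Formula.realize_equal] using htt')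
    simpa [Language.Formula.realize_equal] using this
  refine ⟨σ, fun m hm => ?_, fun i => ?_⟩
  · rw [hσ ⟨m, Or.inl hm⟩]
    exact key _ (Sum.inl ⟨m, hm⟩) (hs _)
  · rw [hσ ⟨x i, Or.inr ⟨i, rfl⟩⟩]
    exact key _ (Sum.inr i) (hs _)

end Saturation

/-! ### Global types as filters on tuples of the monster model. -/

section GlobalTypes

variable {L : FirstOrder.Language.{u, v}} {𝕄 : Type w} [L.Structure 𝕄] {α : Type z}

/-- Every global type is realized in an elementary extension. -/
theorem exists_elementaryEmbedding (p : GlobalType L 𝕄 α) :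
    ∃ (N : Type (max u v w z)) (_ : L.Structure N) (f : 𝕄 ↪ₑ[L] N) (x : α → N),
      ∀ χ : L.Formula (𝕄 ⊕ α),
        Language.Formula.equivSentence (Language.BoundedFormula.constantsVarsEquiv.symm χ :
          (L.withConstants 𝕄).Formula α) ∈ p ↔ χ.Realize (Sum.elim f x) := by
  obtain ⟨N, x, rfl⟩ := Language.Theory.exists_modelType_is_realized_in _ p
  let _ : L.Structure N := (L.lhomWithConstants 𝕄).reduct N
  have _ : (L.lhomWithConstants 𝕄).IsExpansionOn N := Language.LHom.isExpansionOn_reduct _ _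
  refine ⟨N, inferInstance, Language.ElementaryEmbedding.ofModelsElementaryDiagram L 𝕄 N, x,
    fun χ => ?_⟩
  rw [Language.Theory.CompleteType.formula_mem_typeOf]
  have := Language.BoundedFormula.realize_constantsVarsEquiv (M := N)
    (φ := Language.BoundedFormula.constantsVarsEquiv.symm χ) (v := x) (xs := default)
  rw [Equiv.apply_symm_apply] at this
  exact this.symm

/-- A formula in a global type has a solution in the model. -/
theorem exists_realize_of_elementaryEmbedding [Nonempty 𝕄] {N : Type*} [L.Structure N]
    (f : 𝕄 ↪ₑ[L] N) {x : α → N} {χ : L.Formula (𝕄 ⊕ α)} (h : χ.Realize (Sum.elim f x)) :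
    ∃ y : α → 𝕄, χ.Realize (Sum.elim id y) := by
  classical
  let F : Finset α := χ.freeVarFinset.toRight
  let g : χ.freeVarFinset → 𝕄 ⊕ F := fun x => Sum.casesOn (motive := fun s =>
    s ∈ χ.freeVarFinset → 𝕄 ⊕ F) x.1 (fun m _ => Sum.inl m)
    (fun a ha => Sum.inr ⟨a, by simp [F, ha]⟩) x.2
  let χ' : L.Formula (𝕄 ⊕ F) := χ.restrictFreeVar g
  have h1 : (χ'.iExs F).Realize (f ∘ id) := by
    rw [Language.Formula.realize_iExs]
    refine ⟨fun a => x a, (Language.BoundedFormula.realize_restrictFreeVar (Sum.elim f x) ?_).2 h⟩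
    rintro ⟨i | i, hi⟩ <;> rfl
  rw [f.map_formula, Language.Formula.realize_iExs] at h1
  obtain ⟨y, hy⟩ := h1
  refine ⟨fun a => if ha : a ∈ F then y ⟨a, ha⟩ else Classical.arbitrary 𝕄,
    (Language.BoundedFormula.realize_restrictFreeVar _ ?_).1 hy⟩
  rintro ⟨i | i, hi⟩
  · rfl
  · have : i ∈ F := by simp [F, hi]
    simp [g, this]

theorem definable_setOf_realize {γ : Type*} {A : Set 𝕄} {c : γ → 𝕄} (hc : ∀ i, c i ∈ A)
    (φ : L.Formula (γ ⊕ α)) : A.Definable L {x : α → 𝕄 | φ.Realize (Sum.elim c x)} := by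
  refine definable_iff_exists_formula_sum.2 ⟨φ.relabel (Sum.map (fun i => ⟨c i, hc i⟩) id), ?_⟩
  ext x
  simp only [mem_ofPred_eq, Language.Formula.realize_relabel]
  refine iff_of_eq (congrArg _ (funext fun i => ?_))
  rcases i with i | i <;> rfl

theorem exists_formula_of_definable {A : Set 𝕄} {S : Set (α → 𝕄)} (hS : A.Definable L S) :
    ∃ (n : ℕ) (c : Fin n → 𝕄) (φ : L.Formula (Fin n ⊕ α)), (∀ i, c i ∈ A) ∧
      S = {x | φ.Realize (Sum.elim c x)} := by
  obtain ⟨A₀, hfin, hA₀, hS⟩ := definable_finite_param hS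
  obtain ⟨φ, rfl⟩ := definable_iff_exists_formula_sum.1 hS
  have := hfin.to_subtype
  obtain ⟨n, ⟨e⟩⟩ := Finite.exists_equiv_fin A₀
  refine ⟨n, fun i => e.symm i, φ.relabel (Sum.map e id), fun i => hA₀ (e.symm i).2, ?_⟩
  ext x
  simp only [mem_ofPred_eq, Language.Formula.realize_relabel]
  refine iff_of_eq (congrArg _ (funext fun i => ?_))
  rcases i with i | i <;> simp

variable [Nonempty 𝕄]

/-- The filter generated by the solution sets of the formulas in a global type. -/
def typeFilter (p : GlobalType L 𝕄 α) : Filter (α → 𝕄) where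
  sets := {S | ∃ χ : L.Formula (𝕄 ⊕ α), Contains p χ id ∧ {x | χ.Realize (Sum.elim id x)} ⊆ S}
  univ_sets := by
    obtain ⟨N, _, f, x, h⟩ := exists_elementaryEmbedding p
    exact ⟨⊤, (h _).2 (by simp [Language.Formula.Realize, Language.Formula.relabel]),
      subset_univ _⟩
  sets_of_superset := by
    rintro S T ⟨χ, h, h'⟩ hST
    exact ⟨χ, h, h'.trans hST⟩
  inter_sets := by
    obtain ⟨N, _, f, x, h⟩ := exists_elementaryEmbedding p
    rintro S T ⟨χ, hχ, hS⟩ ⟨ψ, hψ, hT⟩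
    refine ⟨χ ⊓ ψ, ?_, fun y hy => ?_⟩
    · rw [Contains, h, Language.Formula.realize_relabel] at hχ hψ ⊢
      exact Language.Formula.realize_inf.2 ⟨hχ, hψ⟩
    · obtain ⟨h1, h2⟩ := Language.Formula.realize_inf.1 hy
      exact ⟨hS h1, hT h2⟩

theorem contains_iff (p : GlobalType L 𝕄 α) {γ : Type*} (φ : L.Formula (γ ⊕ α)) (c : γ → 𝕄) :
    Contains p φ c ↔ {x | φ.Realize (Sum.elim c x)} ∈ typeFilter p := by
  obtain ⟨N, _, f, x, h⟩ := exists_elementaryEmbedding p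
  constructor
  · intro hφ
    refine ⟨φ.relabel (Sum.map c id), ?_, fun y hy => ?_⟩
    · rw [Contains, h] at hφ ⊢
      simpa only [Language.Formula.realize_relabel, Sum.elim_comp_map, Function.comp_id] using hφ
    · simpa only [mem_ofPred_eq, Language.Formula.realize_relabel, Sum.elim_comp_map,
        Function.comp_id, Function.id_comp] using hy
  · rintro ⟨χ, hχ, hsub⟩
    rw [Contains, h] at hχ ⊢
    by_contra hφ
    obtain ⟨y, hy⟩ := exists_realize_of_elementaryEmbedding f (x := x)
      (χ := χ.relabel (Sum.map id id) ⊓ (φ.relabel (Sum.map c id)).not)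
      (Language.Formula.realize_inf.2 ⟨hχ, Language.Formula.realize_not.2 hφ⟩)
    obtain ⟨h1, h2⟩ := Language.Formula.realize_inf.1 hy
    rw [Language.Formula.realize_not] at h2
    apply h2
    simp only [Language.Formula.realize_relabel, Sum.elim_comp_map, Function.comp_id,
      Function.id_comp] at h1 ⊢
    exact hsub h1

instance typeFilter_neBot (p : GlobalType L 𝕄 α) : (typeFilter p).NeBot := by
  refine ⟨fun h => ?_⟩
  obtain ⟨N, _, f, x, h'⟩ := exists_elementaryEmbedding p
  have : (∅ : Set (α → 𝕄)) ∈ typeFilter p := by rw [h]; trivial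
  obtain ⟨χ, hχ, hsub⟩ := this
  rw [Contains, h', Language.Formula.realize_relabel] at hχ
  obtain ⟨y, hy⟩ := exists_realize_of_elementaryEmbedding f (x := x) (χ := χ) (by simpa using hχ)
  exact hsub hy

theorem typeFilter_mem_or_compl (p : GlobalType L 𝕄 α) {A : Set 𝕄} {S : Set (α → 𝕄)}
    (hS : A.Definable L S) : S ∈ typeFilter p ∨ Sᶜ ∈ typeFilter p := by
  obtain ⟨φ, rfl⟩ := definable_iff_exists_formula_sum.1 hS
  by_cases h : Contains p φ (fun a => (a : 𝕄))
  · exact Or.inl ((contains_iff p φ _).1 h)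
  · refine Or.inr ((contains_iff p φ.not _).1 ?_ )
    obtain ⟨N, _, f, x, h'⟩ := exists_elementaryEmbedding p
    rw [Contains, h'] at h ⊢
    exact Language.Formula.realize_not.2 h

theorem exists_definable_of_mem_typeFilter {p : GlobalType L 𝕄 α} {S : Set (α → 𝕄)}
    (hS : S ∈ typeFilter p) : ∃ T ⊆ S, T ∈ typeFilter p ∧ (univ : Set 𝕄).Definable L T := by
  obtain ⟨χ, hχ, hsub⟩ := hS
  exact ⟨_, hsub, (contains_iff p χ id).1 hχ, definable_setOf_realize (fun _ => mem_univ _) χ⟩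

/-- Every ultrafilter on tuples defines a global type. -/
theorem exists_globalType_of_ultrafilter (U : Ultrafilter (α → 𝕄)) :
    ∃ p : GlobalType L 𝕄 α, ∀ (A : Set 𝕄) (S : Set (α → 𝕄)), A.Definable L S →
      (S ∈ typeFilter p ↔ S ∈ U) := by
  -- The type is that of the tuple of coordinate functions in the ultrapower along `U`.
  let N := (U : Filter (α → 𝕄)).Product fun _ => 𝕄
  let _ : (L.withConstants 𝕄).Structure N := Language.Ultraproduct.structure
  have hN : N ⊨ L.elementaryDiagram 𝕄 := by
    refine ⟨fun φ hφ => ?_⟩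
    rw [Language.Ultraproduct.sentence_realize]
    exact Filter.Eventually.of_forall fun _ => hφ
  let x : α → N := fun a => ((fun y => y a : (α → 𝕄) → 𝕄) : (U : Filter (α → 𝕄)).Product fun _ => 𝕄)
  refine ⟨(L.elementaryDiagram 𝕄).typeOf x, fun A S hS => ?_⟩
  obtain ⟨φ, rfl⟩ := definable_iff_exists_formula_sum.1 hS
  rw [← contains_iff, Contains, Language.Theory.CompleteType.formula_mem_typeOf]
  refine (Language.Ultraproduct.realize_formula_cast _ _).trans ?_
  refine iff_of_eq (congrArg (· ∈ U) (ext fun y => ?_))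
  have := Language.BoundedFormula.realize_constantsVarsEquiv (M := 𝕄)
    (φ := Language.BoundedFormula.constantsVarsEquiv.symm
      (φ.relabel (Sum.map (fun a : A => (a : 𝕄)) id) : L.Formula (𝕄 ⊕ α))) (v := y) (xs := default)
  rw [Equiv.apply_symm_apply] at this
  refine this.symm.trans (Language.Formula.realize_relabel.trans
    (iff_of_eq (congrArg _ (funext fun i => ?_))))
  rcases i with i | i <;> rfl

theorem realizesOver_iff {p : GlobalType L 𝕄 α} {A : Set 𝕄} {x : α → 𝕄} :
    RealizesOver p A x ↔ ∀ S, A.Definable L S → S ∈ typeFilter p → x ∈ S := by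
  constructor
  · intro h S hS hSp
    obtain ⟨φ, rfl⟩ := definable_iff_exists_formula_sum.1 hS
    exact h φ ((contains_iff _ _ _).2 hSp)
  · intro h φ hφ
    exact h _ (definable_iff_exists_formula_sum.2 ⟨φ, rfl⟩) ((contains_iff _ _ _).1 hφ)

theorem RealizesOver.mem_iff {p : GlobalType L 𝕄 α} {A : Set 𝕄} {x : α → 𝕄}
    (h : RealizesOver p A x) {S : Set (α → 𝕄)} (hS : A.Definable L S) :
    x ∈ S ↔ S ∈ typeFilter p := by
  refine ⟨fun hx => ?_, realizesOver_iff.1 h S hS⟩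
  refine (typeFilter_mem_or_compl p hS).resolve_right fun h' => ?_
  exact realizesOver_iff.1 h _ hS.compl h' hx

theorem RealizesOver.mono {p : GlobalType L 𝕄 α} {A B : Set 𝕄} {x : α → 𝕄}
    (h : RealizesOver p B x) (hAB : A ⊆ B) : RealizesOver p A x :=
  realizesOver_iff.2 fun S hS => realizesOver_iff.1 h S (hS.mono hAB)

theorem RealizesOver.sameType {p : GlobalType L 𝕄 α} {A : Set 𝕄} {x y : α → 𝕄}
    (h : RealizesOver p A x) (h' : RealizesOver p A y) : SameType L A x y :=
  sameType_iff.2 fun _ hS => (h.mem_iff hS).trans (h'.mem_iff hS).symm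

theorem RealizesOver.of_sameType {p : GlobalType L 𝕄 α} {A : Set 𝕄} {x y : α → 𝕄}
    (h : RealizesOver p A x) (h' : SameType L A x y) : RealizesOver p A y :=
  realizesOver_iff.2 fun S hS hp => (sameType_iff.1 h' S hS).1 (realizesOver_iff.1 h S hS hp)

variable {κ : Cardinal.{w}}

theorem IsMonster.exists_realizesOver (h𝕄 : IsMonster L 𝕄 κ) (hα : SmallIndex κ α)
    (p : GlobalType L 𝕄 α) {A : Set 𝕄} (hA : #A < κ) : ∃ x, RealizesOver p A x := by
  obtain ⟨x, hx⟩ := h𝕄.exists_mem_of_fip hα hA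
    (𝒮 := {S | A.Definable L S ∧ S ∈ typeFilter p}) (fun S hS => hS.1) (fun 𝒯 h𝒯 hfin =>
      Filter.nonempty_of_mem ((Filter.sInter_mem hfin).2 fun S hS => (h𝒯 hS).2))
  exact ⟨x, realizesOver_iff.2 fun S hS hp => hx S ⟨hS, hp⟩⟩

/-- Invariance under automorphisms fixing `M`. -/
def AutInvariant (M : Set 𝕄) (p : GlobalType L 𝕄 α) : Prop :=
  ∀ σ : 𝕄 ≃[L] 𝕄, Fixes M σ → ∀ S ∈ typeFilter p, {x | (fun i => σ (x i)) ∈ S} ∈ typeFilter p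

theorem AutInvariant.mono {M D : Set 𝕄} {p : GlobalType L 𝕄 α} (h : AutInvariant M p)
    (hMD : M ⊆ D) : AutInvariant D p := fun σ hσ => h σ (hσ.mono hMD)

theorem AutInvariant.mem_iff {M : Set 𝕄} {p : GlobalType L 𝕄 α} (h : AutInvariant M p)
    {σ : 𝕄 ≃[L] 𝕄} (hσ : Fixes M σ) {S : Set (α → 𝕄)} :
    {x | (fun i => σ (x i)) ∈ S} ∈ typeFilter p ↔ S ∈ typeFilter p := by
  refine ⟨fun h' => ?_, h σ hσ S⟩
  have := h σ.symm hσ.symm _ h'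
  simp only [mem_ofPred_eq, Language.Equiv.apply_symm_apply] at this
  exact this

/-- Strong homogeneity turns equality of types of finite parameter tuples over `M` into
automorphisms fixing `M`; conversely automorphisms preserve those types. -/
theorem isInvariant_iff (h𝕄 : IsMonster L 𝕄 κ) {M : Set 𝕄} (hM : #M < κ)
    (p : GlobalType L 𝕄 α) : IsInvariant M p ↔ AutInvariant M p := by
  constructor
  · intro h σ hσ S hS
    obtain ⟨T, hTS, hT, hTdef⟩ := exists_definable_of_mem_typeFilter hS
    obtain ⟨n, c, φ, -, rfl⟩ := exists_formula_of_definable hTdef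
    refine Filter.mem_of_superset ((contains_iff _ _ _).1 (h n φ c (fun i => σ.symm (c i))
      (hσ.symm.sameType c) ((contains_iff _ _ _).2 hT))) fun x hx => hTS ?_
    simp only [mem_ofPred_eq] at hx ⊢
    rw [← Language.StrongHomClass.realize_formula σ φ] at hx
    convert hx using 1
    funext i
    rcases i with i | i <;> simp
  · intro h n φ c c' hcc' hc
    obtain ⟨σ, hσ, hσc⟩ := h𝕄.exists_equiv (h𝕄.small_of_countable _) hM hcc'
    refine (contains_iff _ _ _).2 (Filter.mem_of_superset
      (h σ.symm hσ.symm _ ((contains_iff _ _ _).1 hc)) fun x hx => ?_)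
    simp only [mem_ofPred_eq] at hx ⊢
    rw [← Language.StrongHomClass.realize_formula σ φ] at hx
    convert hx using 1
    funext i
    rcases i with i | i <;> simp [hσc]

theorem RealizesOver.map {M A : Set 𝕄} {p : GlobalType L 𝕄 α} (hp : AutInvariant M p)
    {σ : 𝕄 ≃[L] 𝕄} (hσ : Fixes M σ) {x : α → 𝕄} (h : RealizesOver p A x) :
    RealizesOver p (σ '' A) (fun i => σ (x i)) := by
  refine realizesOver_iff.2 fun S hS hSp => ?_
  have := definable_preimage_equiv hS σ
  rw [preimage_image_eq _ σ.injective] at this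
  exact realizesOver_iff.1 h _ this (hp σ hσ S hSp)

end GlobalTypes

/-- Dependent choice: a sequence can be built by repeatedly extending its initial segments. -/
theorem exists_seq_of_forall_exists {X : Type*} (R : ∀ n : ℕ, (Fin n → X) → X → Prop)
    (h : ∀ n (g : Fin n → X), (∀ i : Fin n, R i (fun j => g ⟨j, j.2.trans i.2⟩) (g i)) →
      ∃ x, R n g x) :
    ∃ f : ℕ → X, ∀ n, R n (fun j => f j) (f n) := by
  classical
  obtain ⟨x₀, -⟩ := h 0 Fin.elim0 fun i => i.elim0
  let next : ∀ n, (Fin n → X) → X := fun n g => if hg : ∃ x, R n g x then hg.choose else x₀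
  let f : ℕ → X := fun n => Nat.strongRec (fun n rec => next n fun j => rec j j.2) n
  have hf : ∀ n, f n = next n fun j => f j := fun n => by
    simp only [f]
    rw [Nat.strongRec_eq]
  refine ⟨f, fun n => ?_⟩
  induction n using Nat.strong_induction_on with
  | _ n ih =>
    have hn := h n (fun j => f j) fun i => ih i i.2
    rw [hf n]
    simp only [next, dif_pos hn]
    exact hn.choose_spec

/-! ### Morley sequences in invariant types and their blocks. -/

section Morley

variable {L : FirstOrder.Language.{u, v}} {𝕄 : Type w} [L.Structure 𝕄] {α : Type z}

/-- The elements of the tuples of a sequence before the index `i`. -/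
def before {ι : Type*} [LT ι] {α : Type*} (I : ι → α → 𝕄) (i : ι) : Set 𝕄 :=
  {x | ∃ j < i, ∃ k, I j k = x}

/-- Morley sequences indexed by an arbitrary order. -/
def IsMorleyOn {ι : Type*} [LT ι] (p : GlobalType L 𝕄 α) (D : Set 𝕄) (I : ι → α → 𝕄) : Prop :=
  ∀ i, RealizesOver p (D ∪ before I i) (I i)

variable [Nonempty 𝕄]

theorem IsMorleyOn.comp {ι ι' : Type*} [Preorder ι] [Preorder ι'] {p : GlobalType L 𝕄 α}
    {D : Set 𝕄} {I : ι → α → 𝕄} (h : IsMorleyOn p D I) {f : ι' → ι} (hf : StrictMono f) :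
    IsMorleyOn p D (fun i => I (f i)) := fun i => (h (f i)).mono <| by
  rintro x (hx | ⟨j, hj, k, rfl⟩)
  exacts [Or.inl hx, Or.inr ⟨f j, hf hj, k, rfl⟩]

theorem IsMorleyOn.mono {ι : Type*} [LT ι] {p : GlobalType L 𝕄 α}
    {D D' : Set 𝕄} {I : ι → α → 𝕄} (h : IsMorleyOn p D' I) (hD : D ⊆ D') :
    IsMorleyOn p D I := fun i => (h i).mono (union_subset_union_left _ hD)

theorem IsMorleyOn.map {ι : Type*} [LT ι] {p : GlobalType L 𝕄 α} {M D : Set 𝕄}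
    (hp : AutInvariant M p) {σ : 𝕄 ≃[L] 𝕄} (hσ : Fixes M σ) {I : ι → α → 𝕄}
    (h : IsMorleyOn p D I) : IsMorleyOn p (σ '' D) (fun i k => σ (I i k)) := fun i => by
  refine ((h i).map hp hσ).mono ?_
  rintro x (⟨y, hy, rfl⟩ | ⟨j, hj, k, rfl⟩)
  exacts [⟨y, Or.inl hy, rfl⟩, ⟨_, Or.inr ⟨j, hj, k, rfl⟩, rfl⟩]

theorem Fixes.image_eq {A : Set 𝕄} {σ : 𝕄 ≃[L] 𝕄} (h : Fixes A σ) : σ '' A = A := by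
  ext x
  constructor
  · rintro ⟨y, hy, rfl⟩
    rwa [h y hy]
  · intro hx
    exact ⟨x, hx, h x hx⟩

theorem IsMorleyOn.map_fixes {ι : Type*} [LT ι] {p : GlobalType L 𝕄 α} {D : Set 𝕄}
    (hp : AutInvariant D p) {σ : 𝕄 ≃[L] 𝕄} (hσ : Fixes D σ) {I : ι → α → 𝕄}
    (h : IsMorleyOn p D I) : IsMorleyOn p D (fun i k => σ (I i k)) := by
  simpa only [hσ.image_eq] using h.map hp hσ

variable {κ : Cardinal.{w}}

/-- Finite Morley sequences in the same invariant type are conjugate. -/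
theorem IsMorleyOn.exists_equiv_fin (h𝕄 : IsMonster L 𝕄 κ) (hα : SmallIndex κ α) {D : Set 𝕄}
    (hD : #D < κ) {p : GlobalType L 𝕄 α} (hp : AutInvariant D p) {n : ℕ} {I J : Fin n → α → 𝕄}
    (hI : IsMorleyOn p D I) (hJ : IsMorleyOn p D J) :
    ∃ σ : 𝕄 ≃[L] 𝕄, Fixes D σ ∧ ∀ i k, σ (I i k) = J i k := by
  induction n with
  | zero => exact ⟨Language.Equiv.refl L 𝕄, fun _ _ => rfl, fun i => i.elim0⟩
  | succ n ih =>
    obtain ⟨σ, hσ, hσI⟩ := ih (hI.comp Fin.strictMono_castSucc) (hJ.comp Fin.strictMono_castSucc)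
    have h1 : RealizesOver p (D ∪ range fun x : Fin n × α => J x.1.castSucc x.2)
        (fun k => σ (I (Fin.last n) k)) := by
      refine ((hI (Fin.last n)).map hp hσ).mono ?_
      rintro x (hx | ⟨⟨i, k⟩, rfl⟩)
      · exact ⟨x, Or.inl hx, hσ x hx⟩
      · exact ⟨_, Or.inr ⟨i.castSucc, Fin.castSucc_lt_last i, k, rfl⟩, hσI i k⟩
    have h2 : RealizesOver p (D ∪ range fun x : Fin n × α => J x.1.castSucc x.2)
        (J (Fin.last n)) := by
      refine (hJ (Fin.last n)).mono ?_
      rintro x (hx | ⟨⟨i, k⟩, rfl⟩)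
      · exact Or.inl hx
      · exact Or.inr ⟨i.castSucc, Fin.castSucc_lt_last i, k, rfl⟩
    obtain ⟨τ, hτ, hτI⟩ := h𝕄.exists_equiv hα (h𝕄.mk_union_lt hD
      ((h𝕄.small_prod (h𝕄.small_of_countable _) hα).mk_range_lt _)) (h1.sameType h2)
    refine ⟨τ.comp σ, fun m hm => ?_, fun i k => ?_⟩
    · simp only [Language.Equiv.comp_apply, hσ m hm]
      exact hτ m (Or.inl hm)
    · rw [Language.Equiv.comp_apply]
      induction i using Fin.lastCases with
      | last => exact hτI k
      | cast i =>
        refine (congrArg τ (hσI i k)).trans (hτ _ (Or.inr ⟨(i, k), rfl⟩))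

theorem IsMorleyOn.sameType_fin (h𝕄 : IsMonster L 𝕄 κ) (hα : SmallIndex κ α) {D : Set 𝕄}
    (hD : #D < κ) {p : GlobalType L 𝕄 α} (hp : AutInvariant D p) {n : ℕ} {I J : Fin n → α → 𝕄}
    (hI : IsMorleyOn p D I) (hJ : IsMorleyOn p D J) :
    SameType L D (fun x : Fin n × α => I x.1 x.2) (fun x : Fin n × α => J x.1 x.2) := by
  obtain ⟨σ, hσ, hσI⟩ := hI.exists_equiv_fin h𝕄 hα hD hp hJ
  simpa only [hσI] using hσ.sameType fun x : Fin n × α => I x.1 x.2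

theorem sameTypeSeq_of_fin {D : Set 𝕄} {I J : ℕ → α → 𝕄}
    (h : ∀ n, SameType L D (fun x : Fin n × α => I x.1 x.2) (fun x : Fin n × α => J x.1 x.2)) :
    SameTypeSeq L D I J := by
  classical
  refine sameType_of_finite fun F => ?_
  let n := (F.sup fun x => x.1) + 1
  exact (h n).comp fun x : F => (⟨x.1.1, Nat.lt_succ_of_le
    (Finset.le_sup (f := fun x : ℕ × α => x.1) x.2)⟩, x.1.2)

theorem IsMorleyOn.sameTypeSeq (h𝕄 : IsMonster L 𝕄 κ) (hα : SmallIndex κ α) {D : Set 𝕄}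
    (hD : #D < κ) {p : GlobalType L 𝕄 α} (hp : AutInvariant D p) {I J : ℕ → α → 𝕄}
    (hI : IsMorleyOn p D I) (hJ : IsMorleyOn p D J) : SameTypeSeq L D I J :=
  sameTypeSeq_of_fin fun _ => (hI.comp Fin.val_strictMono).sameType_fin h𝕄 hα hD hp
    (hJ.comp Fin.val_strictMono)

theorem IsMonster.exists_equiv_seq (h𝕄 : IsMonster L 𝕄 κ) (hα : SmallIndex κ α) {D : Set 𝕄}
    (hD : #D < κ) {I J : ℕ → α → 𝕄} (h : SameTypeSeq L D I J) :
    ∃ σ : 𝕄 ≃[L] 𝕄, Fixes D σ ∧ ∀ i k, σ (I i k) = J i k := by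
  obtain ⟨σ, hσ, hσI⟩ := h𝕄.exists_equiv (h𝕄.small_prod (h𝕄.small_of_countable _) hα) hD h
  exact ⟨σ, hσ, fun i k => hσI (i, k)⟩

theorem IsMorleyOn.of_sameTypeSeq (h𝕄 : IsMonster L 𝕄 κ) (hα : SmallIndex κ α) {D : Set 𝕄}
    (hD : #D < κ) {p : GlobalType L 𝕄 α} (hp : AutInvariant D p) {I J : ℕ → α → 𝕄}
    (hI : IsMorleyOn p D I) (h : SameTypeSeq L D I J) : IsMorleyOn p D J := by
  obtain ⟨σ, hσ, hσI⟩ := h𝕄.exists_equiv_seq hα hD h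
  simpa only [hσI] using hI.map_fixes hp hσ

theorem IsMorleyOn.isIndiscernible (h𝕄 : IsMonster L 𝕄 κ) (hα : SmallIndex κ α) {D : Set 𝕄}
    (hD : #D < κ) {p : GlobalType L 𝕄 α} (hp : AutInvariant D p) {I : ℕ → α → 𝕄}
    (hI : IsMorleyOn p D I) : IsIndiscernible L D I := fun _ _ _ hf hg =>
  (hI.comp hf).sameType_fin h𝕄 hα hD hp (hI.comp hg)

theorem IsMonster.mk_before_lt (h𝕄 : IsMonster L 𝕄 κ) (hα : SmallIndex κ α) {n : ℕ}
    (g : Fin n → α → 𝕄) : #(range fun x : Fin n × α => g x.1 x.2) < κ :=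
  (h𝕄.small_prod (h𝕄.small_of_countable _) hα).mk_range_lt _

/-- Morley sequences exist, with a prescribed first term. -/
theorem IsMonster.exists_morley (h𝕄 : IsMonster L 𝕄 κ) (hα : SmallIndex κ α) {D : Set 𝕄}
    (hD : #D < κ) (p : GlobalType L 𝕄 α) {x : α → 𝕄} (hx : RealizesOver p D x) :
    ∃ I : ℕ → α → 𝕄, I 0 = x ∧ IsMorleyOn p D I := by
  obtain ⟨I, hI⟩ := exists_seq_of_forall_exists (X := α → 𝕄)
    (fun n g y => RealizesOver p (D ∪ range fun x : Fin n × α => g x.1 x.2) y ∧ (n = 0 → y = x))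
    (fun n g _ => by
      rcases n.eq_zero_or_pos with rfl | hn
      · exact ⟨x, hx.mono (by rintro y (hy | ⟨⟨i, -⟩, -⟩); exacts [hy, i.elim0]), fun _ => rfl⟩
      · obtain ⟨y, hy⟩ := h𝕄.exists_realizesOver hα p (h𝕄.mk_union_lt hD (h𝕄.mk_before_lt hα g))
        exact ⟨y, hy, fun h => absurd h hn.ne'⟩)
  refine ⟨I, (hI 0).2 rfl, fun n => (hI n).1.mono ?_⟩
  rintro y (hy | ⟨j, hj, k, rfl⟩)
  exacts [Or.inl hy, Or.inr ⟨(⟨j, hj⟩, k), rfl⟩]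

theorem IsMonster.exists_morley' (h𝕄 : IsMonster L 𝕄 κ) (hα : SmallIndex κ α) {D : Set 𝕄}
    (hD : #D < κ) (p : GlobalType L 𝕄 α) : ∃ I : ℕ → α → 𝕄, IsMorleyOn p D I := by
  obtain ⟨x, hx⟩ := h𝕄.exists_realizesOver hα p hD
  obtain ⟨I, -, hI⟩ := h𝕄.exists_morley hα hD p hx
  exact ⟨I, hI⟩

/-- The tuple obtained from a block of tuples and elements of `M` by selecting coordinates. -/
def selectTuple {k : ℕ} {γ : Type*} {M : Set 𝕄} (g : γ → (Fin k × α) ⊕ M) (I : Fin k → α → 𝕄) :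
    γ → 𝕄 := fun i => Sum.elim (fun x : Fin k × α => I x.1 x.2) ((↑) : M → 𝕄) (g i)

theorem map_selectTuple {k : ℕ} {γ : Type*} {M : Set 𝕄} (g : γ → (Fin k × α) ⊕ M)
    {σ : 𝕄 ≃[L] 𝕄} (hσ : Fixes M σ) {I J : Fin k → α → 𝕄} (h : ∀ i k, σ (I i k) = J i k) :
    (fun i => σ (selectTuple g I i)) = selectTuple g J := by
  funext i
  simp only [selectTuple]
  rcases g i with x | m
  · exact h _ _
  · exact hσ m m.2

/-- A tuple selected from a finite Morley sequence realizes an invariant type. -/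
theorem IsMonster.exists_block_type (h𝕄 : IsMonster L 𝕄 κ) (hα : SmallIndex κ α) {M : Set 𝕄}
    (hM : #M < κ) {p : GlobalType L 𝕄 α} (hp : AutInvariant M p) {k : ℕ} {γ : Type*}
    (g : γ → (Fin k × α) ⊕ M) :
    ∃ p' : GlobalType L 𝕄 γ, AutInvariant M p' ∧ ∀ D, M ⊆ D → #D < κ → ∀ I : Fin k → α → 𝕄,
      IsMorleyOn p D I → RealizesOver p' D (selectTuple g I) := by
  -- Finite Morley sequences over `D` are conjugate over `D`, so this filter already decides every
  -- definable set; the ultrafilter refining it adds no choice.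
  let 𝓕 : Filter (γ → 𝕄) :=
    { sets := {S | ∃ D, M ⊆ D ∧ #D < κ ∧ ∀ I : Fin k → α → 𝕄, IsMorleyOn p D I →
        selectTuple g I ∈ S}
      univ_sets := ⟨M, subset_rfl, hM, fun _ _ => mem_univ _⟩
      sets_of_superset := by
        rintro S T ⟨D, h1, h2, h3⟩ hST
        exact ⟨D, h1, h2, fun I hI => hST (h3 I hI)⟩
      inter_sets := by
        rintro S T ⟨D, h1, h2, h3⟩ ⟨D', h1', h2', h3'⟩
        exact ⟨D ∪ D', h1.trans subset_union_left, h𝕄.mk_union_lt h2 h2', fun I hI =>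
          ⟨h3 I (hI.mono subset_union_left), h3' I (hI.mono subset_union_right)⟩⟩ }
  have hne : 𝓕.NeBot := by
    refine ⟨fun h => ?_⟩
    have : (∅ : Set (γ → 𝕄)) ∈ 𝓕 := by rw [h]; trivial
    obtain ⟨D, -, hD, h⟩ := this
    obtain ⟨I, hI⟩ := h𝕄.exists_morley' hα hD p
    exact h _ (hI.comp (Fin.val_strictMono (n := k)))
  obtain ⟨p', hp'⟩ := exists_globalType_of_ultrafilter (L := L) (Ultrafilter.of 𝓕)
  have key : ∀ D, M ⊆ D → #D < κ → ∀ I : Fin k → α → 𝕄, IsMorleyOn p D I →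
      RealizesOver p' D (selectTuple g I) := by
    intro D hMD hD I hI
    refine realizesOver_iff.2 fun S hS hSp => by_contra fun hIS => ?_
    rw [hp' D S hS] at hSp
    have : Sᶜ ∈ 𝓕 := by
      refine ⟨D, hMD, hD, fun J hJ hJS => hIS ?_⟩
      obtain ⟨σ, hσ, hσJ⟩ := hJ.exists_equiv_fin h𝕄 hα hD (hp.mono hMD) hI
      rw [← map_selectTuple g (hσ.mono hMD) hσJ]
      exact (hσ.mem_iff hS _).2 hJS
    exact Ultrafilter.compl_mem_iff_notMem.1 (Ultrafilter.of_le 𝓕 this) hSp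
  refine ⟨p', fun σ hσ S hS => ?_, key⟩
  obtain ⟨T, hTS, hT, hTdef⟩ := exists_definable_of_mem_typeFilter hS
  obtain ⟨A, hAfin, -, hTA⟩ := definable_finite_param hTdef
  have hD : #(M ∪ A : Set 𝕄) < κ := h𝕄.mk_union_lt hM (h𝕄.mk_lt_of_finite hAfin)
  have hD' : #(M ∪ σ ⁻¹' A : Set 𝕄) < κ := h𝕄.mk_union_lt hM
    (h𝕄.mk_lt_of_finite (hAfin.preimage σ.injective.injOn))
  obtain ⟨I, hI⟩ := h𝕄.exists_morley' hα hD' p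
  have hI := hI.comp (Fin.val_strictMono (n := k))
  have hIσ := hI.map hp hσ
  have h1 := key _ subset_union_left hD' _ hI
  refine Filter.mem_of_superset ((h1.mem_iff ((definable_preimage_equiv hTA σ).mono
    subset_union_right)).1 ?_) fun x hx => hTS hx
  have h2 := (key _ subset_union_left hD _ (hIσ.mono (by
    rintro x (hx | hx)
    · exact ⟨x, Or.inl hx, hσ x hx⟩
    · exact ⟨σ.symm x, Or.inr (by simpa using hx), by simp⟩))).mem_iff (hTA.mono subset_union_right)
  have h3 := h2.2 hT
  rwa [← map_selectTuple g hσ (I := fun i => I i) fun _ _ => rfl] at h3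

/-- The blocks of a Morley sequence form a Morley sequence in the type of a block. -/
theorem IsMonster.isMorleyOn_blocks (h𝕄 : IsMonster L 𝕄 κ) (hα : SmallIndex κ α) {M D : Set 𝕄}
    (hMD : M ⊆ D) (hD : #D < κ) {p : GlobalType L 𝕄 α} {k : ℕ} {γ : Type z'}
    {g : γ → (Fin k × α) ⊕ M} {p' : GlobalType L 𝕄 γ}
    (hp' : ∀ D, M ⊆ D → #D < κ → ∀ I : Fin k → α → 𝕄,
      IsMorleyOn p D I → RealizesOver p' D (selectTuple g I))
    {I : ℕ → α → 𝕄} (hI : IsMorleyOn p D I) :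
    IsMorleyOn p' D (fun n => selectTuple g fun i => I (k * n + i)) := by
  intro n
  refine (hp' (D ∪ range fun x : Fin (k * n) × α => I x.1 x.2)
    (hMD.trans subset_union_left)
    (h𝕄.mk_union_lt hD (h𝕄.mk_before_lt hα fun i : Fin (k * n) => I i)) _ ?_).mono ?_
  · intro i
    refine (hI (k * n + i)).mono ?_
    rintro x ((hx | ⟨⟨j, l⟩, rfl⟩) | ⟨j, hj, l, rfl⟩)
    · exact Or.inl hx
    · exact Or.inr ⟨j, j.2.trans_le (Nat.le_add_right _ _), l, rfl⟩
    · exact Or.inr ⟨k * n + j, Nat.add_lt_add_left hj _, l, rfl⟩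
  · rintro x (hx | ⟨j, hj, l, rfl⟩)
    · exact Or.inl hx
    · simp only [selectTuple]
      rcases g l with ⟨i, a⟩ | m
      · refine Or.inr ⟨(⟨k * j + i, ?_⟩, a), rfl⟩
        calc k * j + i < k * j + k := Nat.add_lt_add_left i.2 _
          _ = k * (j + 1) := (Nat.mul_succ k j).symm
          _ ≤ k * n := Nat.mul_le_mul_left k hj
      · exact Or.inl (hMD m.2)

end Morley

/-! ### Extraction of indiscernibles; construction of invariant types. -/

section Indiscernible

variable {L : FirstOrder.Language.{u, v}} {𝕄 : Type w} [L.Structure 𝕄] {α : Type z}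

/-- `P` holds for almost all increasing `n`-tuples, with respect to the iterates of a
nonprincipal ultrafilter. -/
def AlmostAll : ∀ n : ℕ, ((Fin n → ℕ) → Prop) → Prop
  | 0, P => P Fin.elim0
  | n + 1, P => ∀ᶠ i in (Filter.hyperfilter ℕ : Filter ℕ), AlmostAll n fun t => P (Fin.cons i t)

theorem AlmostAll.mono {n : ℕ} {P Q : (Fin n → ℕ) → Prop} (hP : AlmostAll n P)
    (h : ∀ t, P t → Q t) : AlmostAll n Q := by
  induction n with
  | zero => exact h _ hP
  | succ n ih =>
    refine Filter.Eventually.mono hP fun i hi => ?_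
    exact ih hi fun t => h _

theorem AlmostAll.and {n : ℕ} {P Q : (Fin n → ℕ) → Prop} (hP : AlmostAll n P)
    (hQ : AlmostAll n Q) : AlmostAll n fun t => P t ∧ Q t := by
  induction n with
  | zero => exact ⟨hP, hQ⟩
  | succ n ih =>
    exact Filter.Eventually.mp hP (Filter.Eventually.mono hQ fun i hi hi' => ih hi' hi)

theorem almostAll_not {n : ℕ} {P : (Fin n → ℕ) → Prop} (h : ¬ AlmostAll n P) :
    AlmostAll n fun t => ¬ P t := by
  induction n with
  | zero => exact h
  | succ n ih =>
    have h' : ∀ᶠ i in (Filter.hyperfilter ℕ : Filter ℕ),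
      ¬ AlmostAll n fun t => P (Fin.cons i t) := Ultrafilter.eventually_not.2 h
    exact h'.mono fun i hi => ih hi

theorem AlmostAll.exists {n : ℕ} {P : (Fin n → ℕ) → Prop} (hP : AlmostAll n P) : ∃ t, P t := by
  induction n with
  | zero => exact ⟨_, hP⟩
  | succ n ih =>
    obtain ⟨i, hi⟩ := Filter.Eventually.exists hP
    obtain ⟨t, ht⟩ := ih hi
    exact ⟨_, ht⟩

theorem almostAll_const {n : ℕ} {P : Prop} (h : P) : AlmostAll n fun _ => P := by
  induction n with
  | zero => exact h
  | succ n ih => exact Filter.Eventually.of_forall fun _ => ih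

theorem almostAll_strictMono (n N : ℕ) :
    AlmostAll n fun t => StrictMono t ∧ ∀ i, N < t i := by
  induction n generalizing N with
  | zero => exact ⟨fun i => i.elim0, fun i => i.elim0⟩
  | succ n ih =>
    have : ∀ᶠ i in (Filter.hyperfilter ℕ : Filter ℕ), N < i := by
      refine Filter.hyperfilter_le_cofinite ?_
      rw [Nat.cofinite_eq_atTop]
      exact Filter.eventually_gt_atTop N
    refine this.mono fun i hi => (ih i).mono fun t ht => ⟨?_, ?_⟩
    · intro a b hab
      induction a using Fin.cases with
      | zero =>
        induction b using Fin.cases with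
        | zero => exact absurd hab (lt_irrefl _)
        | succ b => simpa using ht.2 b
      | succ a =>
        induction b using Fin.cases with
        | zero => exact absurd hab (Fin.not_lt_zero _)
        | succ b => simpa using ht.1 (Fin.succ_lt_succ_iff.1 hab)
    · intro a
      induction a using Fin.cases with
      | zero => exact hi
      | succ a => simpa using hi.trans (ht.2 a)

/-- By recursion on the longer length: the first index is either the first argument of `P`, or a
dummy one over which the quantifier is vacuous. -/
theorem almostAll_comp {m n : ℕ} {f : Fin m → Fin n} (hf : StrictMono f)
    {P : (Fin m → ℕ) → Prop} (hP : AlmostAll m P) : AlmostAll n fun t => P fun i => t (f i) := by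
  induction n generalizing m with
  | zero =>
    obtain rfl : m = 0 := by
      by_contra hm
      exact (f ⟨0, Nat.pos_of_ne_zero hm⟩).elim0
    have e : P Fin.elim0 = P fun i => Fin.elim0 (f i) := congrArg P (funext fun i => i.elim0)
    exact e.mp hP
  | succ n ih =>
    by_cases hm : ∃ i, f i = 0
    · obtain ⟨i, hi⟩ := hm
      obtain ⟨m, rfl⟩ : ∃ m', m = m' + 1 := ⟨m - 1, by have := i.2; omega⟩
      have h0 : f 0 = 0 := le_antisymm ((hf.monotone (Fin.zero_le i)).trans_eq hi) (Fin.zero_le _)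
      have hpos : ∀ j : Fin m, f j.succ ≠ 0 := fun j hj => by
        have := hf (Fin.succ_pos j)
        rw [h0, hj] at this
        exact lt_irrefl _ this
      refine Filter.Eventually.mono hP fun a ha => ?_
      refine (ih (f := fun j => (f j.succ).pred (hpos j)) (fun j j' hjj' => ?_) ha).mono
        fun t ht => ?_
      · exact Fin.pred_lt_pred_iff.2 (hf (Fin.succ_lt_succ_iff.2 hjj'))
      · convert ht using 1
        funext j
        induction j using Fin.cases with
        | zero => simp [h0]
        | succ j =>
          obtain ⟨l, hl⟩ := Fin.exists_succ_eq.2 (hpos j)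
          simp [← hl]
    · push Not at hm
      refine Filter.Eventually.of_forall fun a => ?_
      refine (ih (f := fun j => (f j).pred (hm j)) (fun j j' hjj' => ?_) hP).mono fun t ht => ?_
      · exact Fin.pred_lt_pred_iff.2 (hf hjj')
      · convert ht using 1
        funext j
        obtain ⟨l, hl⟩ := Fin.exists_succ_eq.2 (hm j)
        simp [← hl]

variable [Nonempty 𝕄] {κ : Cardinal.{w}}

/-- Extraction of indiscernible sequences. -/
theorem IsMonster.exists_indiscernible (h𝕄 : IsMonster L 𝕄 κ) (hα : SmallIndex κ α) {D : Set 𝕄}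
    (hD : #D < κ) (I : ℕ → α → 𝕄) : ∃ I' : ℕ → α → 𝕄, IsIndiscernible L D I' ∧
      ∀ n (S : Set (Fin n × α → 𝕄)), D.Definable L S →
        (∀ t : Fin n → ℕ, StrictMono t → (fun x : Fin n × α => I (t x.1) x.2) ∈ S) →
        ∀ t : Fin n → ℕ, StrictMono t → (fun x : Fin n × α => I' (t x.1) x.2) ∈ S := by
  let Q : ∀ n, Set (Fin n × α → 𝕄) → Prop := fun n S =>
    AlmostAll n fun t => (fun x : Fin n × α => I (t x.1) x.2) ∈ S
  obtain ⟨y, hy⟩ := h𝕄.exists_mem_of_fip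
    (h𝕄.small_prod (h𝕄.small_of_countable ℕ) hα) hD
    (𝒮 := {T | ∃ n, ∃ S : Set (Fin n × α → 𝕄), D.Definable L S ∧ Q n S ∧
      T = {y | (fun x : Fin n × α => y (x.1, x.2)) ∈ S}})
    (by
      rintro _ ⟨n, S, hS, -, rfl⟩
      exact hS.preimage_comp fun x : Fin n × α => ((x.1 : ℕ), x.2))
    (by
      intro 𝒯 h𝒯 hfin
      -- Each condition concerns an initial segment. On a sufficiently long common segment they all
      -- hold for almost all index tuples, so a single tuple of indices satisfies them together.
      have : ∃ N, ∀ M ≥ N, AlmostAll M fun t => ∀ T ∈ 𝒯, ∀ y : ℕ × α → 𝕄,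
          (∀ (i : Fin M) a, y (i, a) = I (t i) a) → y ∈ T := by
        induction 𝒯, hfin using Set.Finite.induction_on with
        | empty => exact ⟨0, fun M _ => (almostAll_const trivial).mono
            fun _ _ T hT => absurd hT (notMem_empty T)⟩
        | @insert T 𝒯 _ _ ih =>
          obtain ⟨N, hN⟩ := ih ((subset_insert _ _).trans h𝒯)
          obtain ⟨n, S, -, hS, rfl⟩ := h𝒯 (mem_insert _ _)
          refine ⟨max n N, fun M hM => ?_⟩
          have hnM : n ≤ M := (le_max_left _ _).trans hM
          refine ((hN M ((le_max_right _ _).trans hM)).and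
            (almostAll_comp (Fin.strictMono_castLE hnM) hS)).mono ?_
          rintro t ⟨h1, h2⟩ T' (rfl | hT') y hy
          · have e : (fun x : Fin n × α => y (x.1, x.2)) =
                fun x : Fin n × α => I (t (Fin.castLE hnM x.1)) x.2 :=
              funext fun x => hy (Fin.castLE hnM x.1) x.2
            exact (congrArg (· ∈ S) e).mpr h2
          · exact h1 T' hT' y hy
      obtain ⟨N, hN⟩ := this
      obtain ⟨t, ht⟩ := (hN N le_rfl).exists
      refine ⟨fun x => if h : x.1 < N then I (t ⟨x.1, h⟩) x.2 else Classical.arbitrary 𝕄,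
        fun T hT => ht T hT _ fun i a => ?_⟩
      simp)
  have key : ∀ n (S : Set (Fin n × α → 𝕄)), D.Definable L S → Q n S →
      ∀ t : Fin n → ℕ, StrictMono t → (fun x : Fin n × α => y (t x.1, x.2)) ∈ S := by
    intro n S hS hQ t ht
    obtain ⟨N, hN⟩ : ∃ N, ∀ i, t i < N := by
      refine ⟨(Finset.univ.sup t) + 1, fun i => Nat.lt_succ_of_le (Finset.le_sup (Finset.mem_univ i))⟩
    exact hy _ ⟨N, {z | (fun x : Fin n × α => z (⟨t x.1, hN x.1⟩, x.2)) ∈ S},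
      hS.preimage_comp fun x : Fin n × α => ((⟨t x.1, hN x.1⟩ : Fin N), x.2),
      almostAll_comp (f := fun i => (⟨t i, hN i⟩ : Fin N)) (fun i j hij => ht hij) hQ, rfl⟩
  refine ⟨fun i a => y (i, a), fun n f g hf hg => sameType_of_imp fun S hS hfS => ?_,
    fun n S hS h => key n S hS ((almostAll_strictMono n 0).mono fun t ht => h t ht.1)⟩
  refine key n S hS ?_ g hg
  by_contra h
  exact key n Sᶜ hS.compl (almostAll_not h) f hf hfS

theorem IsIndiscernible.sameTypeSeq_of_forall {B : Set 𝕄} {I I' : ℕ → α → 𝕄}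
    (hI : IsIndiscernible L B I)
    (h : ∀ n (S : Set (Fin n × α → 𝕄)), B.Definable L S →
      (∀ t : Fin n → ℕ, StrictMono t → (fun x : Fin n × α => I (t x.1) x.2) ∈ S) →
      ∀ t : Fin n → ℕ, StrictMono t → (fun x : Fin n × α => I' (t x.1) x.2) ∈ S) :
    SameTypeSeq L B I I' :=
  sameTypeSeq_of_fin fun n => sameType_of_imp fun S hS hIS => h n S hS (fun t ht =>
    (sameType_iff.1 (hI n _ t Fin.val_strictMono ht) S hS).1 hIS) _ Fin.val_strictMono

/-- A sequence indiscernible over `B` can be made indiscernible over a larger set, keeping its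
type over `B` and all properties holding for each single term. -/
theorem IsIndiscernible.exists_indiscernible (h𝕄 : IsMonster L 𝕄 κ) (hα : SmallIndex κ α)
    {B D : Set 𝕄} (hBD : B ⊆ D) (hD : #D < κ) {I : ℕ → α → 𝕄} (hI : IsIndiscernible L B I) :
    ∃ I' : ℕ → α → 𝕄, IsIndiscernible L D I' ∧ SameTypeSeq L B I I' ∧
      ∀ S : Set (α → 𝕄), D.Definable L S → (∀ i, I i ∈ S) → ∀ i, I' i ∈ S := by
  obtain ⟨I', hI', h⟩ := h𝕄.exists_indiscernible hα hD I
  exact ⟨I', hI', hI.sameTypeSeq_of_forall fun n S hS => h n S (hS.mono hBD), fun S hS hIS i =>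
    h 1 {y | (fun a => y (0, a)) ∈ S} (hS.preimage_comp fun a => ((0 : Fin 1), a))
      (fun t _ => hIS (t 0)) (fun _ => i) (Subsingleton.strictMono _)⟩

theorem SameTypeSeq.mem {B : Set 𝕄} {I J : ℕ → α → 𝕄} (h : SameTypeSeq L B I J)
    {S : Set (α → 𝕄)} (hS : B.Definable L S) {i : ℕ} (hi : I i ∈ S) : J i ∈ S :=
  (sameType_iff.1 (SameType.comp h fun a => (i, a)) S hS).1 hi

/-- Invariant types form a closed set. -/
theorem exists_autInvariant_of_finite {M : Set 𝕄} (𝒢 : Set (Set (α → 𝕄)))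
    (h𝒢 : ∀ S ∈ 𝒢, (univ : Set 𝕄).Definable L S)
    (h : ∀ 𝒯 ⊆ 𝒢, 𝒯.Finite → ∃ p : GlobalType L 𝕄 α, AutInvariant M p ∧
      ∀ S ∈ 𝒯, S ∈ typeFilter p) :
    ∃ p : GlobalType L 𝕄 α, AutInvariant M p ∧ ∀ S ∈ 𝒢, S ∈ typeFilter p := by
  -- Invariance is itself a set of closed conditions: the implications from `S` to its preimage
  -- under `σ`. Each lies in every invariant type, so adding them all keeps finite consistency.
  let ℋ : Set (Set (α → 𝕄)) := {T | ∃ (S : Set (α → 𝕄)) (σ : 𝕄 ≃[L] 𝕄),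
    (univ : Set 𝕄).Definable L S ∧ Fixes M σ ∧ T = {x | x ∈ S → (fun i => σ (x i)) ∈ S}}
  have hdef : ∀ (S : Set (α → 𝕄)) (σ : 𝕄 ≃[L] 𝕄), (univ : Set 𝕄).Definable L S →
      (univ : Set 𝕄).Definable L {x | (fun i => σ (x i)) ∈ S} := fun S σ hS =>
    (definable_preimage_equiv hS σ).mono (subset_univ _)
  have hne : (Filter.generate (𝒢 ∪ ℋ)).NeBot := by
    rw [Filter.generate_neBot_iff]
    intro 𝒯 h𝒯 hfin
    obtain ⟨p, hp, hpS⟩ := h (𝒯 ∩ 𝒢) inter_subset_right (hfin.inter_of_left _)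
    refine Filter.nonempty_of_mem (f := typeFilter p) ((Filter.sInter_mem hfin).2 fun T hT => ?_)
    rcases h𝒯 hT with h1 | ⟨S, σ, hS, hσ, rfl⟩
    · exact hpS T ⟨hT, h1⟩
    · rcases typeFilter_mem_or_compl p hS with h1 | h1
      · exact Filter.mem_of_superset (hp σ hσ S h1) fun x hx _ => hx
      · exact Filter.mem_of_superset h1 fun x hx hx' => absurd hx' hx
  obtain ⟨p, hp⟩ := exists_globalType_of_ultrafilter (L := L)
    (Ultrafilter.of (Filter.generate (𝒢 ∪ ℋ)))
  have hmem : ∀ T ∈ 𝒢 ∪ ℋ, T ∈ Ultrafilter.of (Filter.generate (𝒢 ∪ ℋ)) := fun T hT =>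
    Ultrafilter.of_le _ (Filter.mem_generate_of_mem hT)
  refine ⟨p, fun σ hσ S hS => ?_, fun S hS => (hp _ S (h𝒢 S hS)).2 (hmem S (Or.inl hS))⟩
  obtain ⟨T, hTS, hT, hTdef⟩ := exists_definable_of_mem_typeFilter hS
  have h1 := (hp _ T hTdef).1 hT
  have h2 := hmem _ (Or.inr ⟨T, σ, hTdef, hσ, rfl⟩)
  exact Filter.mem_of_superset ((hp _ _ (hdef T σ hTdef)).2
    (Filter.mem_of_superset (Filter.inter_mem h1 h2) fun x hx => hx.2 hx.1)) fun x hx => hTS hx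

/-- Over a model, every type extends to an invariant global type. -/
theorem exists_autInvariant_extension (M : L.ElementarySubstructure 𝕄) (x : α → 𝕄) :
    ∃ p : GlobalType L 𝕄 α, AutInvariant (M : Set 𝕄) p ∧ RealizesOver p (M : Set 𝕄) x := by
  -- A coheir: the ultrafilter concentrates on tuples from `M`, which automorphisms fixing `M` do
  -- not move, so invariance is automatic.
  let 𝓕 : Filter (α → 𝕄) := Filter.generate
    {T | ∃ S, (M : Set 𝕄).Definable L S ∧ x ∈ S ∧ T = S ∩ {y | ∀ i, y i ∈ M}}
  have hne : 𝓕.NeBot := by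
    rw [Filter.generate_neBot_iff]
    intro 𝒯 h𝒯 hfin
    have h𝒯' : ∀ T ∈ 𝒯, _ := fun T hT => h𝒯 hT
    choose! S hS hxS hTS using h𝒯'
    obtain ⟨y, hy, hyM⟩ := exists_mem_of_definable M (S := ⋂₀ (S '' 𝒯))
      (definable_sInter (hfin.image _) (by rintro _ ⟨T, hT, rfl⟩; exact hS T hT))
      ⟨x, by rintro _ ⟨T, hT, rfl⟩; exact hxS T hT⟩
    exact ⟨y, fun T hT => by rw [hTS T hT]; exact ⟨hy _ ⟨T, hT, rfl⟩, hyM⟩⟩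
  obtain ⟨p, hp⟩ := exists_globalType_of_ultrafilter (L := L) (Ultrafilter.of 𝓕)
  have hmem : ∀ S, (M : Set 𝕄).Definable L S → x ∈ S →
      S ∩ {y | ∀ i, y i ∈ M} ∈ Ultrafilter.of 𝓕 := fun S hS hx =>
    Ultrafilter.of_le _ (Filter.mem_generate_of_mem ⟨S, hS, hx, rfl⟩)
  refine ⟨p, fun σ hσ S hS => ?_, realizesOver_iff.2 fun S hS hSp => by_contra fun hx => ?_⟩
  · obtain ⟨T, hTS, hT, hTdef⟩ := exists_definable_of_mem_typeFilter hS
    refine Filter.mem_of_superset ((hp _ _ ((definable_preimage_equiv hTdef σ).mono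
      (subset_univ _))).2 (Filter.mem_of_superset (Filter.inter_mem ((hp _ T hTdef).1 hT)
      (hmem univ definable_univ (mem_univ _))) ?_)) fun x hx => hTS hx
    rintro y ⟨hy, -, hyM⟩
    have : (fun i => σ (y i)) = y := funext fun i => hσ _ (hyM i)
    simpa only [mem_ofPred_eq, this] using hy
  · exact Ultrafilter.compl_mem_iff_notMem.1
      (Filter.mem_of_superset (hmem Sᶜ hS.compl hx) inter_subset_left) ((hp _ S hS).1 hSp)

end Indiscernible

/-! ### Parameter-free definable relations and the use of NSOP₃. -/

section Relations

variable (L : FirstOrder.Language.{u, v}) {𝕄 : Type w} [L.Structure 𝕄] {ξ η ζ ι : Type*}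

/-- The relation `Φ` between tuples is definable without parameters. -/
def DefRel (Φ : (ξ → 𝕄) → (η → 𝕄) → Prop) : Prop :=
  (∅ : Set 𝕄).Definable L {v : ξ ⊕ η → 𝕄 | Φ (fun i => v (.inl i)) fun i => v (.inr i)}

variable {L} {Φ : (ξ → 𝕄) → (η → 𝕄) → Prop} {Ψ : (ξ → 𝕄) → (ζ → 𝕄) → Prop}

theorem DefRel.definable (hΦ : DefRel L Φ) (f : ξ → ι) (g : η → ι) :
    (∅ : Set 𝕄).Definable L {v : ι → 𝕄 | Φ (fun i => v (f i)) fun i => v (g i)} :=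
  hΦ.preimage_comp (Sum.elim f g)

theorem DefRel.swap (hΦ : DefRel L Φ) : DefRel L fun y x => Φ x y := hΦ.definable _ _

theorem DefRel.not (hΦ : DefRel L Φ) : DefRel L fun x y => ¬ Φ x y := hΦ.compl

theorem DefRel.left (hΦ : DefRel L Φ) {A : Set 𝕄} {y : η → 𝕄} (hy : ∀ i, y i ∈ A) :
    A.Definable L {x | Φ x y} :=
  definable_preimage_subst (ι := ξ) (hΦ.mono (empty_subset A)) (Sum.map id fun i => ⟨y i, hy i⟩)

theorem DefRel.right (hΦ : DefRel L Φ) {A : Set 𝕄} {x : ξ → 𝕄} (hx : ∀ i, x i ∈ A) :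
    A.Definable L {y | Φ x y} := hΦ.swap.left hx

theorem DefRel.map_iff (hΦ : DefRel L Φ) (σ : 𝕄 ≃[L] 𝕄) (x : ξ → 𝕄) (y : η → 𝕄) :
    Φ (fun i => σ (x i)) (fun i => σ (y i)) ↔ Φ x y :=
  Fixes.mem_iff (A := ∅) (fun m hm => absurd hm (notMem_empty m)) hΦ (Sum.elim x y)

variable [Nonempty 𝕄]

theorem DefRel.exists_and [Finite η] [Finite ζ] (hΦ : DefRel L Φ) (hΨ : DefRel L Ψ) :
    DefRel L fun y z => ∃ x, Φ x y ∧ Ψ x z := by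
  have h := definable_image_comp ((hΦ.definable (ι := ξ ⊕ (η ⊕ ζ)) .inl (.inr ∘ .inl)).inter
    (hΨ.definable .inl (.inr ∘ .inr))) (Sum.inr : η ⊕ ζ → ξ ⊕ (η ⊕ ζ))
  refine (congrArg (fun S => (∅ : Set 𝕄).Definable L S) (Set.ext fun v => ⟨?_, ?_⟩)).mp h
  · rintro ⟨w, ⟨h1, h2⟩, hw⟩
    refine ⟨fun i => w (.inl i), ?_, ?_⟩
    · simp only [hw]
      exact h1
    · simp only [hw]
      exact h2
  · rintro ⟨x, h1, h2⟩
    exact ⟨Sum.elim x v, ⟨h1, h2⟩, fun i => rfl⟩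

theorem DefRel.forall_left {k : ℕ} (hΦ : DefRel L Φ) :
    DefRel L fun (x : Fin k × ξ → 𝕄) y => ∀ j, Φ (fun i => x (j, i)) y :=
  definable_forall_finite fun j => hΦ.definable (fun i => Sum.inl (j, i)) Sum.inr

theorem DefRel.forall_right {k : ℕ} (hΦ : DefRel L Φ) :
    DefRel L fun x (y : Fin k × η → 𝕄) => ∀ j, Φ x (fun i => y (j, i)) :=
  definable_forall_finite fun j => hΦ.definable Sum.inl (fun i => Sum.inr (j, i))

theorem exists_defRel_of_definable {A : Set 𝕄} {S : Set (ξ → 𝕄)} (hS : A.Definable L S) :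
    ∃ (n : ℕ) (c : Fin n → 𝕄) (Ψ : (ξ → 𝕄) → (Fin n → 𝕄) → Prop), DefRel L Ψ ∧
      (∀ i, c i ∈ A) ∧ S = {x | Ψ x c} := by
  obtain ⟨n, c, φ, hc, rfl⟩ := exists_formula_of_definable hS
  refine ⟨n, c, fun x z => φ.Realize (Sum.elim z x), ?_, hc, rfl⟩
  refine Set.empty_definable_iff.2 ⟨φ.relabel (Sum.elim Sum.inr Sum.inl), ?_⟩
  ext v
  simp only [mem_ofPred_eq, Language.Formula.realize_relabel]
  refine iff_of_eq (congrArg _ (funext fun i => ?_))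
  rcases i with i | i <;> rfl

variable {κ : Cardinal.{w}}

/-- Otherwise consider, between triples d = (c, a, b) and d' = (c', a', b'), the relation Φ(c', a) ∧
Ψ(c, b') ∧ ¬∃ x, Φ(x, a') ∧ Ψ(x, b). The given triples form an infinite chain for it, while it has
no 3-cycle. -/
theorem IsNSOP.not_inconsistent [Finite ξ] [Finite η] [Finite ζ] (hN : IsNSOP L 𝕄 3)
    (hΦ : DefRel L Φ) (hΨ : DefRel L Ψ) (a : ℕ → η → 𝕄) (b : ℕ → ζ → 𝕄) (c : ℕ → ξ → 𝕄)
    (hca : ∀ i j, i < j → Φ (c j) (a i)) (hcb : ∀ i j, i < j → Ψ (c i) (b j)) :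
    ∃ i j, i < j ∧ ∃ x, Φ x (a j) ∧ Ψ x (b i) := by
  by_contra hθ
  push Not at hθ
  obtain ⟨k, ⟨e⟩⟩ := Finite.exists_equiv_fin (ξ ⊕ η ⊕ ζ)
  let S : Set (Fin k ⊕ Fin k → 𝕄) :=
    {v | Φ (fun i => v (.inr (e (.inl i)))) fun i => v (.inl (e (.inr (.inl i))))} ∩
    {v | Ψ (fun i => v (.inl (e (.inl i)))) fun i => v (.inr (e (.inr (.inr i))))} ∩
    {v | ¬ ∃ x, Φ x (fun i => v (.inr (e (.inr (.inl i))))) ∧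
      Ψ x fun i => v (.inl (e (.inr (.inr i))))}
  have hS : (∅ : Set 𝕄).Definable L S :=
    ((hΦ.definable _ _).inter (hΨ.definable _ _)).inter ((hΦ.exists_and hΨ).not.definable
      (fun i => Sum.inr (e (Sum.inr (Sum.inl i)))) fun i => Sum.inl (e (Sum.inr (Sum.inr i))))
  obtain ⟨R, hR⟩ := Set.empty_definable_iff.1 hS
  have hR' : ∀ v, R.Realize v ↔ v ∈ S := fun v => by rw [hR]; rfl
  refine hN ⟨k, R, ?_, fun n i => Sum.elim (c n) (Sum.elim (a n) (b n)) (e.symm i), ?_⟩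
  -- In a cycle d₀, d₁, d₂ the c-component of d₁ solves Φ(x, a₀) ∧ Ψ(x, b₂), which the edge from d₂
  -- to d₀ forbids.
  · rintro ⟨d, hd⟩
    obtain ⟨⟨h1, -⟩, -⟩ := (hR' _).1 (hd 0)
    obtain ⟨⟨-, h2⟩, -⟩ := (hR' _).1 (hd 1)
    obtain ⟨-, h3⟩ := (hR' _).1 (hd 2)
    exact h3 ⟨_, h1, h2⟩
  · intro i j hij
    rw [hR']
    refine ⟨⟨?_, ?_⟩, ?_⟩
    · simpa using hca i j hij
    · simpa using hcb i j hij
    · simpa using hθ i j hij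

/-- Compactness for each entry c_n separately. The b-side starts at n + 1 because
`IsNSOP.not_inconsistent` puts no condition on the pair c_n, b_n. -/
theorem IsMonster.exists_seq_of_fin (h𝕄 : IsMonster L 𝕄 κ) [Finite ξ] [Finite η] [Finite ζ]
    (hΦ : DefRel L Φ) (hΨ : DefRel L Ψ) (a : ℕ → η → 𝕄) (b : ℕ → ζ → 𝕄)
    (hc : ∀ n N, ∃ c, (∀ i < n, Φ c (a i)) ∧ ∀ j < N, Ψ c (b (n + 1 + j))) :
    ∃ c : ℕ → ξ → 𝕄, (∀ i j, i < j → Φ (c j) (a i)) ∧ ∀ i j, i < j → Ψ (c i) (b j) := by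
  have key : ∀ n, ∃ c, (∀ i < n, Φ c (a i)) ∧ ∀ j, n < j → Ψ c (b j) := by
    intro n
    obtain ⟨c, hc⟩ := h𝕄.exists_mem_of_fip (h𝕄.small_of_countable ξ) (A :=
      (range fun x : Fin n × η => a x.1 x.2) ∪ range fun x : ℕ × ζ => b x.1 x.2)
      (h𝕄.mk_union_lt ((h𝕄.small_of_countable _).mk_range_lt _)
        ((h𝕄.small_of_countable _).mk_range_lt _))
      (𝒮 := {S | ∃ i, i < n ∧ S = {x | Φ x (a i)}} ∪ {S | ∃ j, S = {x | Ψ x (b (n + 1 + j))}})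
      (by
        rintro _ (⟨i, hi, rfl⟩ | ⟨j, rfl⟩)
        · exact hΦ.left fun l => Or.inl ⟨(⟨i, hi⟩, l), rfl⟩
        · exact hΨ.left fun l => Or.inr ⟨(n + 1 + j, l), rfl⟩)
      (by
        intro 𝒯 h𝒯 hfin
        have : ∃ N, ∀ c, (∀ i < n, Φ c (a i)) → (∀ j < N, Ψ c (b (n + 1 + j))) → c ∈ ⋂₀ 𝒯 := by
          induction 𝒯, hfin using Set.Finite.induction_on with
          | empty => exact ⟨0, fun c _ _ => by simp⟩
          | @insert T 𝒯 _ _ ih =>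
            obtain ⟨N, hN⟩ := ih ((subset_insert _ _).trans h𝒯)
            rcases h𝒯 (mem_insert _ _) with ⟨i, hi, rfl⟩ | ⟨j, rfl⟩
            · refine ⟨N, fun c h1 h2 => ?_⟩
              rw [sInter_insert]
              exact ⟨h1 i hi, hN c h1 h2⟩
            · refine ⟨max N (j + 1), fun c h1 h2 => ?_⟩
              rw [sInter_insert]
              exact ⟨h2 j (by omega), hN c h1 fun j hj => h2 j (by omega)⟩
        obtain ⟨N, hN⟩ := this
        obtain ⟨c, h1, h2⟩ := hc n N
        exact ⟨c, hN c h1 h2⟩)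
    refine ⟨c, fun i hi => hc _ (Or.inl ⟨i, hi, rfl⟩), fun j hj => ?_⟩
    obtain ⟨j, rfl⟩ := Nat.exists_eq_add_of_lt hj
    have : Ψ c (b (n + 1 + j)) := hc _ (Or.inr ⟨j, rfl⟩)
    rwa [Nat.add_right_comm] at this
  choose c h1 h2 using key
  exact ⟨c, fun i j hij => h1 j i hij, fun i j hij => h2 i j hij⟩

end Relations

/-! ### Powers of invariant types and transfer of relations by invariance. -/

section Powers

variable {L : FirstOrder.Language.{u, v}} {𝕄 : Type w} [L.Structure 𝕄] [Nonempty 𝕄]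
  {κ : Cardinal.{w}} {α : Type z} {ξ η ζ : Type*}

/-- `p'` is the type of a `k`-block of a Morley sequence in `p`. -/
def IsPower (κ : Cardinal.{w}) (M : Set 𝕄) (p : GlobalType L 𝕄 α) {k : ℕ}
    (p' : GlobalType L 𝕄 (Fin k × α)) : Prop :=
  AutInvariant M p' ∧ ∀ D, M ⊆ D → #D < κ → ∀ I : Fin k → α → 𝕄,
      IsMorleyOn p D I → RealizesOver p' D (fun x => I x.1 x.2)

theorem IsMonster.exists_isPower (h𝕄 : IsMonster L 𝕄 κ) (hα : SmallIndex κ α) {M : Set 𝕄}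
    (hM : #M < κ) {p : GlobalType L 𝕄 α} (hp : AutInvariant M p) (k : ℕ) :
    ∃ p' : GlobalType L 𝕄 (Fin k × α), IsPower κ M p p' :=
  h𝕄.exists_block_type hα hM hp Sum.inl

theorem IsPower.isMorleyOn (h𝕄 : IsMonster L 𝕄 κ) (hα : SmallIndex κ α) {M D : Set 𝕄}
    (hMD : M ⊆ D) (hD : #D < κ) {p : GlobalType L 𝕄 α} {k : ℕ} {p' : GlobalType L 𝕄 (Fin k × α)}
    (hp' : IsPower κ M p p') {I : ℕ → α → 𝕄} (hI : IsMorleyOn p D I) :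
    IsMorleyOn p' D (fun n x => I (k * n + x.1) x.2) :=
  h𝕄.isMorleyOn_blocks hα hMD hD (g := Sum.inl) hp'.2 hI

theorem RealizesOver.rel {q : GlobalType L 𝕄 ξ} {D : Set 𝕄} {x : ξ → 𝕄} (h : RealizesOver q D x)
    {Φ : (ξ → 𝕄) → (η → 𝕄) → Prop} (hΦ : DefRel L Φ) {y : η → 𝕄} (hy : ∀ i, y i ∈ D)
    (hq : {x | Φ x y} ∈ typeFilter q) : Φ x y :=
  (h.mem_iff (hΦ.left hy)).2 hq

theorem AutInvariant.rel_map {q : GlobalType L 𝕄 ξ} {M : Set 𝕄} (hq : AutInvariant M q)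
    {Φ : (ξ → 𝕄) → (η → 𝕄) → Prop} (hΦ : DefRel L Φ) {σ : 𝕄 ≃[L] 𝕄} (hσ : Fixes M σ) {y : η → 𝕄}
    (h : {x | Φ x y} ∈ typeFilter q) : {x | Φ x fun i => σ (y i)} ∈ typeFilter q := by
  rw [← hq.mem_iff hσ]
  exact Filter.mem_of_superset h fun x hx => (hΦ.map_iff σ x y).2 hx

theorem AutInvariant.rel (h𝕄 : IsMonster L 𝕄 κ) [Finite η] {q : GlobalType L 𝕄 ξ} {M : Set 𝕄}
    (hM : #M < κ) (hq : AutInvariant M q)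
    {Φ : (ξ → 𝕄) → (η → 𝕄) → Prop} (hΦ : DefRel L Φ) {y y' : η → 𝕄} (hy : SameType L M y y')
    (h : {x | Φ x y} ∈ typeFilter q) : {x | Φ x y'} ∈ typeFilter q := by
  obtain ⟨σ, hσ, hσy⟩ := h𝕄.exists_equiv (h𝕄.small_of_countable η) hM hy
  simpa only [hσy] using hq.rel_map hΦ hσ h

theorem rel_or_not (q : GlobalType L 𝕄 ξ) {Φ : (ξ → 𝕄) → (η → 𝕄) → Prop} (hΦ : DefRel L Φ)
    {y : η → 𝕄} : {x | Φ x y} ∈ typeFilter q ∨ {x | ¬ Φ x y} ∈ typeFilter q :=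
  typeFilter_mem_or_compl q (hΦ.left (A := range y) fun i => ⟨i, rfl⟩)

end Powers

/-! ### First amalgamation lemmas and the notion of a nice type. -/

section Amalgamation

variable {L : FirstOrder.Language.{u, v}} {𝕄 : Type w} [L.Structure 𝕄] [Nonempty 𝕄]
  {κ : Cardinal.{w}} {ξ η ζ : Type*} [Finite ξ] [Finite η] [Finite ζ]
  {Φ : (ξ → 𝕄) → (η → 𝕄) → Prop} {Ψ : (ξ → 𝕄) → (ζ → 𝕄) → Prop}

theorem isMorleyOn_of_range {ι : Type*} {p : GlobalType L 𝕄 ι} {D : Set 𝕄} {I : ℕ → ι → 𝕄}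
    (h : ∀ n, RealizesOver p (D ∪ range fun x : Fin n × ι => I x.1 x.2) (I n)) :
    IsMorleyOn p D I := fun n => (h n).mono <| by
  rintro y (hy | ⟨j, hj, k, rfl⟩)
  exacts [Or.inl hy, Or.inr ⟨(⟨j, hj⟩, k), rfl⟩]

/-- The basic pattern: if the negation were in `r`, the failure could be spread along a sequence.
Conjugates b_n of b see the earlier c's as initial segments of `J`, a_n realizes `r` over the
earlier b's, and c_n realizes `q` over the earlier a's and c's. This configuration contradicts
NSOP₃. -/
theorem exists_and_mem_typeFilter (h𝕄 : IsMonster L 𝕄 κ) (hN : IsNSOP L 𝕄 3) {M : Set 𝕄}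
    (hM : #M < κ) {q : GlobalType L 𝕄 ξ} {r : GlobalType L 𝕄 η} (hq : AutInvariant M q)
    (hr : AutInvariant M r) (hΦ : DefRel L Φ) (hΨ : DefRel L Ψ) {a : η → 𝕄}
    (ha : RealizesOver r M a) (hqa : {x | Φ x a} ∈ typeFilter q) {J : ℕ → ξ → 𝕄}
    (hJ : IsMorleyOn q M J) {b : ζ → 𝕄} (hb : ∀ i, Ψ (J i) b) :
    {y | ∃ x, Φ x y ∧ Ψ x b} ∈ typeFilter r := by
  refine (rel_or_not r (hΦ.exists_and hΨ)).resolve_right fun hθ => ?_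
  -- The entries are triples (c_n, a_n, b_n); the automorphism witnessing b_n carries J_i to c_i for
  -- i < n.
  obtain ⟨f, hf⟩ := exists_seq_of_forall_exists (X := (ξ → 𝕄) × (η → 𝕄) × (ζ → 𝕄))
    (fun n g x => (∃ σ : 𝕄 ≃[L] 𝕄, Fixes M σ ∧ (∀ i, σ (b i) = x.2.2 i) ∧
        ∀ (i : Fin n) k, σ (J i k) = (g i).1 k) ∧
      RealizesOver r (M ∪ range fun t : Fin n × ζ => (g t.1).2.2 t.2) x.2.1 ∧
      RealizesOver q ((M ∪ range fun t : Fin n × η => (g t.1).2.1 t.2) ∪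
        range fun t : Fin n × ξ => (g t.1).1 t.2) x.1) (fun n g hg => by
    have hc : IsMorleyOn q M fun i => (g i).1 := fun i => (hg i).2.2.mono <| by
      rintro y (hy | ⟨j, hj, k, rfl⟩)
      exacts [Or.inl (Or.inl hy), Or.inr ⟨(⟨j, hj⟩, k), rfl⟩]
    obtain ⟨σ, hσ, hσJ⟩ := (hJ.comp (Fin.val_strictMono (n := n))).exists_equiv_fin h𝕄
      (h𝕄.small_of_countable _) hM hq hc
    obtain ⟨y, hy⟩ := h𝕄.exists_realizesOver (h𝕄.small_of_countable _) r (h𝕄.mk_union_lt hM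
      (h𝕄.mk_before_lt (h𝕄.small_of_countable _) fun i => (g i).2.2))
    obtain ⟨x, hx⟩ := h𝕄.exists_realizesOver (h𝕄.small_of_countable _) q
      (h𝕄.mk_union_lt (h𝕄.mk_union_lt hM
      (h𝕄.mk_before_lt (h𝕄.small_of_countable _) fun i => (g i).2.1))
      (h𝕄.mk_before_lt (h𝕄.small_of_countable _) fun i => (g i).1))
    exact ⟨(x, y, fun i => σ (b i)), ⟨σ, hσ, fun _ => rfl, hσJ⟩, hy, hx⟩)
  have hca : ∀ i j, i < j → Φ (f j).1 (f i).2.1 := fun i j hij => by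
    refine (hf j).2.2.rel hΦ (fun l => Or.inl (Or.inr ⟨(⟨i, hij⟩, l), rfl⟩)) ?_
    exact hq.rel h𝕄 hM hΦ (ha.sameType ((hf i).2.1.mono subset_union_left)) hqa
  have hcb : ∀ i j, i < j → Ψ (f i).1 (f j).2.2 := fun i j hij => by
    obtain ⟨⟨σ, hσ, hσb, hσc⟩, -⟩ := hf j
    have := (hΨ.map_iff σ _ _).2 (hb i)
    simp only [hσb, hσc ⟨i, hij⟩] at this
    exact this
  obtain ⟨i, j, hij, x, h1, h2⟩ := hN.not_inconsistent hΦ hΨ (fun n => (f n).2.1)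
    (fun n => (f n).2.2) (fun n => (f n).1) hca hcb
  obtain ⟨⟨σ, hσ, hσb, -⟩, -⟩ := hf i
  have h := hr.rel_map (hΦ.exists_and hΨ).not hσ hθ
  simp only [hσb] at h
  exact (hf j).2.1.rel (hΦ.exists_and hΨ).not (fun l => Or.inr ⟨(⟨i, hij⟩, l), rfl⟩) h
    ⟨x, h1, h2⟩

/-- The entries c_n needed for NSOP₃ come from `exists_and_mem_typeFilter` with the two sides
exchanged: the block b_{n+1}, …, b_{n+N} realizes a power of `s` over a_0, …, a_{n-1}, and by
invariance `q` contains Ψ(x, b_j) for each j in the block. -/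
theorem exists_and_of_isMorleyOn (h𝕄 : IsMonster L 𝕄 κ) (hN : IsNSOP L 𝕄 3) {M : Set 𝕄}
    (hM : #M < κ) {q : GlobalType L 𝕄 ξ} {s : GlobalType L 𝕄 ζ} (hq : AutInvariant M q)
    (hs : AutInvariant M s) (hΦ : DefRel L Φ) (hΨ : DefRel L Ψ) {b₀ : ζ → 𝕄}
    (hb₀ : RealizesOver s M b₀) (hqb : {x | Ψ x b₀} ∈ typeFilter q) (a : ℕ → η → 𝕄)
    (b : ℕ → ζ → 𝕄)
    (hb : ∀ n, RealizesOver s ((M ∪ range fun t : Fin (n + 1) × η => a t.1 t.2) ∪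
      range fun t : Fin n × ζ => b t.1 t.2) (b n))
    (hI : ∀ n : ℕ, ∃ I : ℕ → ξ → 𝕄, IsMorleyOn q M I ∧ ∀ i < n, ∀ j, Φ (I j) (a i)) :
    ∃ i j, i < j ∧ ∃ x, Φ x (a j) ∧ Ψ x (b i) := by
  suffices h : ∀ n N, ∃ c, (∀ i < n, Φ c (a i)) ∧ ∀ j < N, Ψ c (b (n + 1 + j)) by
    obtain ⟨c, hca, hcb⟩ := h𝕄.exists_seq_of_fin hΦ hΨ a b h
    exact hN.not_inconsistent hΦ hΨ a b c hca hcb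
  intro n N
  obtain ⟨s', hs'⟩ := h𝕄.exists_isPower (h𝕄.small_of_countable ζ) hM hs N
  obtain ⟨I, hI, hIa⟩ := hI n
  let D := M ∪ range fun t : Fin n × η => a t.1 t.2
  have hD : #D < κ := h𝕄.mk_union_lt hM (h𝕄.mk_before_lt (h𝕄.small_of_countable _) fun i => a i)
  have hB : RealizesOver s' D fun t : Fin N × ζ => b (n + 1 + t.1) t.2 := by
    refine hs'.2 D subset_union_left hD (fun i => b (n + 1 + i)) fun i =>
      (hb (n + 1 + i)).mono ?_
    rintro y ((hy | ⟨⟨j, l⟩, rfl⟩) | ⟨j, hj, k, rfl⟩)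
    · exact Or.inl (Or.inl hy)
    · exact Or.inl (Or.inr ⟨(⟨j, by omega⟩, l), rfl⟩)
    · exact Or.inr ⟨(⟨n + 1 + j, by have : (j : ℕ) < i := hj; omega⟩, k), rfl⟩
  have hqB : {x | ∀ j : Fin N, Ψ x (b (n + 1 + j))} ∈ typeFilter q := by
    have : ∀ j : Fin N, {x | Ψ x (b (n + 1 + j))} ∈ typeFilter q := fun j =>
      hq.rel h𝕄 hM hΨ (hb₀.sameType ((hb _).mono fun x hx => Or.inl (Or.inl hx))) hqb
    have := (Filter.iInter_mem (f := typeFilter q)).2 this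
    refine Filter.mem_of_superset this fun x hx j => mem_iInter.1 hx j
  have key := exists_and_mem_typeFilter h𝕄 hN hM hq hs'.1
    (Φ := fun x (y : Fin N × ζ → 𝕄) => ∀ j, Ψ x fun i => y (j, i)) hΨ.forall_right
    (Ψ := fun x (y : Fin n × η → 𝕄) => ∀ j, Φ x fun i => y (j, i)) hΦ.forall_right
    (hB.mono subset_union_left) hqB hI (b := fun t => a t.1 t.2) fun i j => hIa j j.2 i
  obtain ⟨c, h1, h2⟩ := hB.rel ((hΨ.forall_right (k := N)).exists_and
    (hΦ.forall_right (k := n))) (fun t => Or.inr ⟨t, rfl⟩) key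
  exact ⟨c, fun i hi => h2 ⟨i, hi⟩, fun j hj => h1 ⟨j, hj⟩⟩

/-- Over every small set of parameters, some realization `a` of `r` and some Morley sequence in `q`
satisfy the relation `Φ`. -/
def Nice (κ : Cardinal.{w}) (M : Set 𝕄) (r : GlobalType L 𝕄 η) (q : GlobalType L 𝕄 ξ)
    (Φ : (ξ → 𝕄) → (η → 𝕄) → Prop) : Prop :=
  ∀ C : Set 𝕄, #C < κ → ∃ a, RealizesOver r (M ∪ C) a ∧
    ∃ I : ℕ → ξ → 𝕄, IsMorleyOn q (M ∪ C) I ∧ ∀ j, Φ (I j) a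

/-- If, for every small set of parameters and every `k`, some realization of `r` and some
`k`-block of a Morley sequence satisfy `Φ`, then so do infinite Morley sequences. -/
theorem nice_of_fin (h𝕄 : IsMonster L 𝕄 κ) {M : Set 𝕄}
    (hM : #M < κ) {q : GlobalType L 𝕄 ξ} {r : GlobalType L 𝕄 η} (hq : AutInvariant M q)
    (hΦ : DefRel L Φ)
    (h : ∀ (n k : ℕ) (b : Fin n → 𝕄) (Θ : (η → 𝕄) → (Fin n → 𝕄) → Prop), DefRel L Θ →
      {y | Θ y b} ∈ typeFilter r → ∀ q' : GlobalType L 𝕄 (Fin k × ξ), IsPower κ M q q' →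
      {x : Fin k × ξ → 𝕄 | ¬ ∃ y, (∀ j, Φ (fun i => x (j, i)) y) ∧ Θ y b} ∉ typeFilter q') :
    Nice κ M r q Φ := by
  intro C hC
  have hD : #(M ∪ C : Set 𝕄) < κ := h𝕄.mk_union_lt hM hC
  obtain ⟨I, hI⟩ := h𝕄.exists_morley' (h𝕄.small_of_countable ξ) hD q
  obtain ⟨y, hy⟩ := h𝕄.exists_mem_of_fip (h𝕄.small_of_countable η)
    (A := (M ∪ C) ∪ range fun t : ℕ × ξ => I t.1 t.2)
    (h𝕄.mk_union_lt hD ((h𝕄.small_of_countable _).mk_range_lt _))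
    (𝒮 := {S | (M ∪ C).Definable L S ∧ S ∈ typeFilter r} ∪ {S | ∃ j, S = {y | Φ (I j) y}})
    (by
      rintro S (⟨hS, -⟩ | ⟨j, rfl⟩)
      · exact hS.mono subset_union_left
      · exact hΦ.right fun l => Or.inr ⟨(j, l), rfl⟩)
    (by
      intro 𝒯 h𝒯 hfin
      have : ∃ (S : Set (η → 𝕄)) (k : ℕ), (M ∪ C).Definable L S ∧ S ∈ typeFilter r ∧
          ∀ y ∈ S, (∀ j < k, Φ (I j) y) → y ∈ ⋂₀ 𝒯 := by
        induction 𝒯, hfin using Set.Finite.induction_on with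
        | empty => exact ⟨univ, 0, definable_univ, Filter.univ_mem, fun _ _ _ => by simp⟩
        | @insert T 𝒯 _ _ ih =>
          obtain ⟨S, k, hS, hSr, h𝒯'⟩ := ih ((subset_insert _ _).trans h𝒯)
          rcases h𝒯 (mem_insert _ _) with ⟨hT, hTr⟩ | ⟨j, rfl⟩
          · refine ⟨T ∩ S, k, hT.inter hS, Filter.inter_mem hTr hSr, fun y h1 h2 => ?_⟩
            rw [sInter_insert]
            exact ⟨h1.1, h𝒯' y h1.2 h2⟩
          · refine ⟨S, max k (j + 1), hS, hSr, fun y h1 h2 => ?_⟩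
            rw [sInter_insert]
            exact ⟨h2 j (by omega), h𝒯' y h1 fun j hj => h2 j (by omega)⟩
      obtain ⟨S, k, hS, hSr, hST⟩ := this
      obtain ⟨n, b, Θ, hΘ, hb, rfl⟩ := exists_defRel_of_definable hS
      obtain ⟨q', hq'⟩ := h𝕄.exists_isPower (h𝕄.small_of_countable ξ) hM hq k
      have hR := (hΦ.forall_left (k := k)).swap.exists_and hΘ
      have := h n k b Θ hΘ hSr q' hq'
      have := (rel_or_not q' hR (y := b)).resolve_right this
      obtain ⟨y, h1, h2⟩ := (hq'.2 (M ∪ C) subset_union_left hD (fun i => I i)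
        (hI.comp Fin.val_strictMono)).rel hR hb this
      exact ⟨y, hST y h2 fun j hj => h1 ⟨j, hj⟩⟩)
  refine ⟨y, realizesOver_iff.2 fun S hS hSr => hy S (Or.inl ⟨hS, hSr⟩), I, hI, fun j =>
    hy _ (Or.inr ⟨j, rfl⟩)⟩

/-- If niceness fails, some k-block of `q` excludes every realization of some Θ(y, b₀) in `r`.
Interleave a Morley sequence in `r` with one in an invariant extension of tp(b₀/M), and amalgamate
Φ(x, a_j) with this exclusion at b_i for some i < j. The excluded witness is then a_j itself, since
Θ(a_j, b_i) holds by invariance. -/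
theorem nice_of_isMorleyOn (h𝕄 : IsMonster L 𝕄 κ) (hN : IsNSOP L 𝕄 3)
    (M : L.ElementarySubstructure 𝕄)
    (hM : #M < κ) {q : GlobalType L 𝕄 ξ} {r : GlobalType L 𝕄 η} (hq : AutInvariant (M : Set 𝕄) q)
    (hr : AutInvariant (M : Set 𝕄) r) (hΦ : DefRel L Φ) {A : ℕ → η → 𝕄}
    (hA : IsMorleyOn r (M : Set 𝕄) A)
    (hI : ∀ n : ℕ, ∃ I : ℕ → ξ → 𝕄, IsMorleyOn q (M : Set 𝕄) I ∧ ∀ i < n, ∀ j, Φ (I j) (A i)) :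
    Nice κ (M : Set 𝕄) r q Φ := by
  refine nice_of_fin h𝕄 hM hq hΦ fun n k b₀ Θ hΘ hΘr q' hq' hcon => ?_
  obtain ⟨s, hs, hsb⟩ := exists_autInvariant_extension M b₀
  obtain ⟨f, hf⟩ := exists_seq_of_forall_exists (X := (η → 𝕄) × (Fin n → 𝕄))
    (fun n g x => RealizesOver r (((M : Set 𝕄) ∪ range fun t : Fin n × Fin _ => (g t.1).2 t.2) ∪
        range fun t : Fin n × η => (g t.1).1 t.2) x.1 ∧
      RealizesOver s (((M : Set 𝕄) ∪ (range fun t : Fin n × η => (g t.1).1 t.2) ∪ range x.1) ∪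
        range fun t : Fin n × Fin _ => (g t.1).2 t.2) x.2)
    (fun m g _ => by
      have h1 := h𝕄.mk_before_lt (h𝕄.small_of_countable _) fun i => (g i).1
      have h2 := h𝕄.mk_before_lt (h𝕄.small_of_countable _) fun i => (g i).2
      obtain ⟨x, hx⟩ := h𝕄.exists_realizesOver (h𝕄.small_of_countable _) r
        (h𝕄.mk_union_lt (h𝕄.mk_union_lt hM h2) h1)
      obtain ⟨y, hy⟩ := h𝕄.exists_realizesOver (h𝕄.small_of_countable _) s
        (h𝕄.mk_union_lt (h𝕄.mk_union_lt (h𝕄.mk_union_lt hM h1)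
          ((h𝕄.small_of_countable _).mk_range_lt x)) h2)
      exact ⟨(x, y), hx, hy⟩)
  have hA' : IsMorleyOn r (M : Set 𝕄) fun n => (f n).1 := isMorleyOn_of_range fun n =>
    (hf n).1.mono (union_subset_union_left _ subset_union_left)
  have hR := (hΦ.forall_left (k := k)).swap.exists_and hΘ
  have hB : ∀ m, RealizesOver s (((M : Set 𝕄) ∪ range fun t : Fin (m + 1) × η => (f t.1).1 t.2) ∪
      range fun t : Fin m × Fin n => (f t.1).2 t.2) (f m).2 := fun m => (hf m).2.mono <| by
    rintro y ((hy | ⟨⟨t, l⟩, rfl⟩) | hy)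
    · exact Or.inl (Or.inl (Or.inl hy))
    · induction t using Fin.lastCases with
      | last => exact Or.inl (Or.inr ⟨l, rfl⟩)
      | cast t => exact Or.inl (Or.inl (Or.inr ⟨(t, l), rfl⟩))
    · exact Or.inr hy
  have hIA : ∀ m : ℕ, ∃ I : ℕ → Fin k × ξ → 𝕄, IsMorleyOn q' (M : Set 𝕄) I ∧
      ∀ i < m, ∀ j l, Φ (fun t => I j (l, t)) (f i).1 := fun m => by
    obtain ⟨I, hI, hIA⟩ := hI m
    obtain ⟨σ, hσ, hσA⟩ := (hA.comp (Fin.val_strictMono (n := m))).exists_equiv_fin h𝕄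
      (h𝕄.small_of_countable _) hM hr (hA'.comp (Fin.val_strictMono (n := m)))
    refine ⟨_, hq'.isMorleyOn h𝕄 (h𝕄.small_of_countable _) subset_rfl hM (hI.map_fixes hq hσ),
      fun i hi j l => ?_⟩
    have := (hΦ.map_iff σ _ _).2 (hIA i hi (k * j + l))
    simp only [hσA ⟨i, hi⟩] at this
    exact this
  obtain ⟨i, j, hij, x, h1, h2⟩ := exists_and_of_isMorleyOn h𝕄 hN hM hq'.1 hs
    (hΦ.forall_left (k := k)) hR.not hsb hcon (fun n => (f n).1) (fun n => (f n).2) hB hIA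
  refine h2 ⟨(f j).1, h1, (hf j).1.rel hΘ
    (fun l => Or.inl (Or.inr ⟨(⟨i, hij⟩, l), rfl⟩)) ?_⟩
  exact hr.rel h𝕄 hM hΘ (hsb.sameType ((hf i).2.mono fun x hx =>
    Or.inl (Or.inl (Or.inl hx)))) hΘr

end Amalgamation

/-! ### Coordinate changes; dividing conditions along Morley sequences. -/

section Marginals

variable {L : FirstOrder.Language.{u, v}} {𝕄 : Type w} [L.Structure 𝕄] [Nonempty 𝕄]
  {κ : Cardinal.{w}} {α : Type z} {ξ η ζ ε : Type*}

/-- The one-term case of `IsMonster.exists_block_type`. Besides restricting coordinates, it allows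
parameters from `M` to be appended to a tuple. -/
theorem IsMonster.exists_marginal (h𝕄 : IsMonster L 𝕄 κ) (hα : SmallIndex κ α) {M : Set 𝕄}
    (hM : #M < κ) {p : GlobalType L 𝕄 α} (hp : AutInvariant M p) (f : ε → α ⊕ M) :
    ∃ p' : GlobalType L 𝕄 ε, AutInvariant M p' ∧ ∀ D, M ⊆ D → #D < κ → ∀ x : α → 𝕄,
      RealizesOver p D x → RealizesOver p' D fun i => Sum.elim x (↑) (f i) := by
  obtain ⟨p', hp', h⟩ := h𝕄.exists_block_type hα hM hp (k := 1)
    (fun i => Sum.map (fun j => ((0 : Fin 1), j)) id (f i))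
  refine ⟨p', hp', fun D hMD hD x hx => ?_⟩
  have := h D hMD hD (fun _ => x) fun i => hx.mono ?_
  · refine (congrArg (RealizesOver p' D) (funext fun i => ?_)).mp this
    simp only [selectTuple]
    rcases f i with j | m <;> rfl
  · rintro y (hy | ⟨j, hj, -⟩)
    · exact hy
    · exact absurd hj (by rw [Subsingleton.elim i j]; exact lt_irrefl _)

theorem IsMorleyOn.marginal (h𝕄 : IsMonster L 𝕄 κ) (hα : SmallIndex κ α) {M : Set 𝕄}
    (hM : #M < κ) {p : GlobalType L 𝕄 α} {f : ε → α ⊕ M} {p' : GlobalType L 𝕄 ε}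
    (hp' : ∀ D, M ⊆ D → #D < κ → ∀ x : α → 𝕄,
      RealizesOver p D x → RealizesOver p' D fun i => Sum.elim x (↑) (f i))
    {I : ℕ → α → 𝕄} (hI : IsMorleyOn p M I) :
    IsMorleyOn p' M fun n i => Sum.elim (I n) (↑) (f i) := fun n => by
  refine (hp' (M ∪ before I n) subset_union_left (h𝕄.mk_union_lt hM ?_) _ (hI n)).mono ?_
  · refine (mk_le_mk_of_subset ?_).trans_lt (h𝕄.mk_before_lt hα fun i : Fin n => I i)
    rintro _ ⟨j, hj, k, rfl⟩
    exact ⟨(⟨j, hj⟩, k), rfl⟩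
  · rintro _ (hy | ⟨j, hj, k, rfl⟩)
    · exact Or.inl hy
    · rcases hk : f k with l | m
      · exact Or.inr ⟨j, hj, l, by simp [hk]⟩
      · exact Or.inl (by simp [hk])

theorem defRel_realize (φ : L.Formula (η ⊕ ξ)) :
    DefRel L (𝕄 := 𝕄) fun z x => φ.Realize (Sum.elim z x) := by
  refine Set.empty_definable_iff.2 ⟨φ, ?_⟩
  ext v
  have : Sum.elim (fun i => v (Sum.inl i)) (fun i => v (Sum.inr i)) = v := by
    funext i
    rcases i with i | i <;> rfl
  simp only [mem_ofPred_eq, this]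

theorem DefRel.exists_formula {Ω : (ξ → 𝕄) → (η → 𝕄) → Prop} (hΩ : DefRel L Ω) {m n : ℕ}
    (e : Fin m ≃ ξ) (e' : Fin n ≃ η) : ∃ φ : L.Formula (Fin n ⊕ Fin m), ∀ u v,
      φ.Realize (Sum.elim u v) ↔ Ω (fun i => v (e.symm i)) fun i => u (e'.symm i) := by
  obtain ⟨φ, hφ⟩ := Set.empty_definable_iff.1 (hΩ.definable (fun i => Sum.inr (e.symm i))
    fun i => (Sum.inl (e'.symm i) : Fin n ⊕ Fin m))
  exact ⟨φ, fun u v => (iff_of_eq (congrArg (fun S => Sum.elim u v ∈ S) hφ)).symm⟩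

/-- Failure of Conant-dividing gives consistency along just one invariant Morley sequence, whose
type depends on the formula. This is why `exists_copy` needs a compactness argument in the space of
invariant types. -/
theorem ConantDivIndep.exists_morley (h𝕄 : IsMonster L 𝕄 κ) {M A B : Set 𝕄} (hM : #M < κ)
    (h : ConantDivIndep L M A B) [Finite ξ] [Finite η] {Ω : (ξ → 𝕄) → (η → 𝕄) → Prop}
    (hΩ : DefRel L Ω) {x : ξ → 𝕄} {y : η → 𝕄} (hx : ∀ i, x i ∈ A) (hy : ∀ i, y i ∈ M ∪ B)
    (hxy : Ω x y) : ∃ (r : GlobalType L 𝕄 η) (b : ℕ → η → 𝕄), AutInvariant M r ∧ IsMorleyOn r M b ∧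
      b 0 = y ∧ ∀ k, ∃ x, ∀ i < k, Ω x (b i) := by
  obtain ⟨m, ⟨e⟩⟩ := Finite.exists_equiv_fin ξ
  obtain ⟨n, ⟨e'⟩⟩ := Finite.exists_equiv_fin η
  obtain ⟨φ, hφ⟩ := hΩ.exists_formula e.symm e'.symm
  have := h m (fun i => x (e.symm i)) ⟨n, φ, fun i => y (e'.symm i)⟩ (fun i => hx _)
    (fun i => hy _) ((hφ _ _).2 (by simpa using hxy))
  simp only [ConantDivides, not_forall, not_not] at this
  obtain ⟨b, hb0, ⟨p, hp, hb⟩, hcon⟩ := this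
  obtain ⟨r, hr, hpr⟩ := h𝕄.exists_marginal (h𝕄.small_of_countable _) hM
    ((isInvariant_iff h𝕄 hM p).1 hp) fun i => Sum.inl (e' i)
  refine ⟨r, fun n i => b n (e' i), hr, IsMorleyOn.marginal h𝕄 (h𝕄.small_of_countable _) hM
    (f := fun i => Sum.inl (e' i)) hpr hb, ?_, fun k => ?_⟩
  · funext i
    simpa using congrFun hb0 (e' i)
  · obtain ⟨a, ha⟩ := hcon k
    exact ⟨_, fun i hi => (hφ _ _).1 (ha i hi)⟩

/-- Here, unlike for Conant-dividing, the Morley sequence is prescribed. A Kim-dividing formula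
Kim-forks, being a disjunction with one member. -/
theorem KimIndep.exists_of_isMorleyOn (h𝕄 : IsMonster L 𝕄 κ) {M A B : Set 𝕄} (hM : #M < κ)
    (h : KimIndep L M A B) [Finite ξ] [Finite η] {Ω : (ξ → 𝕄) → (η → 𝕄) → Prop}
    (hΩ : DefRel L Ω) {x : ξ → 𝕄} {y : η → 𝕄} (hx : ∀ i, x i ∈ A) (hy : ∀ i, y i ∈ M ∪ B)
    (hxy : Ω x y) {r : GlobalType L 𝕄 η} (hr : AutInvariant M r) {b : ℕ → η → 𝕄}
    (hb : IsMorleyOn r M b) (hb0 : b 0 = y) (k : ℕ) : ∃ x, ∀ i < k, Ω x (b i) := by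
  obtain ⟨m, ⟨e⟩⟩ := Finite.exists_equiv_fin ξ
  obtain ⟨n, ⟨e'⟩⟩ := Finite.exists_equiv_fin η
  obtain ⟨φ, hφ⟩ := hΩ.exists_formula e.symm e'.symm
  let ψ : ParamFormula L 𝕄 m := ⟨n, φ, fun i => y (e'.symm i)⟩
  have hfork : ¬ KimForks M ψ := h m (fun i => x (e.symm i)) ψ (fun i => hx _)
    (fun i => hy _) ((hφ _ _).2 (by simpa [ψ] using hxy))
  have hdiv : ¬ KimDivides M ψ := fun hψ => hfork ⟨{ψ}, finite_singleton _,
    fun χ hχ => by rwa [mem_singleton_iff.1 hχ], fun a ha => ⟨ψ, rfl, ha⟩⟩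
  obtain ⟨p, hp, hpr⟩ := h𝕄.exists_marginal (h𝕄.small_of_countable _) hM hr
    fun i => Sum.inl (e'.symm i)
  by_contra hcon
  refine hdiv ⟨fun n i => b n (e'.symm i), funext fun i => congrFun hb0 _, ⟨p, (isInvariant_iff h𝕄 hM p).2 hp,
    IsMorleyOn.marginal h𝕄 (h𝕄.small_of_countable _) hM (f := fun i => Sum.inl (e'.symm i))
      hpr hb⟩, fun hc => hcon ?_⟩
  obtain ⟨a, ha⟩ := hc k
  refine ⟨fun i => a (e i), fun i hi => ?_⟩
  have := (hφ _ _).1 (ha i hi)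
  simpa using this

theorem IsMonster.mk_seqSet_lt (h𝕄 : IsMonster L 𝕄 κ) (hα : SmallIndex κ α) (I : ℕ → α → 𝕄) :
    #(seqSet I) < κ := by
  refine (mk_le_mk_of_subset ?_).trans_lt ((h𝕄.small_prod (h𝕄.small_of_countable ℕ)
    hα).mk_range_lt fun t : ℕ × α => I t.1 t.2)
  rintro _ ⟨i, j, rfl⟩
  exact ⟨(i, j), rfl⟩

/-- If a Morley sequence over `M` is indiscernible over `ME`, then no formula of `tp(E/MI)`
Conant-divides over `M`. -/
theorem IsIndiscernible.conantDivIndep (h𝕄 : IsMonster L 𝕄 κ) (hα : SmallIndex κ α) {M E : Set 𝕄}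
    (hM : #M < κ) {p : GlobalType L 𝕄 α} (hp : AutInvariant M p) {I : ℕ → α → 𝕄}
    (hI : IsMorleyOn p M I) (hE : IsIndiscernible L (M ∪ E) I) :
    ConantDivIndep L M E (seqSet I) := by
  rintro m a ⟨n, φ, c⟩ ha hc hφ hdiv
  -- The parameters lie in `M` and the first `k` terms of `I`, so the successive `k`-blocks of `I`
  -- continue them to an invariant Morley sequence, along which `a` is a common solution.
  have : ∃ (k : ℕ) (g : Fin n → (Fin k × α) ⊕ M), c = selectTuple g fun i => I i := by
    have : ∀ i, ∃ j : (ℕ × α) ⊕ M, c i = Sum.elim (fun x => I x.1 x.2) (↑) j := fun i => by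
      rcases hc i with h | ⟨j, l, h⟩
      · exact ⟨Sum.inr ⟨_, h⟩, rfl⟩
      · exact ⟨Sum.inl (j, l), h.symm⟩
    choose g hg using this
    let N : Fin n → ℕ := fun i => Sum.elim (fun x => x.1) (fun _ => 0) (g i)
    have hN : ∀ i, N i < Finset.univ.sup N + 1 := fun i =>
      Nat.lt_succ_of_le (Finset.le_sup (f := N) (Finset.mem_univ i))
    refine ⟨Finset.univ.sup N + 1, fun i => Sum.map (fun x => (⟨N i, hN i⟩, x.2)) id (g i),
      funext fun i => ?_⟩
    have key : ∀ (K l : ℕ) (hl : l < K) (j : (ℕ × α) ⊕ M), l = Sum.elim (fun x => x.1) (fun _ => 0) j →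
        Sum.elim (fun x => I x.1 x.2) (↑) j = Sum.elim (fun x : Fin K × α => I x.1 x.2) (↑)
          (Sum.map (fun x => ((⟨l, hl⟩ : Fin K), x.2)) id j) := by
      rintro K l hl (x | x) rfl <;> rfl
    exact (hg i).trans (key _ _ (hN i) (g i) rfl)
  obtain ⟨k, g, rfl⟩ := this
  obtain ⟨p', hp', h⟩ := h𝕄.exists_block_type hα hM hp g
  refine hdiv (fun n => selectTuple g fun i => I (k * n + i)) (by simp)
    ⟨p', (isInvariant_iff h𝕄 hM p').2 hp', h𝕄.isMorleyOn_blocks hα subset_rfl hM h hI⟩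
    fun l => ⟨a, fun i _ => ?_⟩
  have hdef : (M ∪ E).Definable L {v : Fin k × α → 𝕄 |
      φ.Realize (Sum.elim (fun i => Sum.elim v (↑) (g i)) a)} := by
    refine (congrArg (fun S => (M ∪ E).Definable L S) (Set.ext fun v => ?_)).mp
      (definable_preimage_subst ((defRel_realize φ).left (A := M ∪ E) (y := a)
        fun i => Or.inr (ha i)) fun i => Sum.map id (inclusion subset_union_left) (g i))
    refine iff_of_eq (congrArg φ.Realize (congrArg (fun u => Sum.elim u a) (funext fun i => ?_)))
    rcases g i with x | x <;> rfl
  exact (sameType_iff.1 (hE k (fun i => i) (fun x : Fin k => k * i + (x : ℕ)) Fin.val_strictMono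
    fun x y hxy => Nat.add_lt_add_left hxy _) _ hdef).1 hφ

/-- A definable set of sequences depends on finitely many terms only. -/
theorem exists_fin_support {A : Set 𝕄} {T : Set (ℕ × α → 𝕄)} (hT : A.Definable L T) :
    ∃ N, ∀ K ≥ N, ∃ T' : Set (Fin K × α → 𝕄), A.Definable L T' ∧
      T = {x | (fun t : Fin K × α => x (t.1, t.2)) ∈ T'} := by
  classical
  obtain ⟨F, T', hT', rfl⟩ := exists_finset_support hT
  refine ⟨F.sup (fun x => x.1) + 1, fun K hK => ?_⟩
  have hF : ∀ x : F, x.1.1 < K := fun x => (Nat.lt_succ_of_le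
    (Finset.le_sup (f := fun x : ℕ × α => x.1) x.2)).trans_le hK
  exact ⟨_, hT'.preimage_comp fun x : F => ((⟨x.1.1, hF x⟩ : Fin K), x.1.2), rfl⟩

/-- A sequence of the same type satisfying a given condition termwise exists if there are
arbitrarily long finite approximations. -/
theorem IsMonster.exists_sameTypeSeq (h𝕄 : IsMonster L 𝕄 κ) (hα : SmallIndex κ α) {D A : Set 𝕄}
    (hD : #D < κ) (hA : #A < κ) (I : ℕ → α → 𝕄) {Y : Set (α → 𝕄)} (hY : A.Definable L Y)
    (h : ∀ k (T : Set (Fin k × α → 𝕄)), D.Definable L T → (fun t : Fin k × α => I t.1 t.2) ∈ T →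
      ∃ x ∈ T, ∀ j, (fun i => x (j, i)) ∈ Y) :
    ∃ J, SameTypeSeq L D I J ∧ ∀ j, J j ∈ Y := by
  obtain ⟨y, hy⟩ := h𝕄.exists_mem_of_fip (h𝕄.small_prod (h𝕄.small_of_countable ℕ) hα)
    (h𝕄.mk_union_lt hD hA)
    (𝒮 := {T | D.Definable L T ∧ (fun t : ℕ × α => I t.1 t.2) ∈ T} ∪
      {T | ∃ j, T = {x : ℕ × α → 𝕄 | (fun i => x (j, i)) ∈ Y}})
    (by
      rintro _ (⟨hT, -⟩ | ⟨j, rfl⟩)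
      · exact hT.mono subset_union_left
      · exact (hY.mono subset_union_right).preimage_comp fun i => (j, i))
    (by
      intro 𝒯 h𝒯 hfin
      have : ∃ (S : Set (ℕ × α → 𝕄)) (k : ℕ), D.Definable L S ∧ (fun t : ℕ × α => I t.1 t.2) ∈ S ∧
          ∀ y ∈ S, (∀ j < k, (fun i => y (j, i)) ∈ Y) → y ∈ ⋂₀ 𝒯 := by
        induction 𝒯, hfin using Set.Finite.induction_on with
        | empty => exact ⟨univ, 0, definable_univ, mem_univ _, fun _ _ _ => by simp⟩
        | @insert T 𝒯 _ _ ih =>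
          obtain ⟨S, k, hS, hSr, h𝒯'⟩ := ih ((subset_insert _ _).trans h𝒯)
          rcases h𝒯 (mem_insert _ _) with ⟨hT, hTr⟩ | ⟨j, rfl⟩
          · refine ⟨T ∩ S, k, hT.inter hS, ⟨hTr, hSr⟩, fun y h1 h2 => ?_⟩
            rw [sInter_insert]
            exact ⟨h1.1, h𝒯' y h1.2 h2⟩
          · refine ⟨S, max k (j + 1), hS, hSr, fun y h1 h2 => ?_⟩
            rw [sInter_insert]
            exact ⟨h2 j (by omega), h𝒯' y h1 fun j hj => h2 j (by omega)⟩
      obtain ⟨S, k, hS, hIS, hST⟩ := this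
      obtain ⟨N, hN⟩ := exists_fin_support hS
      obtain ⟨T, hT, rfl⟩ := hN (max N k) (le_max_left _ _)
      obtain ⟨x, hx, hxY⟩ := h _ T hT hIS
      refine ⟨fun t => if ht : t.1 < max N k then x (⟨t.1, ht⟩, t.2) else Classical.arbitrary 𝕄,
        hST _ ?_ fun j hj => ?_⟩
      · have : ∀ t : Fin (max N k), (t : ℕ) < max N k := fun t => t.2
        simp only [mem_ofPred_eq, this, dite_true]
        exact hx
      · have hj' : j < max N k := lt_max_of_lt_right hj
        simpa only [hj', dite_true] using hxY ⟨j, hj'⟩)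
  exact ⟨fun j i => y (j, i), sameType_of_imp fun S hS hI => hy S (Or.inl ⟨hS, hI⟩),
    fun j => hy _ (Or.inr ⟨j, rfl⟩)⟩

end Marginals

/-! ### Consequences of symmetry: invariant copies and nice extensions. -/

section Copies

variable {L : FirstOrder.Language.{u, v}} {𝕄 : Type w} [L.Structure 𝕄] [Nonempty 𝕄]
  {κ : Cardinal.{w}} {ξ η ζ ε ι : Type*} [Finite ξ] [Finite η] [Finite ζ] [Finite ε]
  {Φ : (ξ → 𝕄) → (η → 𝕄) → Prop} {Ψ : (ξ → 𝕄) → (ζ → 𝕄) → Prop}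

theorem definable_exists {A : Set 𝕄} {S : Set (ι ⊕ ε → 𝕄)} (hS : A.Definable L S) :
    A.Definable L {e : ε → 𝕄 | ∃ x, Sum.elim x e ∈ S} := by
  refine (congrArg (fun S => A.Definable L S) (Set.ext fun e => ⟨?_, ?_⟩)).mp
    (definable_image_comp hS (Sum.inr : ε → ι ⊕ ε))
  · rintro ⟨x, hx, hxe⟩
    refine ⟨fun i => x (.inl i), ?_⟩
    have : Sum.elim (fun i => x (.inl i)) e = x := by
      funext i
      rcases i with i | i
      exacts [rfl, hxe i]
    rwa [this]
  · rintro ⟨x, hx⟩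
    exact ⟨_, hx, fun i => rfl⟩

/-- Make I indiscernible over ME. Then E is Conant-independent from I, and by symmetry I from E.
Each formula of tp(I/ME) is therefore consistent along some invariant Morley sequence of E; its
first two terms give E and a copy E'. Compactness makes the invariant type uniform. -/
theorem exists_copy (h𝕄 : IsMonster L 𝕄 κ)
    (hsymm : IsSymmetricRel L κ (ConantDivIndep L (𝕄 := 𝕄)))
    (M : L.ElementarySubstructure 𝕄) (hM : #M < κ) {q : GlobalType L 𝕄 ξ}
    (hq : AutInvariant (M : Set 𝕄) q) {Θ : (ξ → 𝕄) → (ε → 𝕄) → Prop} (hΘ : DefRel L Θ)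
    {I : ℕ → ξ → 𝕄} (hI : IsMorleyOn q (M : Set 𝕄) I) {E : ε → 𝕄} (hIE : ∀ j, Θ (I j) E) :
    ∃ R : GlobalType L 𝕄 ε, AutInvariant (M : Set 𝕄) R ∧ RealizesOver R (M : Set 𝕄) E ∧
      ∃ E', RealizesOver R ((M : Set 𝕄) ∪ range E) E' ∧
        ∃ I' : ℕ → ξ → 𝕄, IsMorleyOn q (M : Set 𝕄) I' ∧ ∀ j, Θ (I' j) E ∧ Θ (I' j) E' := by
  have hξ := h𝕄.small_of_countable ξ
  have hE : #(range E) < κ := (h𝕄.small_of_countable ε).mk_range_lt E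
  have hD : #((M : Set 𝕄) ∪ range E : Set 𝕄) < κ := h𝕄.mk_union_lt hM hE
  have hEdef : ((M : Set 𝕄) ∪ range E).Definable L {x | Θ x E} := hΘ.left fun i => Or.inr ⟨i, rfl⟩
  obtain ⟨I₁, hind, hI₁, hI₁Θ⟩ := (hI.isIndiscernible h𝕄 hξ hM hq).exists_indiscernible h𝕄 hξ
    (subset_union_left : (M : Set 𝕄) ⊆ M ∪ range E) hD
  replace hI₁Θ : ∀ i, Θ (I₁ i) E := hI₁Θ _ hEdef hIE
  have hI₁M := hI.of_sameTypeSeq h𝕄 hξ hM hq hI₁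
  have hcd := hsymm M hM _ _ hE (h𝕄.mk_seqSet_lt hξ I₁) (hind.conantDivIndep h𝕄 hξ hM hq hI₁M)
  -- The copies e for which some sequence in `T` has its first k terms related both to E and to e.
  -- The type `R` must contain all of these for `T` in the type of I₁ over `M`.
  let G : Set (ℕ × ξ → 𝕄) → ℕ → Set (ε → 𝕄) := fun T k =>
    {e | ∃ x ∈ T, ∀ j < k, Θ (fun i => x (j, i)) E ∧ Θ (fun i => x (j, i)) e}
  have hG : ∀ T k, (M : Set 𝕄).Definable L T → ((M : Set 𝕄) ∪ range E).Definable L (G T k) := by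
    intro T k hT
    have h2 : ((M : Set 𝕄) ∪ range E).Definable L
        {v : (ℕ × ξ) ⊕ ε → 𝕄 | ∀ j : Fin k, Θ (fun i => v (.inl (j, i))) E ∧
          Θ (fun i => v (.inl (j, i))) fun i => v (.inr i)} :=
      definable_forall_finite fun j => Definable.inter
        (hEdef.preimage_comp fun i => (Sum.inl (((j : Fin k) : ℕ), i) : (ℕ × ξ) ⊕ ε))
        ((hΘ.definable (fun i => Sum.inl ((j : ℕ), i)) Sum.inr).mono (empty_subset _))
    refine (congrArg (fun S => Set.Definable _ L S) (Set.ext fun e => ?_)).mp (definable_exists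
      (((hT.mono subset_union_left).preimage_comp Sum.inl).inter h2))
    exact exists_congr fun x => and_congr_right fun _ => ⟨fun h j hj => h ⟨j, hj⟩, fun h j => h j j.2⟩
  obtain ⟨R, hR, hR𝒢⟩ := exists_autInvariant_of_finite (L := L) (M := (M : Set 𝕄))
    ({S : Set (ε → 𝕄) | (M : Set 𝕄).Definable L S ∧ E ∈ S} ∪ {S | ∃ T k, (M : Set 𝕄).Definable L T ∧
      (fun t : ℕ × ξ => I₁ t.1 t.2) ∈ T ∧ S = G T k})
    (by
      rintro S (⟨hS, -⟩ | ⟨T, k, hT, -, rfl⟩)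
      · exact hS.mono (subset_univ _)
      · exact (hG T k hT).mono (subset_univ _))
    (by
      intro 𝒯 h𝒯 hfin
      have : ∃ (S : Set (ε → 𝕄)) (T : Set (ℕ × ξ → 𝕄)) (k : ℕ), (M : Set 𝕄).Definable L S ∧
          E ∈ S ∧ (M : Set 𝕄).Definable L T ∧ (fun t : ℕ × ξ => I₁ t.1 t.2) ∈ T ∧
          ∀ X ∈ 𝒯, S ∩ G T k ⊆ X := by
        induction 𝒯, hfin using Set.Finite.induction_on with
        | empty => exact ⟨univ, univ, 0, definable_univ, mem_univ _, definable_univ, mem_univ _,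
            fun X hX => absurd hX (notMem_empty X)⟩
        | @insert X 𝒯 _ _ ih =>
          obtain ⟨S, T, k, hS, hES, hT, hIT, hX⟩ := ih ((subset_insert _ _).trans h𝒯)
          rcases h𝒯 (mem_insert _ _) with ⟨hX1, hX2⟩ | ⟨T', k', hT', hIT', rfl⟩
          · refine ⟨X ∩ S, T, k, hX1.inter hS, ⟨hX2, hES⟩, hT, hIT, ?_⟩
            rintro Y (rfl | hY) e ⟨he1, he2⟩
            exacts [he1.1, hX Y hY ⟨he1.2, he2⟩]
          · refine ⟨S, T' ∩ T, max k' k, hS, hES, hT'.inter hT, ⟨hIT', hIT⟩, ?_⟩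
            rintro Y (rfl | hY) e ⟨he1, x, hx, hxe⟩
            · exact ⟨x, hx.1, fun j hj => hxe j (by omega)⟩
            · exact hX Y hY ⟨he1, x, hx.2, fun j hj => hxe j (by omega)⟩
      obtain ⟨S, T, k, hS, hES, hT, hIT, h𝒯S⟩ := this
      obtain ⟨N, hN⟩ := exists_fin_support hT
      obtain ⟨T', hT', hTT'⟩ := hN (max N k) (le_max_left _ _)
      obtain ⟨n, m, Ψ, hΨ, hm, rfl⟩ := exists_defRel_of_definable hT'
      have hΩ : DefRel L fun (x : Fin (max N k) × ξ → 𝕄) (y : ε ⊕ Fin n → 𝕄) =>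
          Ψ x (fun i => y (.inr i)) ∧ ∀ j, Θ (fun i => x (j, i)) fun i => y (.inl i) :=
        (hΨ.definable Sum.inl fun i => Sum.inr (Sum.inr i)).inter
          (hΘ.forall_left.definable Sum.inl fun i => Sum.inr (Sum.inl i))
      obtain ⟨r, b, hr, hb, hb0, hcon⟩ := hcd.exists_morley h𝕄 hM hΩ
        (x := fun t => I₁ t.1 t.2) (y := Sum.elim E m) (fun i => ⟨_, _, rfl⟩)
        (by rintro (i | i); exacts [Or.inr ⟨i, rfl⟩, Or.inl (hm i)])
        ⟨by rw [hTT'] at hIT; exact hIT, fun j => hI₁Θ j⟩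
      obtain ⟨R, hR, hrR⟩ := h𝕄.exists_marginal (h𝕄.small_of_countable _) hM hr
        fun i : ε => Sum.inl (Sum.inl i)
      have hE0 : RealizesOver R (M : Set 𝕄) E := by
        have := hrR _ subset_rfl hM (b 0) ((hb 0).mono subset_union_left)
        rwa [hb0] at this
      have hE1 : RealizesOver R ((M : Set 𝕄) ∪ range E) fun i => b 1 (.inl i) := by
        refine hrR _ subset_union_left hD (b 1) ((hb 1).mono (union_subset_union_right _ ?_))
        rintro _ ⟨i, rfl⟩
        exact ⟨0, one_pos, .inl i, by rw [hb0]; rfl⟩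
      -- Two terms suffice: the term at 0 is E with the parameters from `M`, the term at 1 contains
      -- the copy.
      obtain ⟨x, hx⟩ := hcon 2
      obtain ⟨hx0, hx0'⟩ := hx 0 (by norm_num)
      obtain ⟨-, hx1⟩ := hx 1 (by norm_num)
      rw [hb0] at hx0 hx0'
      refine ⟨R, hR, fun X hX => Filter.mem_of_superset (Filter.inter_mem ?_ ?_) (h𝒯S X hX)⟩
      · exact (hE0.mem_iff hS).1 hES
      · refine (hE1.mem_iff (hG T k hT)).1 ⟨fun t => if ht : t.1 < max N k then x (⟨t.1, ht⟩, t.2)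
          else Classical.arbitrary 𝕄, ?_, fun j hj => ?_⟩
        · rw [hTT']
          have : ∀ t : Fin (max N k), (t : ℕ) < max N k := fun t => t.2
          simp only [mem_ofPred_eq, this, dite_true]
          exact hx0
        · have hj' : j < max N k := lt_max_of_lt_right hj
          simp only [hj', dite_true]
          exact ⟨hx0' ⟨j, hj'⟩, hx1 ⟨j, hj'⟩⟩)
  obtain ⟨E', hE'⟩ := h𝕄.exists_realizesOver (h𝕄.small_of_countable ε) R hD
  obtain ⟨I', hI', hI'Θ⟩ := h𝕄.exists_sameTypeSeq hξ hM
    (h𝕄.mk_union_lt hE ((h𝕄.small_of_countable ε).mk_range_lt E')) I₁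
    (Y := {x | Θ x E} ∩ {x | Θ x E'})
    ((hΘ.left fun i => Or.inl ⟨i, rfl⟩).inter (hΘ.left fun i => Or.inr ⟨i, rfl⟩))
    (fun k T hT hIT => by
      have hT' := hT.preimage_comp fun t : Fin k × ξ => ((t.1 : ℕ), t.2)
      obtain ⟨x, hx, hxE⟩ := (hE'.mem_iff (hG _ k hT')).2 (hR𝒢 _ (Or.inr ⟨_, k, hT', hIT, rfl⟩))
      exact ⟨_, hx, fun j => hxE j j.2⟩)
  exact ⟨R, hR, realizesOver_iff.2 fun S hS hSR => by_contra fun hES => by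
    have := hR𝒢 Sᶜ (Or.inl ⟨hS.compl, hES⟩)
    obtain ⟨x, hx, hx'⟩ := Filter.nonempty_of_mem (Filter.inter_mem hSR this)
    exact hx' hx, E', hE', I', hI₁M.of_sameTypeSeq h𝕄 hξ hM hq hI', hI'Θ⟩

/-- Suppose every invariant extension of tp(a/M) contains the failure. Repeated copying of all
previous data (`exists_copy`) produces a_n's that stay jointly consistent along Morley sequences in
`q` yet fail with all earlier b_i's, against `exists_and_of_isMorleyOn`. -/
theorem exists_autInvariant_and (h𝕄 : IsMonster L 𝕄 κ) (hN : IsNSOP L 𝕄 3)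
    (hsymm : IsSymmetricRel L κ (ConantDivIndep L (𝕄 := 𝕄)))
    (M : L.ElementarySubstructure 𝕄) (hM : #M < κ) {q : GlobalType L 𝕄 ξ}
    (hq : AutInvariant (M : Set 𝕄) q) (hΦ : DefRel L Φ) (hΨ : DefRel L Ψ)
    {I : ℕ → ξ → 𝕄} (hI : IsMorleyOn q (M : Set 𝕄) I) {a : η → 𝕄} (hIa : ∀ j, Φ (I j) a)
    {b : ζ → 𝕄} (hqb : {x | Ψ x b} ∈ typeFilter q) :
    ∃ r : GlobalType L 𝕄 η, AutInvariant (M : Set 𝕄) r ∧ RealizesOver r (M : Set 𝕄) a ∧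
      {y | ∃ x, Φ x y ∧ Ψ x b} ∈ typeFilter r := by
  by_contra hcon
  have hθ : ∀ r : GlobalType L 𝕄 η, AutInvariant (M : Set 𝕄) r → RealizesOver r (M : Set 𝕄) a →
      {y | ¬ ∃ x, Φ x y ∧ Ψ x b} ∈ typeFilter r := fun r hr hra =>
    (rel_or_not r (hΦ.exists_and hΨ)).resolve_left fun h => hcon ⟨r, hr, hra, h⟩
  obtain ⟨s, hs, hsb⟩ := exists_autInvariant_extension M b
  obtain ⟨f, hf⟩ := exists_seq_of_forall_exists (X := (η → 𝕄) × (ζ → 𝕄))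
    (fun n g x => (∃ I : ℕ → ξ → 𝕄, IsMorleyOn q (M : Set 𝕄) I ∧
        ∀ j, (∀ i, Φ (I j) (g i).1) ∧ Φ (I j) x.1) ∧ (n = 0 → x.1 = a) ∧
      (∀ i, ¬ ∃ y, Φ y x.1 ∧ Ψ y (g i).2) ∧
      RealizesOver s (((M : Set 𝕄) ∪ (range fun t : Fin n × η => (g t.1).1 t.2) ∪ range x.1) ∪
        range fun t : Fin n × ζ => (g t.1).2 t.2) x.2)
    (fun n g hg => by
      suffices h : ∃ x : η → 𝕄, (∃ I : ℕ → ξ → 𝕄, IsMorleyOn q (M : Set 𝕄) I ∧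
          ∀ j, (∀ i, Φ (I j) (g i).1) ∧ Φ (I j) x) ∧ (n = 0 → x = a) ∧
          (∀ i, ¬ ∃ y, Φ y x ∧ Ψ y (g i).2) by
        obtain ⟨x, h1, h2, h3⟩ := h
        obtain ⟨y, hy⟩ := h𝕄.exists_realizesOver (h𝕄.small_of_countable _) s
          (h𝕄.mk_union_lt (h𝕄.mk_union_lt (h𝕄.mk_union_lt hM
            (h𝕄.mk_before_lt (h𝕄.small_of_countable _) fun i => (g i).1))
            ((h𝕄.small_of_countable _).mk_range_lt x))
            (h𝕄.mk_before_lt (h𝕄.small_of_countable _) fun i => (g i).2))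
        exact ⟨(x, y), h1, h2, h3, hy⟩
      rcases n with _ | n
      · exact ⟨a, ⟨I, hI, fun j => ⟨fun i => i.elim0, hIa j⟩⟩, fun _ => rfl, fun i => i.elim0⟩
      obtain ⟨I₀, hI₀, hI₀g⟩ : ∃ I : ℕ → ξ → 𝕄, IsMorleyOn q (M : Set 𝕄) I ∧
          ∀ j i, Φ (I j) (g i).1 := by
        obtain ⟨⟨I, hI, hIg⟩, -⟩ := hg (Fin.last n)
        refine ⟨I, hI, fun j i => ?_⟩
        induction i using Fin.lastCases with
        | last => exact (hIg j).2
        | cast i => exact (hIg j).1 i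
      have hg0 : (g 0).1 = a := (hg 0).2.1 rfl
      have hΘ : DefRel L fun x (e : Fin (n + 1) × (η ⊕ ζ) → 𝕄) =>
          ∀ i, Φ x fun l => e (i, .inl l) :=
        definable_forall_finite fun i => hΦ.definable Sum.inl fun l => Sum.inr (i, Sum.inl l)
      obtain ⟨R, hR, hRE, E', hE', I', hI', hI'E⟩ := exists_copy h𝕄 hsymm M hM hq hΘ hI₀
        (E := fun t => Sum.elim (g t.1).1 (g t.1).2 t.2) hI₀g
      obtain ⟨r, hr, hRr⟩ := h𝕄.exists_marginal (h𝕄.small_of_countable _) hM hR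
        fun l : η => Sum.inl ((0 : Fin (n + 1)), (Sum.inl l : η ⊕ ζ))
      -- The new term is the copy of a_0 = a: its invariant type extends tp(a/M), so by assumption
      -- it contains the failure with b, and by invariance with each b_i.
      refine ⟨fun l => E' (0, .inl l), ⟨I', hI', fun j => ⟨(hI'E j).1, (hI'E j).2 0⟩⟩,
        fun h => absurd h n.succ_ne_zero, fun i => ?_⟩
      have hra := hRr _ subset_rfl hM _ hRE
      have hra' := hRr _ subset_union_left (h𝕄.mk_union_lt hM
        ((h𝕄.small_of_countable _).mk_range_lt _)) _ hE'
      refine hra'.rel (hΦ.exists_and hΨ).not (fun l => Or.inr ⟨(i, .inr l), rfl⟩) ?_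
      refine hr.rel h𝕄 hM (hΦ.exists_and hΨ).not (hsb.sameType ((hg i).2.2.2.mono fun x hx =>
        Or.inl (Or.inl (Or.inl hx)))) (hθ r hr ?_)
      rw [← hg0]
      exact hra)
  have hB : ∀ m, RealizesOver s (((M : Set 𝕄) ∪ range fun t : Fin (m + 1) × η => (f t.1).1 t.2) ∪
      range fun t : Fin m × ζ => (f t.1).2 t.2) (f m).2 := fun m => (hf m).2.2.2.mono <| by
    rintro y ((hy | ⟨⟨t, l⟩, rfl⟩) | hy)
    · exact Or.inl (Or.inl (Or.inl hy))
    · induction t using Fin.lastCases with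
      | last => exact Or.inl (Or.inr ⟨l, rfl⟩)
      | cast t => exact Or.inl (Or.inl (Or.inr ⟨(t, l), rfl⟩))
    · exact Or.inr hy
  obtain ⟨i, j, hij, h⟩ := exists_and_of_isMorleyOn h𝕄 hN hM hq hs hΦ hΨ hsb hqb
    (fun n => (f n).1) (fun n => (f n).2) hB fun n => by
      obtain ⟨⟨I, hI, hIf⟩, -⟩ := hf n
      exact ⟨I, hI, fun i hi j => (hIf j).1 ⟨i, hi⟩⟩
  exact (hf j).2.2.1 ⟨i, hij⟩ h

/-- Niceness amounts to closed conditions on `r`. Finitely many of them reduce to one formula Ψ(x,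
b) in a power of `q`, where `exists_autInvariant_and` applies; compactness of the invariant types
then gives a single `r`. -/
theorem exists_nice (h𝕄 : IsMonster L 𝕄 κ) (hN : IsNSOP L 𝕄 3)
    (hsymm : IsSymmetricRel L κ (ConantDivIndep L (𝕄 := 𝕄)))
    (M : L.ElementarySubstructure 𝕄) (hM : #M < κ) {q : GlobalType L 𝕄 ξ}
    (hq : AutInvariant (M : Set 𝕄) q) (hΦ : DefRel L Φ)
    {I : ℕ → ξ → 𝕄} (hI : IsMorleyOn q (M : Set 𝕄) I) {a : η → 𝕄} (hIa : ∀ j, Φ (I j) a) :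
    ∃ r : GlobalType L 𝕄 η, AutInvariant (M : Set 𝕄) r ∧ RealizesOver r (M : Set 𝕄) a ∧
      Nice κ (M : Set 𝕄) r q Φ := by
  have hξ := h𝕄.small_of_countable ξ
  let G : Set (ℕ × ξ → 𝕄) → ℕ → Set (η → 𝕄) := fun T k =>
    {y | ∃ x ∈ T, ∀ j < k, Φ (fun i => x (j, i)) y}
  have hG : ∀ (A : Set 𝕄) T k, A.Definable L T → A.Definable L (G T k) := by
    intro A T k hT
    have h2 : A.Definable L {v : (ℕ × ξ) ⊕ η → 𝕄 | ∀ j : Fin k,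
        Φ (fun i => v (.inl (j, i))) fun i => v (.inr i)} :=
      definable_forall_finite fun j =>
        (hΦ.definable (fun i => Sum.inl ((j : ℕ), i)) Sum.inr).mono (empty_subset _)
    refine (congrArg (fun S => Set.Definable _ L S) (Set.ext fun e => ?_)).mp (definable_exists
      ((hT.preimage_comp Sum.inl).inter h2))
    exact exists_congr fun x => and_congr_right fun _ => ⟨fun h j hj => h ⟨j, hj⟩, fun h j => h j j.2⟩
  -- These are the formulas over `A` true of all Morley sequences in `q` over MA, that is, the
  -- infinite power of `q`.
  let P : Set 𝕄 → Set (ℕ × ξ → 𝕄) → Prop := fun A T => #A < κ ∧ A.Definable L T ∧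
    ∀ I : ℕ → ξ → 𝕄, IsMorleyOn q (M ∪ A) I → (fun t : ℕ × ξ => I t.1 t.2) ∈ T
  obtain ⟨r, hr, hr𝒢⟩ := exists_autInvariant_of_finite (L := L) (M := (M : Set 𝕄))
    ({S : Set (η → 𝕄) | (M : Set 𝕄).Definable L S ∧ a ∈ S} ∪ {S | ∃ A T k, P A T ∧ S = G T k})
    (by
      rintro S (⟨hS, -⟩ | ⟨A, T, k, hT, rfl⟩)
      · exact hS.mono (subset_univ _)
      · exact (hG A T k hT.2.1).mono (subset_univ _))
    (by
      intro 𝒯 h𝒯 hfin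
      have : ∃ (S : Set (η → 𝕄)) (A : Set 𝕄) (T : Set (ℕ × ξ → 𝕄)) (k : ℕ),
          (M : Set 𝕄).Definable L S ∧ a ∈ S ∧ P A T ∧ ∀ X ∈ 𝒯, S ∩ G T k ⊆ X := by
        induction 𝒯, hfin using Set.Finite.induction_on with
        | empty => exact ⟨univ, ∅, univ, 0, definable_univ, mem_univ _,
            ⟨h𝕄.mk_lt_of_finite finite_empty, definable_univ, fun _ _ => mem_univ _⟩,
            fun X hX => absurd hX (notMem_empty X)⟩
        | @insert X 𝒯 _ _ ih =>
          obtain ⟨S, A, T, k, hS, hES, ⟨hA, hT, hIT⟩, hX⟩ := ih ((subset_insert _ _).trans h𝒯)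
          rcases h𝒯 (mem_insert _ _) with ⟨hX1, hX2⟩ | ⟨A', T', k', ⟨hA', hT', hIT'⟩, rfl⟩
          · refine ⟨X ∩ S, A, T, k, hX1.inter hS, ⟨hX2, hES⟩, ⟨hA, hT, hIT⟩, ?_⟩
            rintro Y (rfl | hY) e ⟨he1, he2⟩
            exacts [he1.1, hX Y hY ⟨he1.2, he2⟩]
          · refine ⟨S, A' ∪ A, T' ∩ T, max k' k, hS, hES, ⟨h𝕄.mk_union_lt hA' hA,
              (hT'.mono subset_union_left).inter (hT.mono subset_union_right), fun I hI =>
              ⟨hIT' I (hI.mono (union_subset_union_right _ subset_union_left)),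
              hIT I (hI.mono (union_subset_union_right _ subset_union_right))⟩⟩, ?_⟩
            rintro Y (rfl | hY) e ⟨he1, x, hx, hxe⟩
            · exact ⟨x, hx.1, fun j hj => hxe j (by omega)⟩
            · exact hX Y hY ⟨he1, x, hx.2, fun j hj => hxe j (by omega)⟩
      obtain ⟨S, A, T, k, hS, haS, ⟨hA, hT, hIT⟩, h𝒯S⟩ := this
      obtain ⟨N, hN'⟩ := exists_fin_support hT
      obtain ⟨T', hT', hTT'⟩ := hN' (max N k) (le_max_left _ _)
      obtain ⟨n, b, Ψ, hΨ, hb, rfl⟩ := exists_defRel_of_definable hT'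
      obtain ⟨q', hq'⟩ := h𝕄.exists_isPower hξ hM hq (max N k)
      have hD : #((M : Set 𝕄) ∪ A : Set 𝕄) < κ := h𝕄.mk_union_lt hM hA
      have hqb : {x | Ψ x b} ∈ typeFilter q' := by
        obtain ⟨J, hJ⟩ := h𝕄.exists_morley' hξ hD q
        have := hq'.2 _ subset_union_left hD (fun i => J i) (hJ.comp Fin.val_strictMono)
        refine (this.mem_iff (hT'.mono subset_union_right)).1 ?_
        have h := hIT J hJ
        rw [hTT'] at h
        exact h
      obtain ⟨r, hr, hra, hrb⟩ := exists_autInvariant_and h𝕄 hN hsymm M hM hq'.1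
        (hΦ.forall_left (k := max N k)) hΨ (hq'.isMorleyOn h𝕄 hξ subset_rfl hM hI)
        (fun j l => hIa (max N k * j + l)) hqb
      refine ⟨r, hr, fun X hX => Filter.mem_of_superset (Filter.inter_mem
        ((hra.mem_iff hS).1 haS) (Filter.mem_of_superset hrb ?_)) (h𝒯S X hX)⟩
      rintro y ⟨x, hx1, hx2⟩
      refine ⟨fun t => if ht : t.1 < max N k then x (⟨t.1, ht⟩, t.2)
          else Classical.arbitrary 𝕄, ?_, fun j hj => ?_⟩
      · rw [hTT']
        have : ∀ t : Fin (max N k), (t : ℕ) < max N k := fun t => t.2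
        simp only [mem_ofPred_eq, this, dite_true]
        exact hx2
      · have hj' : j < max N k := lt_max_of_lt_right hj
        simp only [hj', dite_true]
        exact hx1 ⟨j, hj'⟩)
  refine ⟨r, hr, realizesOver_iff.2 fun S hS hSR => by_contra fun hES => ?_,
    nice_of_fin h𝕄 hM hq hΦ fun n k b Θ hΘ hΘr q' hq' hcon => ?_⟩
  · obtain ⟨x, hx, hx'⟩ := Filter.nonempty_of_mem (Filter.inter_mem hSR
      (hr𝒢 Sᶜ (Or.inl ⟨hS.compl, hES⟩)))
    exact hx' hx
  · have hΩ := ((hΦ.forall_left (k := k)).swap.exists_and hΘ).not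
    have hb : #(range b) < κ := (h𝕄.small_of_countable _).mk_range_lt b
    have hdef := hΩ.left (A := range b) (y := b) fun i => ⟨i, rfl⟩
    have hT := hdef.preimage_comp fun t : Fin k × ξ => ((t.1 : ℕ), t.2)
    have := hr𝒢 _ (Or.inr ⟨range b, _, k, ⟨hb, hT, fun I hI => ?_⟩, rfl⟩)
    · obtain ⟨y, ⟨x, hx, hxy⟩, hy⟩ := Filter.nonempty_of_mem (Filter.inter_mem this hΘr)
      exact hx ⟨y, fun j => hxy j j.2, hy⟩
    · exact ((hq'.2 _ subset_union_left (h𝕄.mk_union_lt hM hb) (fun i => I i)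
        (hI.comp Fin.val_strictMono)).mem_iff (hdef.mono subset_union_right)).2 hcon

end Copies

/-! ### Amalgamation against nice types and under a chain condition. -/

section Core

variable {L : FirstOrder.Language.{u, v}} {𝕄 : Type w} [L.Structure 𝕄] [Nonempty 𝕄]
  {κ : Cardinal.{w}} {ξ η ζ : Type*} [Finite ξ] [Finite η] [Finite ζ]
  {Φ : (ξ → 𝕄) → (η → 𝕄) → Prop} {Ψ : (ξ → 𝕄) → (ζ → 𝕄) → Prop}

theorem IsIndiscernible.mono {α : Type*} {A B : Set 𝕄} {I : ℕ → α → 𝕄}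
    (h : IsIndiscernible L B I) (hAB : A ⊆ B) : IsIndiscernible L A I :=
  fun n f g hf hg => (h n f g hf hg).mono hAB

theorem IsIndiscernible.mem {α : Type*} {A : Set 𝕄} {I : ℕ → α → 𝕄} (h : IsIndiscernible L A I)
    {S : Set (α → 𝕄)} (hS : A.Definable L S) {i : ℕ} (hi : I i ∈ S) (j : ℕ) : I j ∈ S :=
  (sameType_iff.1 ((h 1 (fun _ => i) (fun _ => j) (Subsingleton.strictMono _)
    (Subsingleton.strictMono _)).comp fun a : α => ((0 : Fin 1), a)) S hS).1 hi

theorem IsIndiscernible.sameTypeSeq {α : Type*} {A : Set 𝕄} {I J : ℕ → α → 𝕄}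
    (hI : IsIndiscernible L A I) (h : SameTypeSeq L A I J) : IsIndiscernible L A J :=
  fun n f g hf hg => ((SameType.comp h fun x : Fin n × α => (f x.1, x.2)).symm.trans
    (hI n f g hf hg)).trans (SameType.comp h fun x : Fin n × α => (g x.1, x.2))

theorem Nice.power (h𝕄 : IsMonster L 𝕄 κ) {M : Set 𝕄} (hM : #M < κ) {q : GlobalType L 𝕄 ξ}
    {r : GlobalType L 𝕄 η} (h : Nice κ M r q Φ) {k : ℕ} {q' : GlobalType L 𝕄 (Fin k × ξ)}
    (hq' : IsPower κ M q q') : Nice κ M r q' fun x y => ∀ j, Φ (fun i => x (j, i)) y := by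
  intro C hC
  obtain ⟨a, ha, I, hI, hIa⟩ := h C hC
  exact ⟨a, ha, _, hq'.isMorleyOn h𝕄 (h𝕄.small_of_countable _) subset_union_left
    (h𝕄.mk_union_lt hM hC) hI, fun j l => hIa (k * j + l)⟩

/-- As in `exists_and_mem_typeFilter`, but Φ(·, a) need not be in `q`. So the b's and c's are chosen
first, with c_n generic over b_0, …, b_n, and niceness fits each a_n in afterwards. -/
theorem Nice.exists_and_mem (h𝕄 : IsMonster L 𝕄 κ) (hN : IsNSOP L 𝕄 3) {M : Set 𝕄}
    (hM : #M < κ) {q : GlobalType L 𝕄 ξ} {r : GlobalType L 𝕄 η} (hq : AutInvariant M q)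
    (hr : AutInvariant M r) (hΦ : DefRel L Φ) (hΨ : DefRel L Ψ) (hnice : Nice κ M r q Φ)
    {J : ℕ → ξ → 𝕄} (hJ : IsMorleyOn q M J) {b : ζ → 𝕄} (hb : ∀ i, Ψ (J i) b) :
    {y | ∃ x, Φ x y ∧ Ψ x b} ∈ typeFilter r := by
  refine (rel_or_not r (hΦ.exists_and hΨ)).resolve_right fun hθ => ?_
  have hξ := h𝕄.small_of_countable ξ
  obtain ⟨f, hf⟩ := exists_seq_of_forall_exists (X := (ξ → 𝕄) × (ζ → 𝕄))
    (fun n g x => (∃ σ : 𝕄 ≃[L] 𝕄, Fixes M σ ∧ (∀ i, σ (b i) = x.2 i) ∧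
        ∀ (i : Fin n) k, σ (J i k) = (g i).1 k) ∧
      RealizesOver q ((M ∪ (range fun t : Fin n × ζ => (g t.1).2 t.2) ∪ range x.2) ∪
        range fun t : Fin n × ξ => (g t.1).1 t.2) x.1) (fun n g hg => by
    have hc : IsMorleyOn q M fun i => (g i).1 := fun i => (hg i).2.mono <| by
      rintro y (hy | ⟨j, hj, k, rfl⟩)
      exacts [Or.inl (Or.inl (Or.inl hy)), Or.inr ⟨(⟨j, hj⟩, k), rfl⟩]
    obtain ⟨σ, hσ, hσJ⟩ := (hJ.comp (Fin.val_strictMono (n := n))).exists_equiv_fin h𝕄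
      hξ hM hq hc
    obtain ⟨x, hx⟩ := h𝕄.exists_realizesOver hξ q
      (h𝕄.mk_union_lt (h𝕄.mk_union_lt (h𝕄.mk_union_lt hM
        (h𝕄.mk_before_lt (h𝕄.small_of_countable _) fun i => (g i).2))
        ((h𝕄.small_of_countable ζ).mk_range_lt fun i => σ (b i)))
        (h𝕄.mk_before_lt hξ fun i => (g i).1))
    exact ⟨(x, fun i => σ (b i)), ⟨σ, hσ, fun _ => rfl, hσJ⟩, hx⟩)
  have hbθ : ∀ n, {y | ¬ ∃ x, Φ x y ∧ Ψ x (f n).2} ∈ typeFilter r := fun n => by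
    obtain ⟨⟨σ, hσ, hσb, -⟩, -⟩ := hf n
    have h := hr.rel_map (hΦ.exists_and hΨ).not hσ hθ
    simpa only [hσb] using h
  -- The tail c_{n+1}, c_{n+2}, … is Morley over `C`, so it is conjugate over MC to the sequence
  -- given by niceness, and the realization of `r` is moved along.
  have ha : ∀ n, ∃ a, (∀ i ≤ n, ¬ ∃ x, Φ x a ∧ Ψ x (f i).2) ∧ ∀ j, n < j → Φ (f j).1 a := by
    intro n
    let C : Set 𝕄 := range fun t : Fin (n + 1) × ζ => (f t.1).2 t.2
    have hC : #C < κ := h𝕄.mk_before_lt (h𝕄.small_of_countable _) fun i : Fin (n + 1) => (f i).2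
    obtain ⟨a, ha, I, hI, hIa⟩ := hnice C hC
    have hc : IsMorleyOn q (M ∪ C) fun j => (f (n + 1 + j)).1 := fun j => (hf _).2.mono <| by
      rintro y ((hy | ⟨⟨i, l⟩, rfl⟩) | ⟨i, hi, k, rfl⟩)
      · exact Or.inl (Or.inl (Or.inl hy))
      · exact Or.inl (Or.inl (Or.inr ⟨(⟨i, by omega⟩, l), rfl⟩))
      · exact Or.inr ⟨(⟨n + 1 + i, by omega⟩, k), rfl⟩
    obtain ⟨σ, hσ, hσI⟩ := h𝕄.exists_equiv_seq hξ (h𝕄.mk_union_lt hM hC)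
      (hI.sameTypeSeq h𝕄 hξ (h𝕄.mk_union_lt hM hC) (hq.mono subset_union_left) hc)
    have ha' := ha.of_sameType (hσ.sameType a)
    refine ⟨fun i => σ (a i), fun i hi => ?_, fun j hj => ?_⟩
    · exact ha'.rel (hΦ.exists_and hΨ).not (fun l => Or.inr ⟨(⟨i, by omega⟩, l), rfl⟩) (hbθ i)
    · obtain ⟨j, rfl⟩ := Nat.exists_eq_add_of_lt hj
      have := (hΦ.map_iff σ _ _).2 (hIa j)
      simp only [hσI] at this
      rwa [Nat.add_right_comm] at this
  choose a haθ haΦ using ha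
  have hcb : ∀ i j, i < j → Ψ (f i).1 (f j).2 := fun i j hij => by
    obtain ⟨⟨σ, hσ, hσb, hσc⟩, -⟩ := hf j
    have := (hΨ.map_iff σ _ _).2 (hb i)
    simp only [hσb, hσc ⟨i, hij⟩] at this
    exact this
  obtain ⟨i, j, hij, h⟩ := hN.not_inconsistent hΦ hΨ a (fun n => (f n).2) (fun n => (f n).1)
    (fun i j hij => haΦ i j hij) hcb
  exact haθ j i hij.le h

/-- By indiscernibility a formula over MC true of the first k-block of `J` holds along all blocks,
so `Nice.exists_and_mem` for the k-th power of `q` handles each finite fragment. -/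
theorem Nice.exists_sameTypeSeq (h𝕄 : IsMonster L 𝕄 κ) (hN : IsNSOP L 𝕄 3) {M C : Set 𝕄}
    (hM : #M < κ) (hC : #C < κ) {q : GlobalType L 𝕄 ξ} {r : GlobalType L 𝕄 η}
    (hq : AutInvariant M q) (hr : AutInvariant M r) (hΦ : DefRel L Φ) (hnice : Nice κ M r q Φ)
    {J : ℕ → ξ → 𝕄} (hJ : IsMorleyOn q M J) (hJC : IsIndiscernible L (M ∪ C) J) {a : η → 𝕄}
    (ha : RealizesOver r (M ∪ C) a) :
    ∃ J', SameTypeSeq L (M ∪ C) J J' ∧ ∀ j, Φ (J' j) a := by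
  refine h𝕄.exists_sameTypeSeq (h𝕄.small_of_countable ξ) (h𝕄.mk_union_lt hM hC)
    ((h𝕄.small_of_countable η).mk_range_lt a) J (Y := {x | Φ x a}) (hΦ.left fun i => ⟨i, rfl⟩)
    fun k T hT hJT => ?_
  obtain ⟨n, b, Ψ, hΨ, hb, rfl⟩ := exists_defRel_of_definable hT
  obtain ⟨q', hq'⟩ := h𝕄.exists_isPower (h𝕄.small_of_countable ξ) hM hq k
  have := (hnice.power h𝕄 hM hq').exists_and_mem h𝕄 hN hM hq'.1 hr hΦ.forall_left hΨ
    (hq'.isMorleyOn h𝕄 (h𝕄.small_of_countable _) subset_rfl hM hJ) (b := b) fun i =>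
      (sameType_iff.1 (hJC k (fun i => i) (fun x : Fin k => k * i + (x : ℕ)) Fin.val_strictMono
        fun x y hxy => Nat.add_lt_add_left hxy _) _ hT).1 hJT
  obtain ⟨x, h1, h2⟩ := ha.rel (hΦ.forall_left.exists_and hΨ) hb this
  exact ⟨x, h2, h1⟩

theorem exists_and_of_invariant (h𝕄 : IsMonster L 𝕄 κ) (hN : IsNSOP L 𝕄 3)
    (M : L.ElementarySubstructure 𝕄) (hM : #M < κ) {q : GlobalType L 𝕄 ξ}
    (hq : AutInvariant (M : Set 𝕄) q) (hΦ : DefRel L Φ) (hΨ : DefRel L Ψ) {a : η → 𝕄} {b : ζ → 𝕄}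
    {J : ℕ → ξ → 𝕄} (hJ : IsMorleyOn q (M : Set 𝕄) J) (hJb : ∀ j, Ψ (J j) b)
    (hK : ∀ t : GlobalType L 𝕄 η, AutInvariant (M : Set 𝕄) t → ∀ A : ℕ → η → 𝕄,
      IsMorleyOn t (M : Set 𝕄) A → A 0 = a → ∀ n : ℕ, ∃ I : ℕ → ξ → 𝕄,
        IsMorleyOn q (M : Set 𝕄) I ∧ ∀ i < n, ∀ j, Φ (I j) (A i))
    {r : GlobalType L 𝕄 η} (hr : AutInvariant (M : Set 𝕄) r)
    (hra : RealizesOver r ((M : Set 𝕄) ∪ range b) a) : ∃ x, Φ x a ∧ Ψ x b := by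
  obtain ⟨A, hA0, hA⟩ := h𝕄.exists_morley (h𝕄.small_of_countable _) hM r
    (hra.mono subset_union_left)
  have := (nice_of_isMorleyOn h𝕄 hN M hM hq hr hΦ hA (hK r hr A hA hA0)).exists_and_mem h𝕄 hN hM
    hq hr hΦ hΨ hJ hJb
  exact hra.rel (hΦ.exists_and hΨ) (fun i => Or.inr ⟨i, rfl⟩) this

/-- Splits off the first term of a reservoir sequence and re-extracts the tail, so that a recursion
can continue with the enlarged base. -/
theorem IsIndiscernible.exists_shift (h𝕄 : IsMonster L 𝕄 κ) {M Db D : Set 𝕄}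
    (hM : M ⊆ Db) (hDb : Db ⊆ D) (hD : #D < κ) {s : GlobalType L 𝕄 ζ} (hs : AutInvariant M s)
    {B : ℕ → ζ → 𝕄} (hB : IsMorleyOn s Db B) {S : Set (ζ → 𝕄)} (hS : D.Definable L S)
    (hBS : ∀ j, B j ∈ S) : ∃ (b : ζ → 𝕄) (B' : ℕ → ζ → 𝕄), RealizesOver s Db b ∧ b ∈ S ∧
      IsMorleyOn s (Db ∪ range b) B' ∧ IsIndiscernible L (D ∪ range b) B' ∧ ∀ j, B' j ∈ S := by
  have hζ := h𝕄.small_of_countable ζ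
  have hDb' : #Db < κ := (mk_le_mk_of_subset hDb).trans_lt hD
  have hb : #(range (B 0)) < κ := hζ.mk_range_lt _
  have hs' : AutInvariant (Db ∪ range (B 0)) s := hs.mono (hM.trans subset_union_left)
  have hB' : IsMorleyOn s (Db ∪ range (B 0)) fun j => B (j + 1) := fun j => (hB (j + 1)).mono <| by
    rintro y ((hy | ⟨l, rfl⟩) | ⟨i, hi, l, rfl⟩)
    exacts [Or.inl hy, Or.inr ⟨0, j.succ_pos, l, rfl⟩, Or.inr ⟨i + 1, Nat.succ_lt_succ hi, l, rfl⟩]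
  obtain ⟨B', h1, h2, h3⟩ := (hB'.isIndiscernible h𝕄 hζ (h𝕄.mk_union_lt hDb' hb)
    hs').exists_indiscernible h𝕄 hζ (union_subset_union_left _ hDb) (h𝕄.mk_union_lt hD hb)
  exact ⟨B 0, B', (hB 0).mono subset_union_left, hBS 0,
    hB'.of_sameTypeSeq h𝕄 hζ (h𝕄.mk_union_lt hDb' hb) hs' h2, h1,
    h3 S (hS.mono subset_union_left) fun j => hBS _⟩

/-- Alternating sequences in two types, one of which is `Nice` over the other. -/
theorem Nice.exists_alternating (h𝕄 : IsMonster L 𝕄 κ) (hN : IsNSOP L 𝕄 3) {M : Set 𝕄}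
    (hM : #M < κ) {s : GlobalType L 𝕄 ζ} {t : GlobalType L 𝕄 η}
    (hs : AutInvariant M s) (ht : AutInvariant M t) {Θ : (ζ → 𝕄) → (η → 𝕄) → Prop}
    (hΘ : DefRel L Θ) (hnice : Nice κ M t s Θ) :
    ∃ (a : ℕ → η → 𝕄) (b : ℕ → ζ → 𝕄), (∀ i j, i ≤ j → Θ (b j) (a i)) ∧ IsMorleyOn s M b ∧
      ∀ n, RealizesOver t ((M ∪ range fun x : Fin n × ζ => b x.1 x.2) ∪
        range fun x : Fin n × η => a x.1 x.2) (a n) := by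
  have hζ := h𝕄.small_of_countable ζ
  have hη := h𝕄.small_of_countable η
  -- The recursion carries a reservoir B for future b's: Morley in `s` over the b's so far,
  -- indiscernible over everything so far, and related to all a's so far. B is not required to be
  -- Morley over the a's.
  obtain ⟨f, hf⟩ := exists_seq_of_forall_exists (X := (η → 𝕄) × (ζ → 𝕄))
    (fun n g x => RealizesOver t ((M ∪ range fun t : Fin n × ζ => (g t.1).2 t.2) ∪
          range fun t : Fin n × η => (g t.1).1 t.2) x.1 ∧
      RealizesOver s (M ∪ range fun t : Fin n × ζ => (g t.1).2 t.2) x.2 ∧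
      (∀ i, Θ x.2 (g i).1) ∧ Θ x.2 x.1 ∧
      ∃ B : ℕ → ζ → 𝕄, IsMorleyOn s (M ∪ (range fun t : Fin n × ζ => (g t.1).2 t.2) ∪ range x.2) B ∧
        IsIndiscernible L (((M ∪ range fun t : Fin n × ζ => (g t.1).2 t.2) ∪
          (range fun t : Fin n × η => (g t.1).1 t.2)) ∪ range x.1 ∪ range x.2) B ∧
        ∀ j, (∀ i, Θ (B j) (g i).1) ∧ Θ (B j) x.1)
    (fun n g hg => by
      set Db := M ∪ range fun t : Fin n × ζ => (g t.1).2 t.2 with hDb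
      set D := Db ∪ range fun t : Fin n × η => (g t.1).1 t.2 with hD
      have hDb' : #Db < κ := h𝕄.mk_union_lt hM (h𝕄.mk_before_lt hζ fun i => (g i).2)
      have hD' : #D < κ := h𝕄.mk_union_lt hDb' (h𝕄.mk_before_lt hη fun i => (g i).1)
      have hMDb : M ⊆ Db := subset_union_left
      have hDbD : Db ⊆ D := subset_union_left
      have hMD : M ∪ D = D := union_eq_right.2 (hMDb.trans hDbD)
      obtain ⟨B, hB, hBD, hBg⟩ : ∃ B : ℕ → ζ → 𝕄, IsMorleyOn s Db B ∧ IsIndiscernible L D B ∧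
          ∀ j i, Θ (B j) (g i).1 := by
        rcases n with _ | n
        · obtain ⟨B, hB⟩ := h𝕄.exists_morley' hζ hDb' s
          refine ⟨B, hB, (hB.isIndiscernible h𝕄 hζ hDb' (hs.mono hMDb)).mono ?_,
            fun j i => i.elim0⟩
          rintro x (hx | ⟨⟨i, -⟩, -⟩)
          exacts [hx, i.elim0]
        · obtain ⟨-, -, -, -, B, h1, h2, h3⟩ := hg (Fin.last n)
          refine ⟨B, h1.mono ?_, h2.mono ?_, fun j i => ?_⟩
          · rintro x (hx | ⟨⟨i, l⟩, rfl⟩)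
            · exact Or.inl (Or.inl hx)
            · induction i using Fin.lastCases with
              | last => exact Or.inr ⟨l, rfl⟩
              | cast i => exact Or.inl (Or.inr ⟨(i, l), rfl⟩)
          · rintro x ((hx | ⟨⟨i, l⟩, rfl⟩) | ⟨⟨i, l⟩, rfl⟩)
            · exact Or.inl (Or.inl (Or.inl (Or.inl hx)))
            · induction i using Fin.lastCases with
              | last => exact Or.inr ⟨l, rfl⟩
              | cast i => exact Or.inl (Or.inl (Or.inl (Or.inr ⟨(i, l), rfl⟩)))
            · induction i using Fin.lastCases with
              | last => exact Or.inl (Or.inr ⟨l, rfl⟩)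
              | cast i => exact Or.inl (Or.inl (Or.inr ⟨(i, l), rfl⟩))
          · induction i using Fin.lastCases with
            | last => exact (h3 j).2
            | cast i => exact (h3 j).1 i
      obtain ⟨a, ha⟩ := h𝕄.exists_realizesOver hη t hD'
      obtain ⟨B₁, hB₁, hB₁a⟩ := hnice.exists_sameTypeSeq h𝕄 hN hM hD' hs ht hΘ (hB.mono hMDb)
        (by rwa [hMD]) (a := a) (by rwa [hMD])
      rw [hMD] at hB₁
      have hgdef : D.Definable L {x | ∀ i, Θ x (g i).1} := definable_forall_finite fun i =>
        hΘ.left fun l => Or.inr ⟨(i, l), rfl⟩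
      have hB₁g : ∀ j i, Θ (B₁ j) (g i).1 := fun j => hB₁.mem hgdef (hBg j)
      have hB₁M := hB.of_sameTypeSeq h𝕄 hζ hDb' (hs.mono hMDb) (SameType.mono hB₁ hDbD)
      obtain ⟨b, B', h1, h2, h3, h4, h5⟩ := IsIndiscernible.exists_shift h𝕄 hMDb
        (hDbD.trans (subset_union_left (t := range a)))
        (h𝕄.mk_union_lt hD' (hη.mk_range_lt a)) hs hB₁M
        (S := {x | ∀ i, Θ x (g i).1} ∩ {x | Θ x a})
        ((hgdef.mono subset_union_left).inter (hΘ.left fun i => Or.inr ⟨i, rfl⟩))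
        fun j => ⟨hB₁g j, hB₁a j⟩
      exact ⟨(a, b), ha, h1, h2.1, h2.2, B', h3, h4, h5⟩)
  refine ⟨fun n => (f n).1, fun n => (f n).2, fun i j hij => ?_,
    isMorleyOn_of_range fun n => (hf n).2.1, fun n => (hf n).1⟩
  rcases hij.lt_or_eq with h | rfl
  · exact (hf j).2.2.1 ⟨i, h⟩
  · exact (hf i).2.2.2.1

/-- Induction on `n`: make the sequence indiscernible over the earlier b's, then use niceness to
absorb the next one without changing the type over them. -/
theorem Nice.exists_isMorleyOn_forall (h𝕄 : IsMonster L 𝕄 κ) (hN : IsNSOP L 𝕄 3) {M : Set 𝕄}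
    (hM : #M < κ) {q : GlobalType L 𝕄 ξ} {s : GlobalType L 𝕄 ζ} (hq : AutInvariant M q)
    (hs : AutInvariant M s) (hΨ : DefRel L Ψ) (hnice : Nice κ M s q Ψ) {b : ℕ → ζ → 𝕄}
    (hb : IsMorleyOn s M b) (n : ℕ) :
    ∃ J : ℕ → ξ → 𝕄, IsMorleyOn q M J ∧ ∀ i < n, ∀ j, Ψ (J j) (b i) := by
  have hξ := h𝕄.small_of_countable ξ
  induction n with
  | zero =>
    obtain ⟨J, hJ⟩ := h𝕄.exists_morley' hξ hM q
    exact ⟨J, hJ, fun i hi => absurd hi i.not_lt_zero⟩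
  | succ n ih =>
    obtain ⟨J, hJ, hJb⟩ := ih
    let C : Set 𝕄 := range fun t : Fin n × ζ => b t.1 t.2
    have hC : #C < κ := h𝕄.mk_before_lt (h𝕄.small_of_countable ζ) fun i : Fin n => b i
    have hdef : (M ∪ C).Definable L {x | ∀ i : Fin n, Ψ x (b i)} := definable_forall_finite fun i =>
      hΨ.left fun l => Or.inr ⟨(i, l), rfl⟩
    obtain ⟨J₁, h1, h2, h3⟩ := (hJ.isIndiscernible h𝕄 hξ hM hq).exists_indiscernible h𝕄 hξ
      (subset_union_left : M ⊆ M ∪ C) (h𝕄.mk_union_lt hM hC)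
    have hJ₁ := hJ.of_sameTypeSeq h𝕄 hξ hM hq h2
    obtain ⟨J₂, h4, h5⟩ := hnice.exists_sameTypeSeq h𝕄 hN hM hC hq hs hΨ hJ₁ h1 (a := b n)
      ((hb n).mono (union_subset_union_right _ (by
        rintro _ ⟨⟨i, l⟩, rfl⟩
        exact ⟨i, i.2, l, rfl⟩)))
    refine ⟨J₂, hJ₁.of_sameTypeSeq h𝕄 hξ hM hq (SameType.mono h4 subset_union_left),
      fun i hi j => ?_⟩
    rcases (Nat.lt_succ_iff.1 hi).lt_or_eq with hi | rfl
    · exact h4.mem hdef (h3 _ hdef (fun j i => hJb i i.2 j) j) ⟨i, hi⟩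
    · exact h5 j

/-- The chain condition spreads a failure at b along a Morley sequence in a nice type `s`. Failure
then counts as a relation that holds along a Morley sequence, so it has a nice type `t` of its own;
alternating `t` and `s` yields failure for i ≤ j, while niceness over `q` supplies the c_n's. -/
theorem exists_and_of_chain (h𝕄 : IsMonster L 𝕄 κ) (hN : IsNSOP L 𝕄 3)
    (hsymm : IsSymmetricRel L κ (ConantDivIndep L (𝕄 := 𝕄)))
    (M : L.ElementarySubstructure 𝕄) (hM : #M < κ) {q : GlobalType L 𝕄 ξ}
    (hq : AutInvariant (M : Set 𝕄) q) (hΦ : DefRel L Φ) (hΨ : DefRel L Ψ) {a : η → 𝕄} {b : ζ → 𝕄}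
    {J : ℕ → ξ → 𝕄} (hJ : IsMorleyOn q (M : Set 𝕄) J) (hJb : ∀ j, Ψ (J j) b)
    (hK : ∀ t : GlobalType L 𝕄 η, AutInvariant (M : Set 𝕄) t → ∀ A : ℕ → η → 𝕄,
      IsMorleyOn t (M : Set 𝕄) A → A 0 = a → ∀ n : ℕ, ∃ I : ℕ → ξ → 𝕄,
        IsMorleyOn q (M : Set 𝕄) I ∧ ∀ i < n, ∀ j, Φ (I j) (A i))
    (hchain : ∀ s : GlobalType L 𝕄 ζ, AutInvariant (M : Set 𝕄) s → RealizesOver s (M : Set 𝕄) b →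
      ∃ B : ℕ → ζ → 𝕄, IsMorleyOn s (M : Set 𝕄) B ∧ B 0 = b ∧
        IsIndiscernible L ((M : Set 𝕄) ∪ range a) B) : ∃ x, Φ x a ∧ Ψ x b := by
  by_contra hab
  obtain ⟨s, hs, hsb, hsq⟩ := exists_nice h𝕄 hN hsymm M hM hq hΨ hJ hJb
  obtain ⟨B, hB, hB0, hBa⟩ := hchain s hs hsb
  have hθ := (hΦ.exists_and hΨ).not.swap
  have hBθ : ∀ j, ¬ ∃ x, Φ x a ∧ Ψ x (B j) := hBa.mem (i := 0) (hθ.left fun i => Or.inr ⟨i, rfl⟩)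
    (by rw [hB0]; exact hab)
  -- Here `s` plays the role of `q`, and the relation is inconsistency of the two formulas.
  obtain ⟨t, ht, hta, hts⟩ := exists_nice h𝕄 hN hsymm M hM hs hθ hB hBθ
  obtain ⟨a', b', hθ', hb', ha'⟩ := hts.exists_alternating h𝕄 hN hM hs ht hθ
  obtain ⟨A, hA0, hA⟩ := h𝕄.exists_morley (h𝕄.small_of_countable _) hM t hta
  suffices h : ∀ n N, ∃ c, (∀ i < n, Ψ c (b' i)) ∧ ∀ j < N, Φ c (a' (n + 1 + j)) by
    obtain ⟨c, hca, hcb⟩ := h𝕄.exists_seq_of_fin hΨ hΦ b' a' h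
    obtain ⟨i, j, hij, x, h1, h2⟩ := hN.not_inconsistent hΨ hΦ b' a' c hca hcb
    exact hθ' i j hij.le ⟨x, h2, h1⟩
  intro n N
  obtain ⟨t', ht'⟩ := h𝕄.exists_isPower (h𝕄.small_of_countable η) hM ht N
  obtain ⟨J', hJ', hJ'b⟩ := hsq.exists_isMorleyOn_forall h𝕄 hN hM hq hs hΨ hb' n
  have hΦN := hΦ.forall_right (k := N)
  -- The first `m` blocks of length `N` use the first `N * m` terms of the Morley sequence of a.
  have hnice := nice_of_isMorleyOn h𝕄 hN M hM hq ht'.1 hΦN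
    (ht'.isMorleyOn h𝕄 (h𝕄.small_of_countable _) subset_rfl hM hA) fun m => by
      obtain ⟨I, hI, hIA⟩ := hK t ht A hA hA0 (N * m)
      refine ⟨I, hI, fun i hi j l => hIA (N * i + l) ?_ j⟩
      calc N * i + l < N * i + N := Nat.add_lt_add_left l.2 _
        _ = N * (i + 1) := (Nat.mul_succ N i).symm
        _ ≤ N * m := Nat.mul_le_mul_left N hi
  have hmem := hnice.exists_and_mem h𝕄 hN hM hq ht'.1 hΦN (hΨ.forall_right (k := n)) hJ'
    (b := fun x => b' x.1 x.2) fun j i => hJ'b i i.2 j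
  let C : Set 𝕄 := range fun t : Fin n × ζ => b' t.1 t.2
  have hC : #C < κ := h𝕄.mk_before_lt (h𝕄.small_of_countable ζ) fun i : Fin n => b' i
  have hblock := ht'.2 ((M : Set 𝕄) ∪ C) subset_union_left (h𝕄.mk_union_lt hM hC)
    (fun i => a' (n + 1 + i)) fun i => (ha' (n + 1 + i)).mono <| by
      rintro y ((hy | ⟨⟨j, l⟩, rfl⟩) | ⟨j, hj, k, rfl⟩)
      · exact Or.inl (Or.inl hy)
      · exact Or.inl (Or.inr ⟨(⟨j, by omega⟩, l), rfl⟩)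
      · exact Or.inr ⟨(⟨n + 1 + j, by have : (j : ℕ) < i := hj; omega⟩, k), rfl⟩
  obtain ⟨c, h1, h2⟩ := hblock.rel (hΦN.exists_and (hΨ.forall_right (k := n)))
    (fun i => Or.inr ⟨i, rfl⟩) hmem
  exact ⟨c, fun i hi => h2 ⟨i, hi⟩, fun j hj => h1 ⟨j, hj⟩⟩

end Core

/-! ### From Kim-independence and compactness to the theorem. -/

section Main

variable {L : FirstOrder.Language.{u, v}} {𝕄 : Type w} [L.Structure 𝕄] [Nonempty 𝕄]
  {κ : Cardinal.{w}} {ξ η ζ : Type*} [Finite ξ] [Finite η] [Finite ζ]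
  {Φ : (ξ → 𝕄) → (η → 𝕄) → Prop} {Ψ : (ξ → 𝕄) → (ζ → 𝕄) → Prop}

/-- Kim-independence gives consistency of `tp(I/a)` along Morley sequences of `a`. -/
theorem KimIndep.exists_isMorleyOn (h𝕄 : IsMonster L 𝕄 κ) {M A B : Set 𝕄} (hM : #M < κ)
    (hK : KimIndep L M A B) {q : GlobalType L 𝕄 ξ} (hq : AutInvariant M q) {I : ℕ → ξ → 𝕄}
    (hI : IsMorleyOn q M I) (hIA : ∀ j i, I j i ∈ A) (hΦ : DefRel L Φ) {a : η → 𝕄}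
    (ha : ∀ i, a i ∈ M ∪ B) (hIa : ∀ j, Φ (I j) a) {t : GlobalType L 𝕄 η} (ht : AutInvariant M t)
    {a' : ℕ → η → 𝕄} (ha' : IsMorleyOn t M a') (ha0 : a' 0 = a) (n : ℕ) :
    ∃ I' : ℕ → ξ → 𝕄, IsMorleyOn q M I' ∧ ∀ i < n, ∀ j, Φ (I' j) (a' i) := by
  have hη := h𝕄.small_of_countable η
  have hξ := h𝕄.small_of_countable ξ
  obtain ⟨I', hI', hI'a⟩ := h𝕄.exists_sameTypeSeq hξ hM
    (h𝕄.mk_before_lt hη fun i : Fin n => a' i) I (Y := {x | ∀ i : Fin n, Φ x (a' i)})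
    (definable_forall_finite fun i => hΦ.left fun l => ⟨(i, l), rfl⟩) fun k T hT hIT => by
      obtain ⟨m, c, Θ, hΘ, hc, rfl⟩ := exists_defRel_of_definable hT
      have hΩ : DefRel L fun (x : Fin k × ξ → 𝕄) (y : η ⊕ Fin m → 𝕄) =>
          Θ x (fun i => y (.inr i)) ∧ ∀ j, Φ (fun i => x (j, i)) fun i => y (.inl i) :=
        (hΘ.definable Sum.inl fun i => Sum.inr (Sum.inr i)).inter
          (hΦ.forall_left.definable Sum.inl fun i => Sum.inr (Sum.inl i))
      let f : η ⊕ Fin m → η ⊕ M := Sum.map id fun i => ⟨c i, hc i⟩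
      obtain ⟨r, hr, htr⟩ := h𝕄.exists_marginal hη hM ht f
      -- Length n + 1 ensures a term at index 0 even when n = 0; that term yields the condition over
      -- `M`.
      obtain ⟨x, hx⟩ := hK.exists_of_isMorleyOn h𝕄 hM hΩ (x := fun t => I t.1 t.2)
        (y := fun i => Sum.elim a Subtype.val (f i)) (fun i => hIA _ _)
        (by rintro (i | i); exacts [ha i, Or.inl (hc i)]) ⟨hIT, fun j => hIa j⟩ hr
        (IsMorleyOn.marginal h𝕄 hη hM htr ha') (by rw [ha0]) (n + 1)
      exact ⟨x, (hx 0 n.succ_pos).1, fun j i => (hx i (i.2.trans n.lt_succ_self)).2 j⟩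
  exact ⟨I', hI.of_sameTypeSeq h𝕄 hξ hM hq hI', fun i hi j => hI'a j ⟨i, hi⟩⟩

theorem Avoids.mono {D : ∀ {m : ℕ}, ParamFormula L 𝕄 m → Prop} {M A A' B B' : Set 𝕄}
    (h : Avoids D M A B) (hA : A' ⊆ A) (hB : B' ⊆ B) : Avoids D M A' B' :=
  fun m a φ ha hφ => h m a φ (fun i => hA (ha i)) fun j => union_subset_union_right M hB (hφ j)

/-- The chain condition yields indiscernible Morley sequences starting with a given tuple. -/
theorem ChainCondition.exists_isMorleyOn (h𝕄 : IsMonster L 𝕄 κ)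
    {R : Set 𝕄 → Set 𝕄 → Set 𝕄 → Prop} (hR : ChainCondition (L := L) κ R)
    (M : L.ElementarySubstructure 𝕄) (hM : #M < κ) {A B : Set 𝕄} (hA : #A < κ) (hB : #B < κ)
    (hAB : R M A B) {s : GlobalType L 𝕄 B} (hs : AutInvariant (M : Set 𝕄) s)
    (hsB : RealizesOver s (M : Set 𝕄) ((↑) : B → 𝕄)) :
    ∃ I : ℕ → B → 𝕄, IsMorleyOn s (M : Set 𝕄) I ∧ I 0 = (↑) ∧
      IsIndiscernible L ((M : Set 𝕄) ∪ A) I := by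
  have hB' := SmallIndex.of_mk_lt hB
  obtain ⟨I, hI0, hI⟩ := h𝕄.exists_morley hB' hM s hsB
  obtain ⟨I', hI', hind, -⟩ := hR M hM A B hA hB hAB I hI0 ⟨s, (isInvariant_iff h𝕄 hM s).2 hs, hI⟩
  refine ⟨I', hI.of_sameTypeSeq h𝕄 hB' hM hs (SameType.mono hI'.symm subset_union_left),
    funext fun i => ?_, hind⟩
  have h0 : I 0 i = i := congrFun hI0 i
  refine (SameType.apply_eq (SameType.symm hI') (0, i) ?_).trans h0
  exact Or.inr (h0.symm ▸ i.2)

theorem exists_and_of_indep (h𝕄 : IsMonster L 𝕄 κ) (hN : IsNSOP L 𝕄 3)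
    (hsymm : IsSymmetricRel L κ (ConantDivIndep L (𝕄 := 𝕄)))
    (M : L.ElementarySubstructure 𝕄) (hM : #M < κ) {A B : Set 𝕄} (hA : #A < κ) (hB : #B < κ)
    (hAB : InvIndep L (M : Set 𝕄) A B ∨
      (ChainCondition L κ (ForkIndep L (𝕄 := 𝕄)) ∧ ForkIndep L (M : Set 𝕄) A B) ∨
      (ChainCondition L κ (KimIndep L (𝕄 := 𝕄)) ∧ KimIndep L (M : Set 𝕄) A B))
    {q : GlobalType L 𝕄 ξ} (hq : AutInvariant (M : Set 𝕄) q) (hΦ : DefRel L Φ) (hΨ : DefRel L Ψ)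
    {a : η → 𝕄} {b : ζ → 𝕄} (ha : ∀ i, a i ∈ A) (hb : ∀ i, b i ∈ B) {J : ℕ → ξ → 𝕄}
    (hJ : IsMorleyOn q (M : Set 𝕄) J) (hJb : ∀ j, Ψ (J j) b)
    (hK : ∀ t : GlobalType L 𝕄 η, AutInvariant (M : Set 𝕄) t → ∀ A : ℕ → η → 𝕄,
      IsMorleyOn t (M : Set 𝕄) A → A 0 = a → ∀ n : ℕ, ∃ I : ℕ → ξ → 𝕄,
        IsMorleyOn q (M : Set 𝕄) I ∧ ∀ i < n, ∀ j, Φ (I j) (A i)) : ∃ x, Φ x a ∧ Ψ x b := by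
  have hchain : ∀ R : Set 𝕄 → Set 𝕄 → Set 𝕄 → Prop, ChainCondition L κ R →
      R M (range a) (range b) → ∃ x, Φ x a ∧ Ψ x b := by
    intro R hR hab
    have hb' : #(range b) < κ := (h𝕄.small_of_countable ζ).mk_range_lt b
    -- The chain condition speaks of sets, so the tuple `b` is replaced by the enumeration of its
    -- range.
    have hΨ' : DefRel L fun x (z : range b → 𝕄) => Ψ x fun i => z ⟨b i, i, rfl⟩ :=
      hΨ.definable Sum.inl fun i => Sum.inr (⟨b i, i, rfl⟩ : range b)
    exact exists_and_of_chain h𝕄 hN hsymm M hM hq hΦ (b := ((↑) : range b → 𝕄))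
      hΨ' hJ hJb hK fun s hs hsb =>
        hR.exists_isMorleyOn h𝕄 M hM ((h𝕄.small_of_countable η).mk_range_lt a) hb' hab hs hsb
  have ha' : range a ⊆ A := range_subset_iff.2 ha
  have hb' : range b ⊆ B := range_subset_iff.2 hb
  rcases hAB with ⟨r, hr, hrA⟩ | ⟨h1, h2⟩ | ⟨h1, h2⟩
  · obtain ⟨r', hr', h⟩ := h𝕄.exists_marginal (SmallIndex.of_mk_lt hA) hM
      ((isInvariant_iff h𝕄 hM r).1 hr) fun i : η => Sum.inl (⟨a i, ha i⟩ : A)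
    exact exists_and_of_invariant h𝕄 hN M hM hq hΦ hΨ hJ hJb hK hr'
      ((h _ subset_union_left (h𝕄.mk_union_lt hM hB) _ hrA).mono (union_subset_union_right _ hb'))
  · exact hchain _ h1 (h2.mono ha' hb')
  · exact hchain _ h1 (h2.mono ha' hb')

/-- Two definable sets of sequences depend on a common finite set of variables. -/
theorem exists_common_support {α : Type z} {A B : Set 𝕄} {S T : Set (ℕ × α → 𝕄)}
    (hS : A.Definable L S) (hT : B.Definable L T) :
    ∃ (F : Finset (ℕ × α)) (S' T' : Set (F → 𝕄)), A.Definable L S' ∧ B.Definable L T' ∧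
      S = {x | (fun i : F => x i) ∈ S'} ∧ T = {x | (fun i : F => x i) ∈ T'} := by
  classical
  obtain ⟨F, S', hS', rfl⟩ := exists_finset_support hS
  obtain ⟨G, T', hT', rfl⟩ := exists_finset_support hT
  exact ⟨F ∪ G, _, _,
    hS'.preimage_comp fun i : F => (⟨i, Finset.mem_union_left _ i.2⟩ : (F ∪ G : Finset _)),
    hT'.preimage_comp fun i : G => (⟨i, Finset.mem_union_right _ i.2⟩ : (F ∪ G : Finset _)),
    rfl, rfl⟩

/-- Amalgamation of the types of two Morley sequences in the same invariant type. -/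
theorem exists_amalgam (h𝕄 : IsMonster L 𝕄 κ) (hN : IsNSOP L 𝕄 3)
    (hsymm : IsSymmetricRel L κ (ConantDivIndep L (𝕄 := 𝕄)))
    (M : L.ElementarySubstructure 𝕄) (hM : #M < κ) {α : Type z} (hα : SmallIndex κ α)
    {p : GlobalType L 𝕄 α} (hp : AutInvariant (M : Set 𝕄) p)
    {A B : Set 𝕄} (hA : #A < κ) (hB : #B < κ)
    (hAB : InvIndep L (M : Set 𝕄) A B ∨
      (ChainCondition L κ (ForkIndep L (𝕄 := 𝕄)) ∧ ForkIndep L (M : Set 𝕄) A B) ∨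
      (ChainCondition L κ (KimIndep L (𝕄 := 𝕄)) ∧ KimIndep L (M : Set 𝕄) A B))
    {I J : ℕ → α → 𝕄} (hI : IsMorleyOn p (M : Set 𝕄) I) (hJ : IsMorleyOn p (M : Set 𝕄) J)
    (hIA : IsIndiscernible L A I) (hJB : IsIndiscernible L B J)
    (hK : KimIndep L (M : Set 𝕄) (seqSet I) A) :
    ∃ H, SameTypeSeq L A I H ∧ SameTypeSeq L B J H := by
  obtain ⟨y, hy⟩ := h𝕄.exists_mem_of_fip (h𝕄.small_prod (h𝕄.small_of_countable ℕ) hα)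
    (h𝕄.mk_union_lt hA hB)
    (𝒮 := {S | A.Definable L S ∧ (fun t : ℕ × α => I t.1 t.2) ∈ S} ∪
      {S | B.Definable L S ∧ (fun t : ℕ × α => J t.1 t.2) ∈ S})
    (by
      rintro S (⟨hS, -⟩ | ⟨hS, -⟩)
      exacts [hS.mono subset_union_left, hS.mono subset_union_right])
    (by
      intro 𝒯 h𝒯 hfin
      have : ∃ S T : Set (ℕ × α → 𝕄), A.Definable L S ∧ (fun t : ℕ × α => I t.1 t.2) ∈ S ∧
          B.Definable L T ∧ (fun t : ℕ × α => J t.1 t.2) ∈ T ∧ S ∩ T ⊆ ⋂₀ 𝒯 := by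
        induction 𝒯, hfin using Set.Finite.induction_on with
        | empty => exact ⟨univ, univ, definable_univ, mem_univ _, definable_univ, mem_univ _,
            by simp⟩
        | @insert X 𝒯 _ _ ih =>
          obtain ⟨S, T, hS, hIS, hT, hJT, hST⟩ := ih ((subset_insert _ _).trans h𝒯)
          rw [sInter_insert]
          rcases h𝒯 (mem_insert _ _) with ⟨hX, hIX⟩ | ⟨hX, hJX⟩
          · exact ⟨X ∩ S, T, hX.inter hS, ⟨hIX, hIS⟩, hT, hJT,
              fun x hx => ⟨hx.1.1, hST ⟨hx.1.2, hx.2⟩⟩⟩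
          · exact ⟨S, X ∩ T, hS, hIS, hX.inter hT, ⟨hJX, hJT⟩,
              fun x hx => ⟨hx.2.1, hST ⟨hx.1, hx.2.2⟩⟩⟩
      obtain ⟨S, T, hS, hIS, hT, hJT, hST⟩ := this
      obtain ⟨F, S', T', hS', hT', rfl, rfl⟩ := exists_common_support hS hT
      obtain ⟨n, a, Φ, hΦ, ha, rfl⟩ := exists_defRel_of_definable hS'
      obtain ⟨m, b, Ψ, hΨ, hb, rfl⟩ := exists_defRel_of_definable hT'
      let k := F.sup (fun x => x.1) + 1
      have hF : ∀ x : F, x.1.1 < k := fun x => Nat.lt_succ_of_le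
        (Finset.le_sup (f := fun x : ℕ × α => x.1) x.2)
      -- The finitely many relevant coordinates lie in the first `k` terms. Making the same
      -- selection in successive blocks of I and of J gives Morley sequences in one type `q`, and
      -- indiscernibility moves the formulas to all blocks.
      let g : F → (Fin k × α) ⊕ (M : Set 𝕄) := fun x => Sum.inl (⟨x.1.1, hF x⟩, x.1.2)
      obtain ⟨q, hq, hpq⟩ := h𝕄.exists_block_type hα hM hp g
      have hblock : ∀ {C : Set 𝕄} {H : ℕ → α → 𝕄}, IsIndiscernible L C H →
          ∀ {U : Set (F → 𝕄)}, C.Definable L U → (fun i : F => H i.1.1 i.1.2) ∈ U → ∀ j,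
          (selectTuple g fun i => H (k * j + i)) ∈ U := by
        intro C H hH U hU hHU j
        exact (sameType_iff.1 ((hH k (fun i => i) (fun x : Fin k => k * j + (x : ℕ))
          Fin.val_strictMono fun x y hxy => Nat.add_lt_add_left hxy _).comp
            fun x : F => ((⟨x.1.1, hF x⟩ : Fin k), x.1.2)) U hU).1 hHU
      obtain ⟨x, h1, h2⟩ := exists_and_of_indep h𝕄 hN hsymm M hM hA hB hAB hq hΦ hΨ ha hb
        (h𝕄.isMorleyOn_blocks hα subset_rfl hM hpq hJ) (hblock hJB hT' hJT)
        fun t ht a' ha' ha0 n => hK.exists_isMorleyOn h𝕄 hM hq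
          (h𝕄.isMorleyOn_blocks hα subset_rfl hM hpq hI) (fun j i => ⟨_, _, rfl⟩) hΦ
          (fun i => Or.inr (ha i)) (hblock hIA hS' hIS) ht ha' ha0 n
      classical
      refine ⟨fun t => if ht : t ∈ F then x ⟨t, ht⟩ else Classical.arbitrary 𝕄, hST ⟨?_, ?_⟩⟩
      · simpa using h1
      · simpa using h2)
  exact ⟨fun j i => y (j, i), sameType_of_imp fun S hS hIS => hy S (Or.inl ⟨hS, hIS⟩),
    sameType_of_imp fun S hS hJS => hy S (Or.inr ⟨hS, hJS⟩)⟩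

end Main

end Monster

theorem mainTheorem4 {L : FirstOrder.Language.{u, v}} {𝕄 : Type w} [L.Structure 𝕄] [Nonempty 𝕄]
    (κ : Cardinal.{w}) (h𝕄 : Monster.IsMonster L 𝕄 κ)
    (hNSOP : Monster.IsNSOP L 𝕄 3)
    (hsymm : Monster.IsSymmetricRel L κ (Monster.ConantDivIndep L (𝕄 := 𝕄)))
    (M : L.ElementarySubstructure 𝕄) (hM : #M < κ)
    {α : Type w} (hα : #α < κ)
    (p : Monster.GlobalType L 𝕄 α) (hp : Monster.IsInvariant (M : Set 𝕄) p)
    (a b : Set 𝕄) (ha : #a < κ) (hb : #b < κ)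
    (hMa : (M : Set 𝕄) ⊆ a) (hMb : (M : Set 𝕄) ⊆ b)
    (hab : Monster.InvIndep L (M : Set 𝕄) a b ∨
      (Monster.ChainCondition L κ (Monster.ForkIndep L (𝕄 := 𝕄)) ∧
        Monster.ForkIndep L (M : Set 𝕄) a b) ∨
      (Monster.ChainCondition L κ (Monster.KimIndep L (𝕄 := 𝕄)) ∧
        Monster.KimIndep L (M : Set 𝕄) a b))
    (I J : ℕ → α → 𝕄)
    (hI : Monster.IsMorleySeqIn p (M : Set 𝕄) I) (hJ : Monster.IsMorleySeqIn p (M : Set 𝕄) J)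
    (hIa : Monster.IsIndiscernible L a I) (hJb : Monster.IsIndiscernible L b J)
    (hIKa : Monster.KimIndep L (M : Set 𝕄) (Monster.seqSet I) a) :
    ∃ I'' : ℕ → α → 𝕄,
      Monster.SameTypeSeq L a I'' I ∧ Monster.SameTypeSeq L b I'' J ∧
        Monster.ConantDivIndep L (M : Set 𝕄) (Monster.seqSet I'') (a ∪ b) := by
  have hα' := Monster.SmallIndex.of_mk_lt hα
  have hp' := (Monster.isInvariant_iff h𝕄 hM p).1 hp
  have hab' := h𝕄.mk_union_lt ha hb
  obtain ⟨H, hHa, hHb⟩ := Monster.exists_amalgam h𝕄 hNSOP hsymm M hM hα' hp' ha hb hab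
    hI hJ hIa hJb hIKa
  -- H is indiscernible over `a` and over `b` separately, so extraction over their union preserves
  -- both types.
  obtain ⟨K, hK, hHK⟩ := h𝕄.exists_indiscernible hα' hab' H
  have hKa := Monster.SameType.trans hHa ((hIa.sameTypeSeq hHa).sameTypeSeq_of_forall
    fun n S hS => hHK n S (hS.mono Set.subset_union_left))
  have hKb := Monster.SameType.trans hHb ((hJb.sameTypeSeq hHb).sameTypeSeq_of_forall
    fun n S hS => hHK n S (hS.mono Set.subset_union_right))
  have hKM := Monster.IsMorleyOn.of_sameTypeSeq h𝕄 hα' hM hp' hI (Monster.SameType.mono hKa hMa)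
  refine ⟨K, Monster.SameType.symm hKa, Monster.SameType.symm hKb,
    hsymm M hM _ _ hab' (h𝕄.mk_seqSet_lt hα' K) (Monster.IsIndiscernible.conantDivIndep h𝕄 hα' hM
      hp' hKM ?_)⟩
  rwa [Set.union_eq_right.2 (hMa.trans Set.subset_union_left)]
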